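/- Conventions. Oriented links in $S^3$ (possibly empty) are presented by oriented link diagrams in the plane, all invariants are computed from the cube of resolutions of such a diagram (they do not depend on the diagram up to isotopy of the link), and $L\sqcup T$ denotes the split disjoint union, presented by drawing diagrams of $L$ and $T$ side by side. $Kh^{i,q}$ is Khovanov cohomology in homological degree $i$ and quantum degree $q$, and $Sq^1\colon Kh^{i-1,q}(L;\mathbb F_2)\to Kh^{i,q}(L;\mathbb F_2)$ is the Bockstein homomorphism of the Khovanov cochain complex (the connecting homomorphism for $0\to\mathbb Z/2\to\mathbb Z/4\to\mathbb Z/2\to0$). $CKh_{BN}(L)$ is the Bar-Natan complex over $\mathbb F_2$, i.e. the cube complex of the Frobenius algebra $\mathbb F_2[x]/(x^2+x)$, filtered by quantum degree; $CKh_{BN}^{\ge q}$ is its subcomplex of elements of filtration degree at least $q$, and $W(L)\subset Kh_{BN}^0(L)$ is the span of the two canonical classes of the orientation $\mathfrak o$ of $L$ and of the reverse orientation. For $L\neq\emptyset$ and an integer $q\equiv\#\pi_0(L)\pmod 2$ consider $$Kh^{-1,q}(L;\mathbb F_2)\xrightarrow{Sq^1}Kh^{0,q}(L;\mathbb F_2)\xleftarrow{\;p\;}H^0(CKh_{BN}^{\ge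 q}(L))\xrightarrow{\;j\;}Kh_{BN}^0(L),$$ where $p$ and $j$ are induced by the projection to the associated graded piece of degree $q$ and by the inclusion. Call $q$ full if $\dim(\mathrm{im}(j)\cap W(L))\ge2$, and $Sq^1$-full if $\dim\big(j(p^{-1}(\mathrm{im}\,Sq^1))\cap W(L)\big)\ge2$. Put $$s(L)=\max\{q: q\text{ is full}\}+1,\qquad s_+^{Sq^1}(L)=\max\{q: q\text{ is }Sq^1\text{-full}\}+3,$$ and $s(\emptyset)=s_+^{Sq^1}(\emptyset)=1$. Proposition. Let $T$ be an oriented link such that $Sq^1\colon Kh^{i-1,s(T)-1}(T;\mathbb F_2)\to Kh^{i,s(T)-1}(T;\mathbb F_2)$ is zero for $i=0,1$. Then for every oriented link $L$, $$s_+^{Sq^1}(L\sqcup T)=s_+^{Sq^1}(L)+s_+^{Sq^1}(T)-1.$$ -/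

import Mathlib

/-!
# Oriented link diagrams, Khovanov and Bar-Natan cohomology, and the `Sq¹`-refined `s`-invariant

Oriented links are presented by oriented plane diagrams, encoded combinatorially; all invariants
are defined, as usual, from the cube of resolutions of a diagram.
-/

noncomputable section

namespace Khovanov

/-! ### Diagrams -/

/-- The underlying combinatorial data of an oriented link diagram on a closed oriented surface.
There are `n` crossings, ordered by their index, and a finite set `E` of oriented edges.
At a crossing `c`, the strand `true` is the over-strand and the strand `false` the under-strand;
strand `b` enters `c` along the edge `inc c b` and leaves it along `out c b`;
`pos c` says whether `c` is a positive (right-handed) crossing.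
Every edge either runs from a crossing to a crossing, or meets no crossing at all, in which case
it is a simple closed curve (a crossingless component). -/
structure PreDiagram where
  n : ℕ
  E : Type
  [finE : Finite E]
  pos : Fin n → Bool
  inc : Fin n → Bool → E
  out : Fin n → Bool → E
  inc_inj : Function.Injective2 inc
  out_inj : Function.Injective2 out
  inc_iff_out : ∀ e, (∃ c b, inc c b = e) ↔ (∃ c b, out c b = e)

attribute [instance] PreDiagram.finE

namespace PreDiagram

variable (D : PreDiagram)

/-- Following the link through a crossing along one of the two strands. -/
inductive StrandRel : D.E → D.E → Prop
  | through (c : Fin D.n) (b : Bool) : StrandRel (D.inc c b) (D.out c b)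

/-- The components of the link. -/
abbrev Component : Type := Quot D.StrandRel

/-- Two edges which are incident to the same crossing. -/
inductive IncidentRel : D.E → D.E → Prop
  | inc_inc (c : Fin D.n) (b b' : Bool) : IncidentRel (D.inc c b) (D.inc c b')
  | inc_out (c : Fin D.n) (b b' : Bool) : IncidentRel (D.inc c b) (D.out c b')

/-- The connected components of the diagram (as a 4-valent graph with circles). -/
abbrev Piece : Type := Quot D.IncidentRel

/-- The two sides of an edge are `(e, true)`, its left side, and `(e, false)`, its right side.
Draw a crossing `c` with both strands pointing upwards. The strand which enters from the lower
left (and leaves to the upper right) is the over-strand if `c` is positive and the under-strand if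
`c` is negative, so it is the strand `D.pos c`. The four constructors are the four corners at `c`.
-/
inductive CornerRel : D.E × Bool → D.E × Bool → Prop
  | west (c : Fin D.n) :
      CornerRel (D.inc c (D.pos c), true) (D.out c (!D.pos c), true)
  | south (c : Fin D.n) :
      CornerRel (D.inc c (D.pos c), false) (D.inc c (!D.pos c), true)
  | east (c : Fin D.n) :
      CornerRel (D.inc c (!D.pos c), false) (D.out c (D.pos c), false)
  | north (c : Fin D.n) :
      CornerRel (D.out c (D.pos c), true) (D.out c (!D.pos c), false)

/-- The faces of the diagram: the sides of the edges, glued at the corners. -/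
abbrev Face : Type := Quot D.CornerRel

end PreDiagram

/-- An oriented link diagram in the plane.

`planar`: the diagram has genus zero. For a connected diagram with `n ≥ 1` crossings, hence `2 n`
edges, this is Euler's formula `n - 2 n + #faces = 2`; a circle without crossings has two faces;
since no piece can exceed the planar number of faces, the equation says that each piece is planar.

`shade`: the checkerboard colouring of the plane in which the diagram lies (unbounded region not
shaded), restricted to the faces of the pieces. How the pieces are nested in each other matters
for the link and its Khovanov complex only through this colouring, and any colouring of the
faces that changes across each edge arises from a nesting. -/
structure LinkDiagram extends PreDiagram where
  planar : Nat.card toPreDiagram.Face = n + 2 * Nat.card toPreDiagram.Piece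
  shade : toPreDiagram.Face → Bool
  shade_ne : ∀ e : E, shade (Quot.mk _ (e, true)) ≠ shade (Quot.mk _ (e, false))

/-! ### Disjoint union of diagrams -/

/-- The disjoint union: crossings of `D₁` come first. -/
def PreDiagram.disjUnion (D₁ D₂ : PreDiagram) : PreDiagram where
  n := D₁.n + D₂.n
  E := D₁.E ⊕ D₂.E
  pos := Fin.append D₁.pos D₂.pos
  inc := Fin.append (fun c b => Sum.inl (D₁.inc c b)) (fun c b => Sum.inr (D₂.inc c b))
  out := Fin.append (fun c b => Sum.inl (D₁.out c b)) (fun c b => Sum.inr (D₂.out c b))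
  inc_inj := by
    intro c c' b b' h
    induction c using Fin.addCases <;> induction c' using Fin.addCases <;>
      simp only [Fin.append_left, Fin.append_right, Sum.inl.injEq, Sum.inr.injEq,
        reduceCtorEq] at h
    · obtain ⟨rfl, rfl⟩ := D₁.inc_inj h; simp
    · obtain ⟨rfl, rfl⟩ := D₂.inc_inj h; simp
  out_inj := by
    intro c c' b b' h
    induction c using Fin.addCases <;> induction c' using Fin.addCases <;>
      simp only [Fin.append_left, Fin.append_right, Sum.inl.injEq, Sum.inr.injEq,
        reduceCtorEq] at h
    · obtain ⟨rfl, rfl⟩ := D₁.out_inj h; simp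
    · obtain ⟨rfl, rfl⟩ := D₂.out_inj h; simp
  inc_iff_out := by
    rintro (e | e)
    · have := D₁.inc_iff_out e
      constructor
      · rintro ⟨c, b, h⟩
        induction c using Fin.addCases <;> simp at h
        obtain ⟨c', b', h'⟩ := this.1 ⟨_, _, h⟩
        exact ⟨Fin.castAdd _ c', b', by simp [h']⟩
      · rintro ⟨c, b, h⟩
        induction c using Fin.addCases <;> simp at h
        obtain ⟨c', b', h'⟩ := this.2 ⟨_, _, h⟩
        exact ⟨Fin.castAdd _ c', b', by simp [h']⟩
    · have := D₂.inc_iff_out e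
      constructor
      · rintro ⟨c, b, h⟩
        induction c using Fin.addCases <;> simp at h
        obtain ⟨c', b', h'⟩ := this.1 ⟨_, _, h⟩
        exact ⟨Fin.natAdd _ c', b', by simp [h']⟩
      · rintro ⟨c, b, h⟩
        induction c using Fin.addCases <;> simp at h
        obtain ⟨c', b', h'⟩ := this.2 ⟨_, _, h⟩
        exact ⟨Fin.natAdd _ c', b', by simp [h']⟩

/-- The quotient of a disjoint union is the disjoint union of the quotients. -/
def quotSumEquiv {α β γ : Type} (r : α → α → Prop) (s : β → β → Prop) (t : γ → γ → Prop)
    (e : γ ≃ α ⊕ β)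
    (hl : ∀ a a', r a a' → t (e.symm (Sum.inl a)) (e.symm (Sum.inl a')))
    (hr : ∀ b b', s b b' → t (e.symm (Sum.inr b)) (e.symm (Sum.inr b')))
    (ht : ∀ x y, t x y → Sum.LiftRel r s (e x) (e y)) :
    Quot t ≃ Quot r ⊕ Quot s where
  toFun := Quot.lift (fun x => Sum.map (Quot.mk r) (Quot.mk s) (e x)) (by
    intro x y h
    have h' := ht x y h
    cases hx : e x <;> cases hy : e y <;> rw [hx, hy] at h' <;> cases h'
    · simpa using Quot.sound ‹_›
    · simpa using Quot.sound ‹_›)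
  invFun := Sum.elim
    (Quot.lift (fun a => Quot.mk t (e.symm (Sum.inl a))) fun a a' h => Quot.sound (hl a a' h))
    (Quot.lift (fun b => Quot.mk t (e.symm (Sum.inr b))) fun b b' h => Quot.sound (hr b b' h))
  left_inv := by
    rintro ⟨x⟩
    change Sum.elim _ _ (Sum.map (Quot.mk r) (Quot.mk s) (e x)) = Quot.mk t x
    rcases hx : e x with a | b
    · change Quot.mk t (e.symm (Sum.inl a)) = _
      rw [← hx, e.symm_apply_apply]
    · change Quot.mk t (e.symm (Sum.inr b)) = _
      rw [← hx, e.symm_apply_apply]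
  right_inv := by
    rintro (q | q) <;> induction q using Quot.ind <;> rename_i a
    · change Sum.map (Quot.mk r) (Quot.mk s) (e (e.symm (Sum.inl a))) = _
      rw [e.apply_symm_apply]; rfl
    · change Sum.map (Quot.mk r) (Quot.mk s) (e (e.symm (Sum.inr a))) = _
      rw [e.apply_symm_apply]; rfl

namespace PreDiagram

variable (D₁ D₂ : PreDiagram)

/-- Faces of a disjoint union. -/
def faceSumEquiv : (D₁.disjUnion D₂).Face ≃ D₁.Face ⊕ D₂.Face :=
  quotSumEquiv _ _ _ (Equiv.sumProdDistrib D₁.E D₂.E Bool)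
    (by
      rintro _ _ (c | c | c | c)
      · change (D₁.disjUnion D₂).CornerRel (Sum.inl _, _) (Sum.inl _, _)
        simpa [disjUnion] using CornerRel.west (D := D₁.disjUnion D₂) (Fin.castAdd D₂.n c)
      · change (D₁.disjUnion D₂).CornerRel (Sum.inl _, _) (Sum.inl _, _)
        simpa [disjUnion] using CornerRel.south (D := D₁.disjUnion D₂) (Fin.castAdd D₂.n c)
      · change (D₁.disjUnion D₂).CornerRel (Sum.inl _, _) (Sum.inl _, _)
        simpa [disjUnion] using CornerRel.east (D := D₁.disjUnion D₂) (Fin.castAdd D₂.n c)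
      · change (D₁.disjUnion D₂).CornerRel (Sum.inl _, _) (Sum.inl _, _)
        simpa [disjUnion] using CornerRel.north (D := D₁.disjUnion D₂) (Fin.castAdd D₂.n c))
    (by
      rintro _ _ (c | c | c | c)
      · change (D₁.disjUnion D₂).CornerRel (Sum.inr _, _) (Sum.inr _, _)
        simpa [disjUnion] using CornerRel.west (D := D₁.disjUnion D₂) (Fin.natAdd D₁.n c)
      · change (D₁.disjUnion D₂).CornerRel (Sum.inr _, _) (Sum.inr _, _)
        simpa [disjUnion] using CornerRel.south (D := D₁.disjUnion D₂) (Fin.natAdd D₁.n c)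
      · change (D₁.disjUnion D₂).CornerRel (Sum.inr _, _) (Sum.inr _, _)
        simpa [disjUnion] using CornerRel.east (D := D₁.disjUnion D₂) (Fin.natAdd D₁.n c)
      · change (D₁.disjUnion D₂).CornerRel (Sum.inr _, _) (Sum.inr _, _)
        simpa [disjUnion] using CornerRel.north (D := D₁.disjUnion D₂) (Fin.natAdd D₁.n c))
    (by
      rintro _ _ (c | c | c | c)
      all_goals
        change Fin (D₁.n + D₂.n) at c
        induction c using Fin.addCases
      all_goals simp [disjUnion]
      · exact Sum.LiftRel.inl (CornerRel.west _)
      · exact Sum.LiftRel.inr (CornerRel.west _)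
      · exact Sum.LiftRel.inl (CornerRel.south _)
      · exact Sum.LiftRel.inr (CornerRel.south _)
      · exact Sum.LiftRel.inl (CornerRel.east _)
      · exact Sum.LiftRel.inr (CornerRel.east _)
      · exact Sum.LiftRel.inl (CornerRel.north _)
      · exact Sum.LiftRel.inr (CornerRel.north _))

/-- Pieces of a disjoint union. -/
def pieceSumEquiv : (D₁.disjUnion D₂).Piece ≃ D₁.Piece ⊕ D₂.Piece :=
  quotSumEquiv _ _ _ (Equiv.refl _)
    (by
      rintro _ _ (⟨c, b, b'⟩ | ⟨c, b, b'⟩)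
      · change (D₁.disjUnion D₂).IncidentRel (Sum.inl _) (Sum.inl _)
        simpa [disjUnion] using IncidentRel.inc_inc (D := D₁.disjUnion D₂) (Fin.castAdd D₂.n c) b b'
      · change (D₁.disjUnion D₂).IncidentRel (Sum.inl _) (Sum.inl _)
        simpa [disjUnion] using IncidentRel.inc_out (D := D₁.disjUnion D₂) (Fin.castAdd D₂.n c) b b')
    (by
      rintro _ _ (⟨c, b, b'⟩ | ⟨c, b, b'⟩)
      · change (D₁.disjUnion D₂).IncidentRel (Sum.inr _) (Sum.inr _)
        simpa [disjUnion] using IncidentRel.inc_inc (D := D₁.disjUnion D₂) (Fin.natAdd D₁.n c) b b'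
      · change (D₁.disjUnion D₂).IncidentRel (Sum.inr _) (Sum.inr _)
        simpa [disjUnion] using IncidentRel.inc_out (D := D₁.disjUnion D₂) (Fin.natAdd D₁.n c) b b')
    (by
      rintro _ _ (⟨c, b, b'⟩ | ⟨c, b, b'⟩)
      all_goals
        change Fin (D₁.n + D₂.n) at c
        induction c using Fin.addCases
      all_goals simp [disjUnion]
      · exact Sum.LiftRel.inl (IncidentRel.inc_inc _ _ _)
      · exact Sum.LiftRel.inr (IncidentRel.inc_inc _ _ _)
      · exact Sum.LiftRel.inl (IncidentRel.inc_out _ _ _)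
      · exact Sum.LiftRel.inr (IncidentRel.inc_out _ _ _))

end PreDiagram

/-- The disjoint union of two diagrams, drawn side by side in the plane: a diagram of the split
union of the two links. -/
def LinkDiagram.disjUnion (D₁ D₂ : LinkDiagram) : LinkDiagram where
  toPreDiagram := D₁.toPreDiagram.disjUnion D₂.toPreDiagram
  planar := by
    rw [Nat.card_congr (PreDiagram.faceSumEquiv _ _), Nat.card_congr (PreDiagram.pieceSumEquiv _ _),
      Nat.card_sum, Nat.card_sum, D₁.planar, D₂.planar]
    simp only [PreDiagram.disjUnion]
    ring
  shade := fun f => Sum.elim D₁.shade D₂.shade (PreDiagram.faceSumEquiv _ _ f)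
  shade_ne := by
    rintro (e | e)
    · exact D₁.shade_ne e
    · exact D₂.shade_ne e

/-! ### The cube of resolutions -/

namespace PreDiagram

variable (D : PreDiagram)

/-- How edges are joined at the crossings in the resolution `v`, where `v c = false` means the
`0`-smoothing and `v c = true` the `1`-smoothing. The smoothing of `c` that respects the
orientations is the `0`-smoothing if `c` is positive and the `1`-smoothing if `c` is negative. -/
inductive SmoothRel (v : Fin D.n → Bool) : D.E → D.E → Prop
  | oriented (c : Fin D.n) (b : Bool) (h : v c = !D.pos c) : SmoothRel v (D.inc c b) (D.out c (!b))
  | unoriented_inc (c : Fin D.n) (h : v c = D.pos c) : SmoothRel v (D.inc c true) (D.inc c false)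
  | unoriented_out (c : Fin D.n) (h : v c = D.pos c) : SmoothRel v (D.out c true) (D.out c false)

/-- The circles of the resolution `v`. -/
abbrev Circle (v : Fin D.n → Bool) : Type := Quot (D.SmoothRel v)

/-- The circle of the resolution `v` that contains the edge `e`. -/
def circ (v : Fin D.n → Bool) (e : D.E) : D.Circle v := Quot.mk _ e

instance (v : Fin D.n → Bool) : Fintype (D.Circle v) := Fintype.ofFinite _

instance (v : Fin D.n → Bool) : DecidableEq (D.Circle v) := Classical.decEq _

/-- Standard generators of the cube: a resolution, and for each of its circles one of the basis
elements `1` (encoded by `true`) and `x` (encoded by `false`) of `A = R[x]/(x² - h x)`. -/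
abbrev State : Type := Σ v : Fin D.n → Bool, (D.Circle v → Bool)

/-- The number of negative crossings. -/
def negCount : ℕ := (Finset.univ.filter fun c => D.pos c = false).card

/-- The number of positive crossings. -/
def posCount : ℕ := (Finset.univ.filter fun c => D.pos c = true).card

/-- The number of `1`-smoothings. -/
def height (v : Fin D.n → Bool) : ℕ := (Finset.univ.filter fun c => v c = true).card

/-- The homological degree. -/
def hdeg (s : D.State) : ℤ := D.height s.1 - D.negCount

/-- The quantum degree, where `1` has degree `1` and `x` has degree `-1`. -/
def qdeg (s : D.State) : ℤ :=
  (∑ C, if s.2 C then (1 : ℤ) else -1) + D.height s.1 + D.posCount - 2 * D.negCount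

end PreDiagram

section Coefficients

variable {R : Type} [CommRing R]

/-- Matrix coefficients of the multiplication of `A = R[x]/(x² - h x)`: the coefficient of the
third basis element in the product of the first two (`true` is `1`, `false` is `x`). -/
def mulCoeff (h : R) : Bool → Bool → Bool → R
  | true, true, true => 1
  | true, false, false => 1
  | false, true, false => 1
  | false, false, false => h
  | _, _, _ => 0

/-- Matrix coefficients of the comultiplication `1 ↦ 1 ⊗ x + x ⊗ 1 - h 1 ⊗ 1`, `x ↦ x ⊗ x`. -/
def comulCoeff (h : R) : Bool → Bool → Bool → R
  | true, true, false => 1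
  | true, false, true => 1
  | true, true, true => -h
  | false, false, false => 1
  | _, _, _ => 0

namespace PreDiagram

variable (D : PreDiagram)

open Classical in
/-- The coefficient of `t` in the part of the differential of `s` that changes the smoothing of `c`
from `0` to `1`. In either smoothing of `c`, the two arcs near `c` are the one that contains the
incoming end and the one that contains the outgoing end of the over-strand. If these lie on
different circles before and on one circle after the change, the circles are merged; in the
opposite case a circle is split; all other circles keep their labels. -/
def edgeCoeff (h : R) (s t : D.State) (c : Fin D.n) : R :=
  let a := D.inc c true
  let b := D.out c true
  if s.1 c = false ∧ t.1 = Function.update s.1 c true ∧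
      ∀ e, D.circ s.1 e ≠ D.circ s.1 a → D.circ s.1 e ≠ D.circ s.1 b →
        s.2 (D.circ s.1 e) = t.2 (D.circ t.1 e) then
    (-1) ^ (Finset.univ.filter fun c' => c' < c ∧ s.1 c' = true).card *
      (if D.circ s.1 a ≠ D.circ s.1 b ∧ D.circ t.1 a = D.circ t.1 b then
        mulCoeff h (s.2 (D.circ s.1 a)) (s.2 (D.circ s.1 b)) (t.2 (D.circ t.1 a))
      else if D.circ s.1 a = D.circ s.1 b ∧ D.circ t.1 a ≠ D.circ t.1 b then
        comulCoeff h (s.2 (D.circ s.1 a)) (t.2 (D.circ t.1 a)) (t.2 (D.circ t.1 b))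
      else 0)
  else 0

/-- The differential of the cube of resolutions for the Frobenius algebra `R[x]/(x² - h x)`.
For `h = 0` it is Khovanov's differential, for `h = 1` Bar-Natan's (filtered) differential. -/
def diff (h : R) : (D.State → R) →ₗ[R] (D.State → R) :=
  Matrix.mulVecLin (Matrix.of fun t s => ∑ c, D.edgeCoeff h s t c)

variable (R)

/-- The cochains supported on the generators that satisfy `P`. -/
def supported (P : D.State → Prop) : Submodule R (D.State → R) where
  carrier := {f | ∀ s, ¬ P s → f s = 0}
  add_mem' hf hg s hs := by simp [hf s hs, hg s hs]
  zero_mem' _ _ := rfl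
  smul_mem' r f hf s hs := by simp [hf s hs]

/-- The Khovanov cochain group `CKh^{i,q}(D; R)`. -/
def CKh (i q : ℤ) : Submodule R (D.State → R) :=
  D.supported R fun s => D.hdeg s = i ∧ D.qdeg s = q

/-- The cocycles in `CKh^{i,q}(D; R)`. -/
def ZKh (i q : ℤ) : Submodule R (D.State → R) :=
  LinearMap.ker (D.diff (0 : R)) ⊓ D.CKh R i q

/-- Khovanov (co)homology `Kh^{i,q}(D; R)`: cocycles modulo coboundaries. -/
abbrev Kh (i q : ℤ) : Type :=
  ↥(D.ZKh R i q) ⧸ ((D.CKh R (i - 1) q).map (D.diff (0 : R))).submoduleOf (D.ZKh R i q)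

end PreDiagram

end Coefficients

/-! ### The operation `Sq¹` -/

namespace PreDiagram

variable (D : PreDiagram)

/-- Reduction modulo 2 of an integral cochain. -/
def mod2 (f : D.State → ℤ) : D.State → ZMod 2 := fun s => (f s : ZMod 2)

/-- `D.IsSq1 i q x y` says that `Sq¹ : Kh^{i-1,q}(D; 𝔽₂) → Kh^{i,q}(D; 𝔽₂)` maps `x` to `y`.
`Sq¹` is the Bockstein homomorphism, the connecting homomorphism for
`0 → CKh(D; ℤ/2) → CKh(D; ℤ/4) → CKh(D; ℤ/2) → 0`: lift a cocycle that represents `x` to an integral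
cochain `f`; then `d f = 2 g` for an integral cochain `g`, whose reduction represents `y`. -/
def IsSq1 (i q : ℤ) (x : D.Kh (ZMod 2) (i - 1) q) (y : D.Kh (ZMod 2) i q) : Prop :=
  ∃ f ∈ D.CKh ℤ (i - 1) q, ∃ g ∈ D.CKh ℤ i q, D.diff (0 : ℤ) f = 2 • g ∧
    ∃ (hf : D.mod2 f ∈ D.ZKh (ZMod 2) (i - 1) q) (hg : D.mod2 g ∈ D.ZKh (ZMod 2) i q),
      x = Submodule.Quotient.mk ⟨D.mod2 f, hf⟩ ∧ y = Submodule.Quotient.mk ⟨D.mod2 g, hg⟩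

/-- The image of `Sq¹` in `Kh^{i,q}(D; 𝔽₂)`. -/
def sq1Image (i q : ℤ) : Submodule (ZMod 2) (D.Kh (ZMod 2) i q) where
  carrier := {y | ∃ x, D.IsSq1 i q x y}
  add_mem' := by
    rintro _ _ ⟨_, f, hf, g, hg, hd, hf', hg', rfl, rfl⟩ ⟨_, k, hk, l, hl, hd', hk', hl', rfl, rfl⟩
    have h1 : D.mod2 (f + k) = D.mod2 f + D.mod2 k := by ext s; simp [mod2]
    have h2 : D.mod2 (g + l) = D.mod2 g + D.mod2 l := by ext s; simp [mod2]
    refine ⟨_, f + k, add_mem hf hk, g + l, add_mem hg hl, by rw [map_add, hd, hd', smul_add],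
      h1 ▸ add_mem hf' hk', h2 ▸ add_mem hg' hl', rfl, ?_⟩
    rw [← Submodule.Quotient.mk_add]
    congr 1
    exact Subtype.ext h2.symm
  zero_mem' := by
    have h0 : D.mod2 0 = 0 := by ext s; simp [mod2]
    refine ⟨_, 0, zero_mem _, 0, zero_mem _, by simp, h0 ▸ zero_mem _, h0 ▸ zero_mem _, rfl, ?_⟩
    rw [← Submodule.Quotient.mk_zero]
    exact congrArg _ (Subtype.ext h0.symm)
  smul_mem' := by
    rintro r _ ⟨_, f, hf, g, hg, hd, hf', hg', rfl, rfl⟩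
    have h1 : D.mod2 ((r.val : ℤ) • f) = r • D.mod2 f := by ext s; simp [mod2]
    have h2 : D.mod2 ((r.val : ℤ) • g) = r • D.mod2 g := by ext s; simp [mod2]
    refine ⟨_, (r.val : ℤ) • f, Submodule.smul_mem _ _ hf, (r.val : ℤ) • g,
      Submodule.smul_mem _ _ hg, by rw [map_smul, hd, smul_comm],
      h1 ▸ Submodule.smul_mem _ _ hf', h2 ▸ Submodule.smul_mem _ _ hg', rfl, ?_⟩
    rw [← Submodule.Quotient.mk_smul]
    congr 1
    exact Subtype.ext h2.symm

/-! ### Bar-Natan cohomology over `𝔽₂` and its quantum filtration -/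

/-- The cocycles of homological degree `i` in the Bar-Natan complex over `𝔽₂`. -/
def ZBN (i : ℤ) : Submodule (ZMod 2) (D.State → ZMod 2) :=
  LinearMap.ker (D.diff (1 : ZMod 2)) ⊓ D.supported (ZMod 2) fun s => D.hdeg s = i

/-- Bar-Natan cohomology `Kh_BN^i(D; 𝔽₂)`. -/
abbrev KhBN (i : ℤ) : Type :=
  ↥(D.ZBN i) ⧸
    ((D.supported (ZMod 2) fun s => D.hdeg s = i - 1).map (D.diff (1 : ZMod 2))).submoduleOf
      (D.ZBN i)

/-- The subspace of `Kh_BN^i(D; 𝔽₂)` of the classes of the Bar-Natan cocycles of degree `i` that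
lie in `U`. -/
def classes (i : ℤ) (U : Submodule (ZMod 2) (D.State → ZMod 2)) :
    Submodule (ZMod 2) (D.KhBN i) :=
  (U.submoduleOf (D.ZBN i)).map (Submodule.mkQ _)

/-- The cochains of filtration degree at least `q`. -/
def filt (q : ℤ) : Submodule (ZMod 2) (D.State → ZMod 2) :=
  D.supported (ZMod 2) fun s => q ≤ D.qdeg s

open Classical in
/-- The component of a cochain in quantum degree `q`. On cocycles of filtration degree at least `q`
it induces the map `p` from the cohomology of the `q`-th filtration step to `Kh^{*,q}`. -/
def component (q : ℤ) : (D.State → ZMod 2) →ₗ[ZMod 2] (D.State → ZMod 2) where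
  toFun f := fun s => if D.qdeg s = q then f s else 0
  map_add' f g := by ext s; by_cases h : D.qdeg s = q <;> simp [h]
  map_smul' r f := by ext s; by_cases h : D.qdeg s = q <;> simp [h]

/-- The Khovanov cocycles in `CKh^{i,q}(D; 𝔽₂)` whose class lies in the image of `Sq¹`. -/
def sq1Cocycles (i q : ℤ) : Submodule (ZMod 2) (D.State → ZMod 2) :=
  ((D.sq1Image i q).comap (Submodule.mkQ _)).map (D.ZKh (ZMod 2) i q).subtype

end PreDiagram

/-! ### Canonical generators and the `s`-invariants -/

namespace LinkDiagram

variable (D : LinkDiagram)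

/-- The resolution of the diagram that respects the orientation. -/
def orientedRes : Fin D.n → Bool := fun c => !D.pos c

open Classical in
/-- The canonical cochains: the product over the circles `C` of the oriented resolution of the
idempotent `x` if the region to the left of `C` has colour `b`, and of the idempotent `1 + x`
otherwise. In the basis of generators, its coefficient at `s` is `1` if `s` has the
oriented resolution and the label `x` on all circles of the first kind, and `0` otherwise.
The values `b = true`, `b = false` give the canonical generators of the orientation of
the link and of the reverse orientation. -/
def canonical (b : Bool) : D.State → ZMod 2 := fun s =>
  if s.1 = D.orientedRes ∧
      ∀ e, D.shade (Quot.mk _ (e, true)) = b → s.2 (D.circ s.1 e) = false then 1 else 0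

/-- The subspace `W` of `Kh_BN^0(D; 𝔽₂)` spanned by the two canonical classes. -/
def W : Submodule (ZMod 2) (D.KhBN 0) :=
  D.classes 0 (Submodule.span (ZMod 2) (Set.range D.canonical))

/-- `q` is full: `im (j) ∩ W` has dimension at least 2, where `j` is the map to `Kh_BN^0` from the
cohomology of the `q`-th filtration step. -/
def IsFull (q : ℤ) : Prop :=
  q ≡ Nat.card D.Component [ZMOD 2] ∧
    2 ≤ Module.finrank (ZMod 2) ↥(D.classes 0 (D.filt q) ⊓ D.W)

/-- `q` is `Sq¹`-full: `j (p⁻¹ (im Sq¹)) ∩ W` has dimension at least 2. -/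
def IsSq1Full (q : ℤ) : Prop :=
  q ≡ Nat.card D.Component [ZMOD 2] ∧
    2 ≤ Module.finrank (ZMod 2)
      ↥(D.classes 0 (D.filt q ⊓ (D.sq1Cocycles 0 q).comap (D.component q)) ⊓ D.W)

open Classical in
/-- Rasmussen's invariant `s` over `𝔽₂`; its value on the empty link is `1`. -/
def s : ℤ := if IsEmpty D.E then 1 else sSup {q | D.IsFull q} + 1

open Classical in
/-- The refined invariant `s₊` for `Sq¹`; its value on the empty link is `1`. -/
def sPlusSq1 : ℤ := if IsEmpty D.E then 1 else sSup {q | D.IsSq1Full q} + 3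

end LinkDiagram

end Khovanov

end

namespace Khovanov

/-! ### Parity of the number of classes -/

/-! The cube of a split union is the tensor product of the two cubes, compatibly with both gradings,
and its canonical cochains are products of canonical cochains (`diff_tensor`, `qdeg_join`,
`canonical_disjUnion`). Quantum degrees have constant parity, so by `sPlusSq1_eq` the refined
invariant is `s + 2` or `s`. It is `s + 2` exactly if both canonical classes have representatives of
filtration degree `s - 1` whose leading terms represent classes in the image of `Sq¹`. It therefore
suffices to show that `s - 1` is additive, that `T` is not refined, and that `L ⊔ T` is refined
exactly if `L` is.

Lower bounds come from products of representatives. Upper bounds come from contraction with a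
functional `φ` on the Bar-Natan complex of `T` that kills coboundaries and degrees at least `s(T)`,
and is `1` on both canonical cochains (`exists_functional`). Contraction is a chain map onto the
complex of `L` that preserves canonical cochains. That a single `φ` serves both canonical classes is
due to the involution `x ↦ 1 + x`: it exchanges them, and their sum lies one step (two degrees)
deeper in the filtration.

For the `Sq¹` condition both constructions are done integrally. Let `d f = 2 g` be a Bockstein
relation. Vanishing of `Sq¹` on `Kh⁰(T)` lifts the leading term of a representative for `T` to an
integral cochain with coboundary divisible by 4; the product of `f` with it has Bockstein `g ⊗ V`
mod 2 (`canonicalIn_sq1Filt_disjUnion`). Vanishing of `Sq¹` into `Kh⁰(T)` gives, by duality, an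
integral lift of the top part of `φ` that is a cocycle mod 4 (`exists_integral_functional`), and
contraction with it respects Bockstein relations (`canonicalIn_sq1Filt_of_disjUnion`).

The general facts about the cube rest on the checkerboard colouring, which shows that every edge of
the cube is a merge or a split (`circ_eq_iff_not`), and on the splitting of `R[x]/(x² - x)` by
idempotents, which makes `d² = 0` a matter of signs. Khovanov's differential is the
degree-preserving part of Bar-Natan's. -/

theorem neg_one_pow_card_orbits {α : Type} [Fintype α] [DecidableEq α] (σ : Equiv.Perm α) :
    (-1 : ℤ) ^ Nat.card (Quot fun x y => σ x = y) =
      (-1) ^ Fintype.card α * (Equiv.Perm.sign σ : ℤ) := by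
  classical
  -- Orbits are counted as fixed points plus nontrivial cycles, because the cycle type, which
  -- determines the sign, omits the fixed points.
  let g : α → {x // σ x = x} ⊕ {c // c ∈ σ.cycleFactorsFinset} := fun x =>
    if h : σ x = x then Sum.inl ⟨x, h⟩ else
      Sum.inr ⟨σ.cycleOf x, Equiv.Perm.cycleOf_mem_cycleFactorsFinset_iff.2
        (Equiv.Perm.mem_support.2 h)⟩
  have hg : ∀ x y, σ x = y → g x = g y := by
    rintro x y rfl
    by_cases h : σ x = x
    · rw [h]
    · have h' : σ (σ x) ≠ σ x := fun h' => h (σ.injective h')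
      simp only [g, h, h', dite_false]
      congr 2
      exact Equiv.Perm.SameCycle.cycleOf_eq ⟨1, by simp⟩
  have hsame : ∀ x y, σ.SameCycle x y →
      Quot.mk (fun x y => σ x = y) x = Quot.mk (fun x y => σ x = y) y := by
    rintro x y ⟨k, rfl⟩
    induction k using Int.induction_on with
    | zero => rfl
    | succ k ih =>
      rw [ih, add_comm, zpow_add, zpow_one]
      exact Quot.sound rfl
    | pred k ih =>
      rw [ih]
      refine (Quot.sound ?_).symm
      rw [← Equiv.Perm.mul_apply, ← zpow_one_add]
      congr 2; ring
  have hbij : Function.Bijective (Quot.lift g hg) := by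
    constructor
    · rintro ⟨x⟩ ⟨y⟩ h
      change g x = g y at h
      by_cases hx : σ x = x <;> by_cases hy : σ y = y <;> simp [g, hx, hy] at h
      · rw [h]
      · refine hsame _ _ ?_
        have : y ∈ (σ.cycleOf x).support := by
          rw [h, Equiv.Perm.mem_support, Equiv.Perm.cycleOf_apply_self]; exact hy
        exact (Equiv.Perm.mem_support_cycleOf_iff.1 this).1
    · rintro (⟨x, hx⟩ | ⟨c, hc⟩)
      · exact ⟨Quot.mk _ x, by change g x = _; simp [g, hx]⟩
      · obtain ⟨hc1, hc2⟩ := Equiv.Perm.mem_cycleFactorsFinset_iff.1 hc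
        obtain ⟨x, hx⟩ := hc1.nonempty_support
        have hx' : σ x ≠ x := by
          rw [← hc2 x hx]; exact Equiv.Perm.mem_support.1 hx
        refine ⟨Quot.mk _ x, ?_⟩
        change g x = _
        simp only [g, hx', dite_false]
        congr 2
        exact (Equiv.Perm.cycle_is_cycleOf hx hc).symm
  have hcard : Nat.card (Quot fun x y => σ x = y) =
      Fintype.card {x // σ x = x} + σ.cycleFactorsFinset.card := by
    rw [Nat.card_eq_of_bijective _ hbij, Nat.card_eq_fintype_card, Fintype.card_sum,
      Fintype.card_coe]
  have hfix : Fintype.card α = σ.support.card + Fintype.card {x // σ x = x} := by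
    rw [Fintype.card_subtype, ← Finset.card_univ, ← Finset.card_filter_add_card_filter_not
      (s := Finset.univ) (fun x => σ x ≠ x)]
    congr 1
    simp
  have hct : Multiset.card σ.cycleType = σ.cycleFactorsFinset.card := by
    rw [Equiv.Perm.cycleType_def, Multiset.card_map]; rfl
  rw [hcard, hfix, Equiv.Perm.sign_of_cycleType, Equiv.Perm.sum_cycleType, hct]
  push_cast
  rw [← pow_add, show σ.support.card + Fintype.card {x // σ x = x} +
    (σ.support.card + σ.cycleFactorsFinset.card) = (σ.support.card + σ.support.card) +
    (Fintype.card {x // σ x = x} + σ.cycleFactorsFinset.card) by ring, pow_add _ (_ + _),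
    Even.neg_one_pow ⟨_, rfl⟩, one_mul]

/-- Joining the ends `hd c b` to the ends `tl c b`, with the two ends `tl c b` interchanged
if `u c`. -/
def JoinRel {n : ℕ} {E : Type} (hd tl : Fin n → Bool → E) (u : Fin n → Bool) (x y : E) : Prop :=
  ∃ c b, x = hd c b ∧ y = tl c (xor b (u c))

/-- Extended by the identity off the joined ends, the joining is a permutation of `E` whose orbits
are the classes. Each interchange composes it with a transposition, so the parity of the number of
orbits flips once for every `c` with `u c`. -/
theorem neg_one_pow_card_quot_joinRel {n : ℕ} {E : Type} [Finite E] (hd tl : Fin n → Bool → E)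
    (hh : Function.Injective2 hd) (ht : Function.Injective2 tl)
    (hr : ∀ e, (∃ c b, hd c b = e) ↔ ∃ c b, tl c b = e) (u : Fin n → Bool) :
    (-1 : ℤ) ^ (Nat.card (Quot (JoinRel hd tl u)) + (Finset.univ.filter fun c => u c = true).card)
      = (-1) ^ Nat.card (Quot (JoinRel hd tl fun _ => false)) := by
  classical
  have := Fintype.ofFinite E
  have key : ∀ (v : Fin n → Bool) (σ : Equiv.Perm E),
      (∀ c b, σ (hd c b) = tl c (xor b (v c))) → (∀ e, (∀ c b, hd c b ≠ e) → σ e = e) →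
      (-1 : ℤ) ^ Nat.card (Quot (JoinRel hd tl v)) =
        (-1) ^ Fintype.card E * (Equiv.Perm.sign σ : ℤ) := by
    intro v σ h1 h2
    rw [← neg_one_pow_card_orbits]
    congr 1
    refine Nat.card_congr ⟨Quot.lift (Quot.mk _) ?_, Quot.lift (Quot.mk _) ?_, ?_, ?_⟩
    · rintro _ _ ⟨c, b, rfl, rfl⟩
      exact Quot.sound (h1 c b)
    · rintro x _ rfl
      by_cases hx : ∃ c b, hd c b = x
      · obtain ⟨c, b, rfl⟩ := hx
        exact Quot.sound ⟨c, b, rfl, h1 c b⟩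
      · push Not at hx
        rw [h2 x hx]
    · rintro ⟨x⟩; rfl
    · rintro ⟨x⟩; rfl
  let ρ : E → E := fun e => if h : ∃ p : Fin n × Bool, hd p.1 p.2 = e then
    tl h.choose.1 h.choose.2 else e
  have hρ : ∀ c b, ρ (hd c b) = tl c b := by
    intro c b
    have h : ∃ p : Fin n × Bool, hd p.1 p.2 = hd c b := ⟨(c, b), rfl⟩
    have h2 := hh h.choose_spec
    simp only [ρ, h, dite_true]
    rw [h2.1, h2.2]
  have hρ' : ∀ e, (∀ c b, hd c b ≠ e) → ρ e = e := by
    intro e he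
    simp only [ρ]
    rw [dif_neg]
    rintro ⟨p, hp⟩
    exact he _ _ hp
  have hinj : Function.Injective ρ := by
    intro x y hxy
    by_cases hx : ∃ c b, hd c b = x <;> by_cases hy : ∃ c b, hd c b = y
    · obtain ⟨c, b, rfl⟩ := hx
      obtain ⟨c', b', rfl⟩ := hy
      rw [hρ, hρ] at hxy
      obtain ⟨rfl, rfl⟩ := ht hxy
      rfl
    · obtain ⟨c, b, rfl⟩ := hx
      rw [hρ, hρ' y (by simpa using hy)] at hxy
      exact absurd ((hr y).2 ⟨_, _, hxy⟩) hy
    · obtain ⟨c, b, rfl⟩ := hy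
      rw [hρ, hρ' x (by simpa using hx)] at hxy
      exact absurd ((hr x).2 ⟨_, _, hxy.symm⟩) hx
    · rwa [hρ' x (by simpa using hx), hρ' y (by simpa using hy)] at hxy
  let ρ' : Equiv.Perm E := Equiv.ofBijective ρ (Finite.injective_iff_bijective.1 hinj)
  have hρ₁ : ∀ c b, ρ' (hd c b) = tl c b := hρ
  have hS : ∀ S : Finset (Fin n), ∃ σ : Equiv.Perm E,
      (∀ c b, σ (hd c b) = tl c (xor b (decide (c ∈ S)))) ∧
      (∀ e, (∀ c b, hd c b ≠ e) → σ e = e) ∧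
      (Equiv.Perm.sign σ : ℤ) = (-1) ^ S.card * (Equiv.Perm.sign ρ' : ℤ) := by
    intro S
    induction S using Finset.induction_on with
    | empty => exact ⟨ρ', by simpa using hρ₁, hρ', by simp⟩
    | insert c S hc ih =>
      obtain ⟨σ, h1, h2, h3⟩ := ih
      refine ⟨Equiv.swap (tl c true) (tl c false) * σ, ?_, ?_, ?_⟩
      · intro c' b
        rw [Equiv.Perm.mul_apply, h1]
        by_cases h : c' = c
        · subst h
          cases b <;> simp [hc]
        · rw [Equiv.swap_apply_of_ne_of_ne]
          · simp [h]
          · intro h'; exact h (ht h').1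
          · intro h'; exact h (ht h').1
      · intro e he
        rw [Equiv.Perm.mul_apply, h2 e he, Equiv.swap_apply_of_ne_of_ne]
        · intro h'
          obtain ⟨c', b', h''⟩ := (hr e).2 ⟨_, _, h'.symm⟩
          exact he _ _ h''
        · intro h'
          obtain ⟨c', b', h''⟩ := (hr e).2 ⟨_, _, h'.symm⟩
          exact he _ _ h''
      · rw [Equiv.Perm.sign_mul, Equiv.Perm.sign_swap (fun h => by simpa using (ht h).2),
          Finset.card_insert_of_notMem hc]
        push_cast
        rw [h3]; ring
  obtain ⟨σ, h1, h2, h3⟩ := hS (Finset.univ.filter fun c => u c = true)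
  rw [pow_add, key u σ (by simpa using h1) h2, key _ ρ' (by simpa using hρ₁) hρ', h3, mul_assoc,
    mul_right_comm, ← pow_add, Even.neg_one_pow (n := _ + _) ⟨_, rfl⟩, one_mul]

/-! ### Circles of neighbouring resolutions -/

namespace PreDiagram

variable (D : PreDiagram)

theorem circ_surjective (v : Fin D.n → Bool) : Function.Surjective (D.circ v) := Quot.mk_surjective

/-- The edge `e` lies on one of the circles of the resolution `v` that pass the crossing `c`. -/
def Near (v : Fin D.n → Bool) (c : Fin D.n) (e : D.E) : Prop :=
  D.circ v e = D.circ v (D.inc c true) ∨ D.circ v e = D.circ v (D.out c true)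

variable {D}

theorem circ_eq_of_smoothRel {v : Fin D.n → Bool} {e e' : D.E} (h : D.SmoothRel v e e') :
    D.circ v e = D.circ v e' := Quot.sound h

theorem SmoothRel.congr_or {v v' : Fin D.n → Bool} {c : Fin D.n} (hv : ∀ c', c' ≠ c → v c' = v' c')
    {e e' : D.E} (h : D.SmoothRel v e e') :
    D.SmoothRel v' e e' ∨ (∃ b, e = D.inc c b ∨ e = D.out c b) ∧
      (∃ b, e' = D.inc c b ∨ e' = D.out c b) := by
  rcases h with ⟨c', b, h⟩ | ⟨c', h⟩ | ⟨c', h⟩ <;> by_cases hc : c' = c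
  · subst hc; exact Or.inr ⟨⟨_, Or.inl rfl⟩, _, Or.inr rfl⟩
  · exact Or.inl (.oriented c' b (by rw [← hv c' hc, h]))
  · subst hc; exact Or.inr ⟨⟨_, Or.inl rfl⟩, _, Or.inl rfl⟩
  · exact Or.inl (.unoriented_inc c' (by rw [← hv c' hc, h]))
  · subst hc; exact Or.inr ⟨⟨_, Or.inr rfl⟩, _, Or.inr rfl⟩
  · exact Or.inl (.unoriented_out c' (by rw [← hv c' hc, h]))

/-- Either smoothing joins the four ends at `c` in two pairs, and each pair contains exactly one end
of the over-strand. So the two ends of the over-strand represent all circles through `c`. -/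
theorem near_end (v : Fin D.n → Bool) (c : Fin D.n) (e : D.E)
    (he : ∃ b, e = D.inc c b ∨ e = D.out c b) : D.Near v c e := by
  obtain ⟨b, he⟩ := he
  by_cases h : v c = D.pos c
  · have h1 := circ_eq_of_smoothRel (SmoothRel.unoriented_inc (D := D) c h)
    have h2 := circ_eq_of_smoothRel (SmoothRel.unoriented_out (D := D) c h)
    cases b <;> rcases he with rfl | rfl
    · exact Or.inl h1.symm
    · exact Or.inr h2.symm
    · exact Or.inl rfl
    · exact Or.inr rfl
  · have h' : v c = !D.pos c := Bool.eq_not.2 h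
    have h1 := circ_eq_of_smoothRel (SmoothRel.oriented (D := D) c true h')
    have h2 := circ_eq_of_smoothRel (SmoothRel.oriented (D := D) c false h')
    cases b <;> rcases he with rfl | rfl
    · exact Or.inr h2
    · exact Or.inl h1.symm
    · exact Or.inl rfl
    · exact Or.inr rfl

/-- A joining in `v'` is either also one in `v` or takes place at `c`, where all ends are near. So
the near edges form a union of circles of both resolutions. -/
theorem near_iff_of_circ_eq {v v' : Fin D.n → Bool} {c : Fin D.n}
    (hv : ∀ c', c' ≠ c → v c' = v' c') {e e' : D.E} (h : D.circ v' e = D.circ v' e') :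
    D.Near v c e ↔ D.Near v c e' := by
  have key : ∀ x y, D.SmoothRel v' x y → (D.Near v c x) = (D.Near v c y) := by
    intro x y hxy
    rcases hxy.congr_or (fun c' hc' => (hv c' hc').symm) with h | ⟨h, h'⟩
    · simp only [Near, circ_eq_of_smoothRel h]
    · simp [near_end v c _ h, near_end v c _ h']
  exact iff_of_eq (congrArg (Quot.lift (D.Near v c) key) h)

theorem near_iff {v v' : Fin D.n → Bool} {c : Fin D.n} (hv : ∀ c', c' ≠ c → v c' = v' c')
    (e : D.E) : D.Near v c e ↔ D.Near v' c e := by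
  have key : ∀ {w w' : Fin D.n → Bool}, (∀ c', c' ≠ c → w c' = w' c') →
      D.Near w c e → D.Near w' c e := by
    rintro w w' hw (h | h)
    · exact (near_iff_of_circ_eq (fun c' hc' => (hw c' hc').symm) h).2 (Or.inl rfl)
    · exact (near_iff_of_circ_eq (fun c' hc' => (hw c' hc').symm) h).2 (Or.inr rfl)
  exact ⟨key hv, key fun c' hc' => (hv c' hc').symm⟩

theorem circ_eq_of_not_near {v v' : Fin D.n → Bool} {c : Fin D.n}
    (hv : ∀ c', c' ≠ c → v c' = v' c') {e e' : D.E} (he : ¬ D.Near v c e)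
    (h : D.circ v e = D.circ v e') : D.circ v' e = D.circ v' e' := by
  classical
  have key : ∀ x y, D.SmoothRel v x y → (if D.Near v c x then none else some (D.circ v' x)) =
      (if D.Near v c y then none else some (D.circ v' y)) := by
    intro x y hxy
    rcases hxy.congr_or hv with h | ⟨h, h'⟩
    · have h2 : D.Near v c x ↔ D.Near v c y := by simp only [Near, circ_eq_of_smoothRel hxy]
      simp only [h2, circ_eq_of_smoothRel h]
    · simp [near_end v c _ h, near_end v c _ h']
  have h1 := congrArg (Quot.lift _ key) h
  change (if D.Near v c e then none else some (D.circ v' e)) =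
    (if D.Near v c e' then none else some (D.circ v' e')) at h1
  have he' : ¬ D.Near v c e' := by
    simpa only [Near, ← h] using he
  simpa [he, he'] using h1

/-- Away from `c` the two resolutions have the same circles. Applied with constant weights to count
circles, with labels for the quantum degree, and with colours for `falseCount`. -/
theorem sum_circle_not_near {M : Type*} [AddCommMonoid M] {v v' : Fin D.n → Bool} {c : Fin D.n}
    (hv : ∀ c', c' ≠ c → v c' = v' c') (F : D.Circle v → M) (G : D.Circle v' → M)
    (hFG : ∀ e, ¬ D.Near v c e → F (D.circ v e) = G (D.circ v' e)) :
    ∑ C ∈ Finset.univ \ {D.circ v (D.inc c true), D.circ v (D.out c true)}, F C =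
      ∑ C ∈ Finset.univ \ {D.circ v' (D.inc c true), D.circ v' (D.out c true)}, G C := by
  have hv' : ∀ c', c' ≠ c → v' c' = v c' := fun c' hc' => (hv c' hc').symm
  have mem : ∀ (w : Fin D.n → Bool) (e : D.E), D.circ w e ∈ Finset.univ \
      ({D.circ w (D.inc c true), D.circ w (D.out c true)} : Finset _) ↔ ¬ D.Near w c e := by
    intro w e; simp [Near]
  have out : ∀ (w : Fin D.n → Bool) (C : D.Circle w), D.circ w C.out = C := fun w C => Quot.out_eq C
  refine Finset.sum_bij' (fun C _ => D.circ v' C.out) (fun C _ => D.circ v C.out) ?_ ?_ ?_ ?_ ?_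
  · intro C hC
    rw [← out v C, mem] at hC
    rwa [mem, ← near_iff hv]
  · intro C hC
    rw [← out v' C, mem] at hC
    rwa [mem, ← near_iff hv']
  · intro C hC
    rw [← out v C, mem, near_iff hv] at hC
    rw [circ_eq_of_not_near hv' (e' := C.out) _ (out v' _), out]
    rwa [near_iff_of_circ_eq (D := D) (v := v') (v' := v') (fun _ _ => rfl) (out v' _)]
  · intro C hC
    rw [← out v' C, mem, near_iff hv'] at hC
    rw [circ_eq_of_not_near hv (e' := C.out) _ (out v _), out]
    rwa [near_iff_of_circ_eq (D := D) (v := v) (v' := v) (fun _ _ => rfl) (out v _)]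
  · intro C hC
    rw [← out v C, mem] at hC
    rw [← hFG _ hC, out]

end PreDiagram

/-! ### The checkerboard colouring and the merge–split dichotomy -/

namespace LinkDiagram

open PreDiagram

variable (D : LinkDiagram)

/-- The colour of the region to the left of an edge. -/
def leftShade (e : D.E) : Bool := D.shade (Quot.mk _ (e, true))

theorem shade_right (e : D.E) : D.shade (Quot.mk _ (e, false)) = !D.leftShade e := by
  have := D.shade_ne e
  unfold leftShade
  revert this
  cases D.shade (Quot.mk _ (e, true)) <;> cases D.shade (Quot.mk _ (e, false)) <;> simp

theorem leftShade_out (c : Fin D.n) (b : Bool) :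
    D.leftShade (D.out c (!b)) = D.leftShade (D.inc c b) := by
  by_cases hb : b = D.pos c
  · subst hb
    exact (congrArg D.shade (Quot.sound (CornerRel.west c))).symm
  · have hb : b = !D.pos c := Bool.eq_not.2 hb
    subst hb
    have h := congrArg D.shade (Quot.sound (CornerRel.east (D := D.toPreDiagram) c))
    rw [shade_right, shade_right] at h
    simpa using h.symm

theorem leftShade_inc_not (c : Fin D.n) (b : Bool) :
    D.leftShade (D.inc c (!b)) = !D.leftShade (D.inc c b) := by
  have h := congrArg D.shade (Quot.sound (CornerRel.south (D := D.toPreDiagram) c))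
  rw [shade_right] at h
  change _ = D.leftShade _ at h
  by_cases hb : b = D.pos c
  · subst hb; exact h.symm
  · have hb : b = !D.pos c := Bool.eq_not.2 hb
    subst hb; rw [← h]; simp

theorem leftShade_inc (c : Fin D.n) (b : Bool) :
    D.leftShade (D.inc c b) = !xor b (D.leftShade (D.inc c true)) := by
  cases b
  · simpa using D.leftShade_inc_not c true
  · simp

/-- With the link orientation, passing from components to circles of the oriented resolution
interchanges tails at every crossing. To reach the other resolutions, edges are reoriented so that
the shaded region is on the left. Then the directions alternate around each crossing and both
smoothings join a head to a tail, so changing a smoothing is again a transposition. -/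
theorem neg_one_pow_card_circle (v : Fin D.n → Bool) :
    (-1 : ℤ) ^ (Nat.card (D.Circle v) + D.height v + D.posCount) =
      (-1) ^ Nat.card D.Component := by
  have hcomp : Nat.card D.Component = Nat.card (Quot (JoinRel D.inc D.out fun _ => false)) := by
    refine Nat.card_congr ⟨Quot.lift (Quot.mk _) ?_, Quot.lift (Quot.mk _) ?_, ?_, ?_⟩
    · rintro _ _ ⟨c, b⟩; exact Quot.sound ⟨c, b, rfl, by simp⟩
    · rintro _ _ ⟨c, b, rfl, rfl⟩
      have := StrandRel.through (D := D.toPreDiagram) c b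
      exact Quot.sound (by simpa using this)
    · rintro ⟨x⟩; rfl
    · rintro ⟨x⟩; rfl
  have hor : Nat.card (D.Circle D.orientedRes) =
      Nat.card (Quot (JoinRel D.inc D.out fun _ => true)) := by
    refine Nat.card_congr ⟨Quot.lift (Quot.mk _) ?_, Quot.lift (Quot.mk _) ?_, ?_, ?_⟩
    · rintro _ _ (⟨c, b, h⟩ | ⟨c, h⟩ | ⟨c, h⟩)
      · exact Quot.sound ⟨c, b, rfl, by simp⟩
      · simp [orientedRes] at h
      · simp [orientedRes] at h
    · rintro _ _ ⟨c, b, rfl, rfl⟩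
      have := SmoothRel.oriented (D := D.toPreDiagram) (v := D.orientedRes) c b rfl
      exact Quot.sound (by simpa using this)
    · rintro ⟨x⟩; rfl
    · rintro ⟨x⟩; rfl
  have h1 := neg_one_pow_card_quot_joinRel D.inc D.out D.inc_inj D.out_inj D.inc_iff_out
    (fun _ => true)
  rw [← hcomp, ← hor] at h1
  -- Strand `β c` is the one that enters along an edge with shaded left side. After reversing the
  -- edges with unshaded left side, `hd c` lists the two ends that point towards `c` and `tl c` the
  -- two that point away from it.
  let β : Fin D.n → Bool := fun c => D.leftShade (D.inc c true)
  let hd : Fin D.n → Bool → D.E := fun c k => if k then D.inc c (β c) else D.out c (β c)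
  let tl : Fin D.n → Bool → D.E := fun c k => if k then D.out c (!β c) else D.inc c (!β c)
  have hin : ∀ c b, D.leftShade (D.inc c b) = !xor b (β c) := D.leftShade_inc
  have hout : ∀ c b, D.leftShade (D.out c b) = xor b (β c) := by
    intro c b
    rw [← Bool.not_not b, D.leftShade_out, hin]; simp
  have hhd : Function.Injective2 hd := by
    intro c c' k k' h
    have h' := congrArg D.leftShade h
    cases k <;> cases k' <;> simp only [hd, if_true, Bool.false_eq_true, if_false] at h h'
    · exact ⟨(D.out_inj h).1, rfl⟩
    · rw [hin, hout] at h'; simp at h'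
    · rw [hin, hout] at h'; simp at h'
    · exact ⟨(D.inc_inj h).1, rfl⟩
  have htl : Function.Injective2 tl := by
    intro c c' k k' h
    have h' := congrArg D.leftShade h
    cases k <;> cases k' <;> simp only [tl, if_true, Bool.false_eq_true, if_false] at h h'
    · exact ⟨(D.inc_inj h).1, rfl⟩
    · rw [hin, hout] at h'; simp at h'
    · rw [hin, hout] at h'; simp at h'
    · exact ⟨(D.out_inj h).1, rfl⟩
  have hrange : ∀ e, (∃ c b, hd c b = e) ↔ ∃ c b, tl c b = e := by
    intro e
    constructor
    · rintro ⟨c, b, rfl⟩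
      cases b
      · obtain ⟨c', b', h⟩ := (D.inc_iff_out (D.out c (β c))).2 ⟨_, _, rfl⟩
        have h' := congrArg D.leftShade h
        rw [hin, hout] at h'
        refine ⟨c', false, ?_⟩
        simp only [tl, hd, Bool.false_eq_true, if_false, ← h]
        congr 1
        revert h'; generalize β c' = z; cases b' <;> cases z <;> simp
      · obtain ⟨c', b', h⟩ := (D.inc_iff_out (D.inc c (β c))).1 ⟨_, _, rfl⟩
        have h' := congrArg D.leftShade h
        rw [hin, hout] at h'
        refine ⟨c', true, ?_⟩
        simp only [tl, hd, if_true, ← h]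
        congr 1
        revert h'; generalize β c' = z; cases b' <;> cases z <;> simp
    · rintro ⟨c, b, rfl⟩
      cases b
      · obtain ⟨c', b', h⟩ := (D.inc_iff_out (D.inc c (!β c))).1 ⟨_, _, rfl⟩
        have h' := congrArg D.leftShade h
        rw [hin, hout] at h'
        refine ⟨c', false, ?_⟩
        simp only [tl, hd, Bool.false_eq_true, if_false, ← h]
        congr 1
        revert h'; generalize β c' = z; cases b' <;> cases z <;> simp
      · obtain ⟨c', b', h⟩ := (D.inc_iff_out (D.out c (!β c))).2 ⟨_, _, rfl⟩
        have h' := congrArg D.leftShade h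
        rw [hin, hout] at h'
        refine ⟨c', true, ?_⟩
        simp only [tl, hd, if_true, ← h]
        congr 1
        revert h'; generalize β c' = z; cases b' <;> cases z <;> simp
  -- The oriented smoothing joins `hd c k` to `tl c k`; the other smoothing, given by `w c = D.pos
  -- c`, interchanges the tails.
  have hv : ∀ w : Fin D.n → Bool, Nat.card (D.Circle w) =
      Nat.card (Quot (JoinRel hd tl fun c => decide (w c = D.pos c))) := by
    intro w
    have gen : ∀ c k, Quot.mk (JoinRel hd tl fun c => decide (w c = D.pos c)) (hd c k) =
        Quot.mk _ (tl c (xor k (decide (w c = D.pos c)))) := fun c k =>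
      Quot.sound ⟨c, k, rfl, rfl⟩
    generalize hR : (JoinRel hd tl fun c => decide (w c = D.pos c)) = R at gen ⊢
    refine Nat.card_congr ⟨Quot.lift (Quot.mk _) ?_, Quot.lift (Quot.mk _) ?_, ?_, ?_⟩
    · rintro _ _ (⟨c, b, h⟩ | ⟨c, h⟩ | ⟨c, h⟩)
      all_goals
        have h1 := gen c true
        have h2 := gen c false
        simp only [h, Bool.not_eq_self, decide_true, decide_false, hd, tl,
          Bool.xor_false, Bool.xor_true, Bool.not_true, Bool.not_false, if_true,
          Bool.false_eq_true, if_false] at h1 h2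
        revert h1 h2
        generalize β c = z
        intro h1 h2
      · cases b <;> cases z <;> simp_all
      · cases z <;> simp_all
      · cases z <;> simp_all
    · subst hR
      rintro _ _ ⟨c, k, rfl, rfl⟩
      by_cases h : w c = D.pos c
      · have h1 := circ_eq_of_smoothRel (SmoothRel.unoriented_inc (D := D.toPreDiagram) c h)
        have h2 := circ_eq_of_smoothRel (SmoothRel.unoriented_out (D := D.toPreDiagram) c h)
        simp only [circ] at h1 h2
        simp only [hd, tl]
        generalize β c = z
        cases z <;> cases k <;> simp [h, h1, h2]
      · have h' : w c = !D.pos c := Bool.eq_not.2 h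
        have h1 := circ_eq_of_smoothRel (SmoothRel.oriented (D := D.toPreDiagram) c true h')
        have h2 := circ_eq_of_smoothRel (SmoothRel.oriented (D := D.toPreDiagram) c false h')
        simp only [circ, Bool.not_true, Bool.not_false] at h1 h2
        simp only [hd, tl]
        generalize β c = z
        cases z <;> cases k <;> simp [h', h1, h2]
    · rintro ⟨x⟩; rfl
    · rintro ⟨x⟩; rfl
  have h2 := neg_one_pow_card_quot_joinRel hd tl hhd htl hrange
  have h3 := h2 (fun c => decide (v c = D.pos c))
  have h4 := h2 (fun c => decide (D.orientedRes c = D.pos c))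
  rw [← hv] at h3 h4
  have sgn : ∀ p : Fin D.n → Prop, [DecidablePred p] →
      (-1 : ℤ) ^ (Finset.univ.filter p).card = ∏ c, if p c then -1 else 1 := by
    intro p _; simp [Finset.prod_ite]
  have h5 : (-1 : ℤ) ^ (Finset.univ.filter fun c => decide (v c = D.pos c) = true).card *
      (-1) ^ (Finset.univ.filter fun c : Fin D.n => true = true).card =
      (-1) ^ D.height v * (-1) ^ D.posCount := by
    rw [height, posCount, sgn, sgn, sgn, sgn, ← Finset.prod_mul_distrib,
      ← Finset.prod_mul_distrib]
    refine Finset.prod_congr rfl fun c _ => ?_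
    cases v c <;> cases D.pos c <;> simp
  have h6 : (Finset.univ.filter
      fun c => decide (D.orientedRes c = D.pos c) = true).card = 0 := by
    simp [orientedRes]
  rw [h6, add_zero] at h4
  rw [← h1, pow_add _ (Nat.card (D.Circle D.orientedRes)), h4, ← h3, pow_add, pow_add, pow_add,
    mul_assoc, mul_assoc, ← h5]

/-- Changing one smoothing changes the height by one, so by `neg_one_pow_card_circle` the number of
circles changes parity. The circles off `c` correspond to each other, so one circle cannot become
one circle, nor two circles two. -/
theorem circ_eq_iff_not (v : Fin D.n → Bool) (c : Fin D.n) (hc : v c = false) :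
    D.circ v (D.inc c true) = D.circ v (D.out c true) ↔
      ¬ D.circ (Function.update v c true) (D.inc c true) =
        D.circ (Function.update v c true) (D.out c true) := by
  set v' := Function.update v c true with hv'
  have hv : ∀ c', c' ≠ c → v c' = v' c' := fun c' h => by rw [hv', Function.update_of_ne h]
  have h0 := sum_circle_not_near (D := D.toPreDiagram) hv (fun _ => (1 : ℕ)) (fun _ => 1)
    (fun _ _ => rfl)
  have hht : D.height v' = D.height v + 1 := by
    have : (Finset.univ.filter fun c' => v' c' = true) =
        insert c (Finset.univ.filter fun c' => v c' = true) := by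
      ext c'
      by_cases h : c' = c
      · subst h; simp [hv']
      · simp [hv', h]
    rw [height, this, Finset.card_insert_of_notMem (by simp [hc]), height]
  have h1 := D.neg_one_pow_card_circle v
  rw [← D.neg_one_pow_card_circle v', hht] at h1
  simp only [Finset.sum_const, smul_eq_mul, mul_one] at h0
  rw [Finset.card_sdiff_of_subset (Finset.subset_univ _),
    Finset.card_sdiff_of_subset (Finset.subset_univ _), Finset.card_univ, Finset.card_univ] at h0
  have hle := Finset.card_le_univ ({D.circ v (D.inc c true), D.circ v (D.out c true)} : Finset _)
  have hle' := Finset.card_le_univ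
    ({D.circ v' (D.inc c true), D.circ v' (D.out c true)} : Finset _)
  rw [Nat.card_eq_fintype_card, Nat.card_eq_fintype_card] at h1
  have key : Fintype.card (D.Circle v) ≠ Fintype.card (D.Circle v') := by
    intro h
    rw [h, ← add_assoc, add_right_comm _ 1, pow_succ] at h1
    have := pow_ne_zero (Fintype.card (D.Circle v') + D.height v + D.posCount)
      (by norm_num : (-1 : ℤ) ≠ 0)
    omega
  by_cases ha : D.circ v (D.inc c true) = D.circ v (D.out c true) <;>
    by_cases ha' : D.circ v' (D.inc c true) = D.circ v' (D.out c true)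
  · exfalso
    rw [ha] at h0 hle
    rw [ha'] at h0 hle'
    simp only [Finset.pair_eq_singleton, Finset.card_singleton] at h0 hle hle'
    exact key (by omega)
  · simp [ha, ha']
  · simp [ha, ha']
  · exfalso
    rw [Finset.card_pair ha, Finset.card_pair ha'] at h0
    rw [Finset.card_pair ha] at hle
    rw [Finset.card_pair ha'] at hle'
    exact key (by omega)

end LinkDiagram

/-! ### Labels of states and the quantum degree -/

namespace PreDiagram

variable {D : PreDiagram}

/-- The label of the circle through an edge. -/
def lab (s : D.State) (e : D.E) : Bool := s.2 (D.circ s.1 e)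

theorem state_ext {s t : D.State} (h : s.1 = t.1) (hl : ∀ e, lab s e = lab t e) : s = t := by
  obtain ⟨v, f⟩ := s
  obtain ⟨w, g⟩ := t
  obtain rfl : v = w := h
  congr 1
  funext C
  obtain ⟨e, rfl⟩ := D.circ_surjective v C
  exact hl e

theorem lab_congr {s : D.State} {e e' : D.E} (h : D.circ s.1 e = D.circ s.1 e') :
    lab s e = lab s e' := by simp only [lab, h]

/-- A colouring of the edges that is constant on the circles of the resolution `v`. -/
def Compat (l : D.E → Bool) (v : Fin D.n → Bool) : Prop :=
  ∀ e e', D.SmoothRel v e e' → l e = l e'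

theorem Compat.eq {l : D.E → Bool} {v : Fin D.n → Bool} (h : Compat l v) {e e' : D.E}
    (he : D.circ v e = D.circ v e') : l e = l e' :=
  congrArg (Quot.lift l h) he

theorem compat_lab (s : D.State) : Compat (lab s) s.1 := fun _ _ h =>
  lab_congr (circ_eq_of_smoothRel h)

/-- The state with given labels of the edges. -/
def mkState (v : Fin D.n → Bool) (l : D.E → Bool) (h : Compat l v) : D.State := ⟨v, Quot.lift l h⟩

@[simp] theorem lab_mkState (v : Fin D.n → Bool) (l : D.E → Bool) (h : Compat l v) (e : D.E) :
    lab (mkState v l h) e = l e := rfl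

/-- The state `t` arises from `s` by changing the smoothing of `c` from `0` to `1`, up to the labels
of the circles that pass `c`. -/
def Adj (s t : D.State) (c : Fin D.n) : Prop :=
  s.1 c = false ∧ t.1 = Function.update s.1 c true ∧ ∀ e, ¬ D.Near s.1 c e → lab s e = lab t e

theorem Adj.agree {s t : D.State} {c : Fin D.n} (h : Adj s t c) :
    ∀ c', c' ≠ c → s.1 c' = t.1 c' := fun c' hc' => by
  rw [h.2.1, Function.update_of_ne hc']

/-- The sign of the edge of the cube that starts at `v` in direction `c`. -/
def edgeSign (R : Type) [CommRing R] (v : Fin D.n → Bool) (c : Fin D.n) : R :=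
  (-1) ^ (Finset.univ.filter fun c' => c' < c ∧ v c' = true).card

variable {R : Type} [CommRing R]

theorem edgeCoeff_of_not_adj (h : R) {s t : D.State} {c : Fin D.n} (hst : ¬ Adj s t c) :
    D.edgeCoeff h s t c = 0 := by
  unfold edgeCoeff
  rw [if_neg]
  rintro ⟨h1, h2, h3⟩
  refine hst ⟨h1, h2, fun e he => ?_⟩
  simp only [Near, not_or] at he
  exact h3 e he.1 he.2

theorem edgeCoeff_of_adj (h : R) {s t : D.State} {c : Fin D.n} (hst : Adj s t c) :
    D.edgeCoeff h s t c = edgeSign R s.1 c *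
      (if D.circ s.1 (D.inc c true) ≠ D.circ s.1 (D.out c true) ∧
          D.circ t.1 (D.inc c true) = D.circ t.1 (D.out c true) then
        mulCoeff h (lab s (D.inc c true)) (lab s (D.out c true)) (lab t (D.inc c true))
      else if D.circ s.1 (D.inc c true) = D.circ s.1 (D.out c true) ∧
          D.circ t.1 (D.inc c true) ≠ D.circ t.1 (D.out c true) then
        comulCoeff h (lab s (D.inc c true)) (lab t (D.inc c true)) (lab t (D.out c true))
      else 0) := by
  unfold edgeCoeff
  dsimp only
  rw [if_pos]
  · rfl
  · refine ⟨hst.1, hst.2.1, fun e h1 h2 => hst.2.2 e ?_⟩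
    simp only [Near, not_or]
    exact ⟨h1, h2⟩

/-- The contribution of a label to the quantum degree. -/
def labDeg (b : Bool) : ℤ := if b then 1 else -1

theorem qdeg_eq (s : D.State) :
    D.qdeg s = (∑ C, labDeg (s.2 C)) + D.height s.1 + D.posCount - 2 * D.negCount := rfl

theorem height_update {v : Fin D.n → Bool} {c : Fin D.n} (hc : v c = false) :
    D.height (Function.update v c true) = D.height v + 1 := by
  have : (Finset.univ.filter fun c' => Function.update v c true c' = true) =
      insert c (Finset.univ.filter fun c' => v c' = true) := by
    ext c'
    by_cases h : c' = c
    · subst h; simp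
    · simp [h]
  rw [height, this, Finset.card_insert_of_notMem (by simp [hc]), height]

theorem hdeg_of_edgeCoeff_ne_zero {h : R} {s t : D.State} {c : Fin D.n}
    (hst : D.edgeCoeff h s t c ≠ 0) : D.hdeg t = D.hdeg s + 1 := by
  have hA : Adj s t c := by
    by_contra hA; exact hst (edgeCoeff_of_not_adj h hA)
  rw [hdeg, hdeg, hA.2.1, height_update hA.1]
  push_cast; ring

theorem Adj.qdeg_sub {s t : D.State} {c : Fin D.n} (h : Adj s t c) :
    D.qdeg t - D.qdeg s = 1 +
      ∑ C ∈ {D.circ t.1 (D.inc c true), D.circ t.1 (D.out c true)}, labDeg (t.2 C) -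
      ∑ C ∈ {D.circ s.1 (D.inc c true), D.circ s.1 (D.out c true)}, labDeg (s.2 C) := by
  have h0 := sum_circle_not_near h.agree (fun C => labDeg (s.2 C)) (fun C => labDeg (t.2 C))
    (fun e he => congrArg labDeg (h.2.2 e he))
  have h1 : D.height t.1 = D.height s.1 + 1 := by rw [h.2.1, height_update h.1]
  rw [qdeg_eq, qdeg_eq, ← Finset.sum_sdiff (Finset.subset_univ
    {D.circ t.1 (D.inc c true), D.circ t.1 (D.out c true)}), ← h0, ← Finset.sum_sdiff
    (Finset.subset_univ {D.circ s.1 (D.inc c true), D.circ s.1 (D.out c true)}), h1]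
  push_cast; ring

/-- The only structure constants that do not preserve the degree are those that contain `h`, namely
in `x · x = h x` and in the term `-h 1 ⊗ 1`, and both raise it by 2. So the differential for `h = 0`
is the associated graded of the one for any `h`. -/
theorem edgeCoeff_zero_and_le (h : R) (s t : D.State) (c : Fin D.n) :
    D.edgeCoeff 0 s t c = (if D.qdeg t = D.qdeg s then D.edgeCoeff h s t c else 0) ∧
      (D.edgeCoeff h s t c ≠ 0 → D.qdeg s ≤ D.qdeg t) := by
  by_cases hA : Adj s t c
  · have hq := hA.qdeg_sub
    rw [edgeCoeff_of_adj h hA, edgeCoeff_of_adj 0 hA]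
    by_cases h1 : D.circ s.1 (D.inc c true) = D.circ s.1 (D.out c true) <;>
      by_cases h2 : D.circ t.1 (D.inc c true) = D.circ t.1 (D.out c true)
    · simp [h1, h2]
    · simp only [h1, h2, ne_eq, not_true, not_false_eq_true, and_true, if_true,
        if_false, false_and]
      rw [h1, Finset.pair_eq_singleton, Finset.sum_singleton, Finset.sum_pair h2] at hq
      change _ = 1 + (labDeg (lab t (D.inc c true)) + labDeg (lab t (D.out c true))) -
        labDeg (lab s (D.out c true)) at hq
      rw [← lab_congr h1] at hq
      generalize lab t (D.inc c true) = x at *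
      generalize lab t (D.out c true) = y at *
      generalize lab s (D.inc c true) = z at *
      cases x <;> cases y <;> cases z <;> simp [labDeg] at hq <;>
        simp [comulCoeff] <;> omega
    · simp only [h1, h2, ne_eq, not_true, not_false_eq_true, and_true, if_true]
      rw [h2, Finset.pair_eq_singleton, Finset.sum_singleton, Finset.sum_pair h1] at hq
      change _ = 1 + labDeg (lab t (D.out c true)) - (labDeg (lab s (D.inc c true)) +
        labDeg (lab s (D.out c true))) at hq
      rw [← lab_congr h2] at hq
      generalize lab t (D.inc c true) = x at *
      generalize lab s (D.out c true) = y at *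
      generalize lab s (D.inc c true) = z at *
      cases x <;> cases y <;> cases z <;> simp [labDeg] at hq <;>
        simp [mulCoeff] <;> omega
    · simp [h1, h2]
  · simp [edgeCoeff_of_not_adj _ hA]

/-- The matrix of the differential. -/
noncomputable def dcoeff (h : R) (t s : D.State) : R := ∑ c, D.edgeCoeff h s t c

theorem diff_apply (h : R) (f : D.State → R) (t : D.State) :
    D.diff h f t = ∑ s, dcoeff h t s * f s := rfl

theorem dcoeff_zero (h : R) (s t : D.State) :
    dcoeff 0 t s = if D.qdeg t = D.qdeg s then dcoeff h t s else 0 := by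
  simp only [dcoeff, (edgeCoeff_zero_and_le h s t _).1]
  split_ifs <;> simp

theorem qdeg_le_of_dcoeff_ne_zero {h : R} {s t : D.State} (hst : dcoeff h t s ≠ 0) :
    D.qdeg s ≤ D.qdeg t := by
  obtain ⟨c, -, hc⟩ := Finset.exists_ne_zero_of_sum_ne_zero hst
  exact (edgeCoeff_zero_and_le h s t c).2 hc

theorem hdeg_of_dcoeff_ne_zero {h : R} {s t : D.State} (hst : dcoeff h t s ≠ 0) :
    D.hdeg t = D.hdeg s + 1 := by
  obtain ⟨c, -, hc⟩ := Finset.exists_ne_zero_of_sum_ne_zero hst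
  exact hdeg_of_edgeCoeff_ne_zero hc

theorem qdeg_eq_of_dcoeff_zero_ne_zero {s t : D.State} (hst : dcoeff (0 : R) t s ≠ 0) :
    D.qdeg t = D.qdeg s := by
  by_contra h
  rw [dcoeff_zero (0 : R), if_neg h] at hst
  exact hst rfl

end PreDiagram

-- Each circle contributes an odd number, so only the parity of circles plus height plus positive
-- crossings matters. This makes the filtration jump in steps of two.
open PreDiagram in
theorem LinkDiagram.qdeg_modEq (D : LinkDiagram) (s : D.State) :
    D.qdeg s ≡ Nat.card D.Component [ZMOD 2] := by
  have h := D.neg_one_pow_card_circle s.1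
  have h1 : (∑ C, labDeg (s.2 C)) ≡ Nat.card (D.Circle s.1) [ZMOD 2] := by
    rw [Nat.card_eq_fintype_card, ← Finset.card_univ, Finset.card_eq_sum_ones]
    push_cast
    refine Int.ModEq.sum fun C _ => ?_
    cases s.2 C <;> decide
  have h2 : ((Nat.card (D.Circle s.1) + D.height s.1 + D.posCount : ℕ) : ℤ) ≡
      (Nat.card D.Component : ℕ) [ZMOD 2] := by
    refine (Int.natCast_modEq_iff (n := 2)).2 ?_
    rw [Nat.ModEq]
    rcases Nat.even_or_odd (Nat.card D.Component) with h3 | h3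
    · rw [h3.neg_one_pow] at h
      have h4 := (neg_one_pow_eq_one_iff_even (by norm_num : (-1 : ℤ) ≠ 1)).1 h
      rw [Nat.even_iff.1 h3, Nat.even_iff.1 h4]
    · rw [h3.neg_one_pow] at h
      have h4 := (neg_one_pow_eq_neg_one_iff_odd (by norm_num : (-1 : ℤ) ≠ 1)).1 h
      rw [Nat.odd_iff.1 h3, Nat.odd_iff.1 h4]
  rw [qdeg_eq]
  push_cast at h2
  simp only [Int.ModEq] at *
  omega

/-! ### Evaluation in the idempotent basis and `d² = 0` -/

namespace PreDiagram

variable {D : PreDiagram} {R : Type} [CommRing R]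

/-- All circles labelled `x` have colour `true`. -/
def Dom (l : D.E → Bool) (s : D.State) : Prop := ∀ e, lab s e = true ∨ l e = true

open Classical in
/-- The evaluation at the resolution `v` under the algebra homomorphism that sends `x` to `1` on the
circles of colour `true` and to `0` on the others. -/
noncomputable def ev (v : Fin D.n → Bool) (l : D.E → Bool) (f : D.State → R) : R :=
  ∑ s, if s.1 = v ∧ Dom l s then f s else 0

/-- The evaluations are triangular in the generators. Take `s` in the support of `f` with the most
edges labelled `1`, and colour exactly the edges labelled `x` by `true`. Any other state that
contributes to this evaluation has strictly more edges labelled `1`, so the evaluation is `f s`. -/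
theorem eq_zero_of_ev_eq_zero (f : D.State → R) (h : ∀ v l, Compat l v → ev v l f = 0) :
    f = 0 := by
  classical
  by_contra hf
  obtain ⟨s₀, hs₀⟩ := Function.ne_iff.1 hf
  obtain ⟨s, hs, hmax⟩ := Finset.exists_max_image (Finset.univ.filter fun s => f s ≠ 0)
    (fun s => {e | lab s e = true}.ncard) ⟨s₀, by simpa using hs₀⟩
  have hs : f s ≠ 0 := by simpa using hs
  refine hs ?_
  rw [← h s.1 (fun e => !lab s e) (fun e e' he => congrArg Bool.not (compat_lab s e e' he)), ev,
    Finset.sum_eq_single s]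
  · rw [if_pos]
    exact ⟨rfl, fun e => by cases h : lab s e <;> simp [h]⟩
  · intro t _ hts
    rw [ite_eq_right_iff]
    rintro ⟨h1, h2⟩
    by_contra hft
    refine hts (state_ext h1 ?_)
    have hsub : {e | lab s e = true} ⊆ {e | lab t e = true} := by
      intro e (he : lab s e = true)
      rcases h2 e with h3 | h3
      · exact h3
      · simp [he] at h3
    have heq := Set.eq_of_subset_of_ncard_le hsub (hmax t (by simpa using hft)) (Set.toFinite _)
    intro e
    rw [Bool.eq_iff_iff]
    exact (Set.ext_iff.1 heq e).symm
  · simp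

theorem ev_add (v : Fin D.n → Bool) (l : D.E → Bool) (f g : D.State → R) :
    ev v l (f + g) = ev v l f + ev v l g := by
  simp only [ev, ← Finset.sum_add_distrib]
  refine Finset.sum_congr rfl fun s _ => ?_
  split_ifs <;> simp

theorem ev_sub (v : Fin D.n → Bool) (l : D.E → Bool) (f g : D.State → R) :
    ev v l (f - g) = ev v l f - ev v l g := by
  simp only [ev, ← Finset.sum_sub_distrib]
  refine Finset.sum_congr rfl fun s _ => ?_
  split_ifs <;> simp

theorem eq_of_ev_eq {f g : D.State → R} (h : ∀ v l, Compat l v → ev v l f = ev v l g) : f = g :=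
  sub_eq_zero.1 (eq_zero_of_ev_eq_zero _ fun v l hl => by rw [ev_sub, h v l hl, sub_self])

theorem SmoothRel.exists_local {v : Fin D.n → Bool} {e e' : D.E} (h : D.SmoothRel v e e') :
    ∃ x, ∀ w : Fin D.n → Bool, w x = v x → D.SmoothRel w e e' := by
  rcases h with ⟨c, b, h⟩ | ⟨c, h⟩ | ⟨c, h⟩
  · exact ⟨c, fun w hw => .oriented c b (by rw [hw, h])⟩
  · exact ⟨c, fun w hw => .unoriented_inc c (by rw [hw, h])⟩
  · exact ⟨c, fun w hw => .unoriented_out c (by rw [hw, h])⟩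

/-- Each joining depends on the smoothing of a single crossing. This supplies the remaining corners
of a square in the cube. -/
theorem Compat.of_local {l : D.E → Bool} {v w z : Fin D.n → Bool} (hv : Compat l v)
    (hw : Compat l w) (h : ∀ x, z x = v x ∨ z x = w x) : Compat l z := by
  intro e e' he
  obtain ⟨x, hx⟩ := he.exists_local
  rcases h x with h | h
  · exact hv e e' (hx v h.symm)
  · exact hw e e' (hx w h.symm)

theorem near_congr {v : Fin D.n → Bool} {c : Fin D.n} {e e' : D.E} (h : D.circ v e = D.circ v e') :
    D.Near v c e ↔ D.Near v c e' := by simp only [Near, h]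

/-- The labels of a neighbouring state with labels `m₁`, `m₂` on the circles through `c`. -/
noncomputable def saddleLab (s : D.State) (c : Fin D.n) (m₁ m₂ : Bool) (e : D.E) : Bool :=
  if D.circ (Function.update s.1 c true) e = D.circ (Function.update s.1 c true) (D.inc c true) then
    m₁
  else if D.circ (Function.update s.1 c true) e =
      D.circ (Function.update s.1 c true) (D.out c true) then m₂
  else lab s e

theorem update_agree (v : Fin D.n → Bool) (c : Fin D.n) (b : Bool) :
    ∀ c', c' ≠ c → v c' = Function.update v c b c' := fun c' h => by
  rw [Function.update_of_ne h]

theorem saddleLab_compat (s : D.State) (c : Fin D.n) (m₁ m₂ : Bool) :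
    Compat (saddleLab s c m₁ m₂) (Function.update s.1 c true) := by
  intro e e' h
  have h1 := circ_eq_of_smoothRel h
  unfold saddleLab
  rw [h1]
  split_ifs with h2 h3
  · rfl
  · rfl
  · refine lab_congr (circ_eq_of_not_near (fun c' hc' => (update_agree s.1 c true c' hc').symm)
      ?_ h1)
    rw [near_congr h1]
    simp only [Near, not_or]
    exact ⟨h2, h3⟩

/-- A neighbouring state with labels `m₁`, `m₂` on the circles through `c`. -/
noncomputable def saddle (s : D.State) (c : Fin D.n) (m₁ m₂ : Bool) : D.State :=
  mkState _ _ (saddleLab_compat s c m₁ m₂)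

theorem lab_saddle_inc (s : D.State) (c : Fin D.n) (m₁ m₂ : Bool) :
    lab (saddle s c m₁ m₂) (D.inc c true) = m₁ := by
  simp [saddle, saddleLab]

theorem lab_saddle_out (s : D.State) (c : Fin D.n) (m₁ m₂ : Bool)
    (h : D.circ (Function.update s.1 c true) (D.inc c true) ≠
      D.circ (Function.update s.1 c true) (D.out c true)) :
    lab (saddle s c m₁ m₂) (D.out c true) = m₂ := by
  simp [saddle, saddleLab, h.symm]

theorem lab_saddle_of_not_near (s : D.State) (c : Fin D.n) (m₁ m₂ : Bool) {e : D.E}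
    (h : ¬ D.Near s.1 c e) : lab (saddle s c m₁ m₂) e = lab s e := by
  rw [near_iff (update_agree s.1 c true)] at h
  simp only [Near, not_or] at h
  simp [saddle, saddleLab, h]

theorem adj_saddle {s : D.State} {c : Fin D.n} (hc : s.1 c = false) (m₁ m₂ : Bool) :
    Adj s (saddle s c m₁ m₂) c :=
  ⟨hc, rfl, fun _ he => (lab_saddle_of_not_near s c m₁ m₂ he).symm⟩

theorem Adj.eq_saddle {s t : D.State} {c : Fin D.n} (h : Adj s t c) :
    t = saddle s c (lab t (D.inc c true)) (lab t (D.out c true)) := by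
  refine state_ext h.2.1 fun e => ?_
  change _ = saddleLab _ _ _ _ _
  rw [saddleLab]
  rw [← h.2.1]
  split_ifs with h1 h2
  · exact lab_congr h1
  · exact lab_congr h2
  · refine (h.2.2 e ?_).symm
    rw [near_iff h.agree]
    simp only [Near, not_or]
    exact ⟨h1, h2⟩

theorem dom_iff_of_near {l : D.E → Bool} {s : D.State} {c : Fin D.n} (hl : Compat l s.1) :
    Dom l s ↔ (∀ e, ¬ D.Near s.1 c e → lab s e = true ∨ l e = true) ∧
      (lab s (D.inc c true) = true ∨ l (D.inc c true) = true) ∧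
      (lab s (D.out c true) = true ∨ l (D.out c true) = true) := by
  constructor
  · exact fun h => ⟨fun e _ => h e, h _, h _⟩
  · rintro ⟨h1, h2, h3⟩ e
    by_cases he : D.Near s.1 c e
    · rcases he with he | he
      · rw [lab_congr he, hl.eq he]; exact h2
      · rw [lab_congr he, hl.eq he]; exact h3
    · exact h1 e he

theorem dom_saddle_iff {l : D.E → Bool} {s : D.State} {c : Fin D.n} {m₁ m₂ : Bool}
    (hl : Compat l (Function.update s.1 c true)) :
    Dom l (saddle s c m₁ m₂) ↔ (∀ e, ¬ D.Near s.1 c e → lab s e = true ∨ l e = true) ∧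
      (m₁ = true ∨ l (D.inc c true) = true) ∧
      (lab (saddle s c m₁ m₂) (D.out c true) = true ∨ l (D.out c true) = true) := by
  rw [dom_iff_of_near (c := c) (s := saddle s c m₁ m₂) hl, lab_saddle_inc]
  refine and_congr_left fun _ => forall_congr' fun e => ?_
  change (¬ D.Near (Function.update s.1 c true) c e → _) ↔ _
  rw [← near_iff (update_agree s.1 c true)]
  refine imp_congr_right fun he => ?_
  rw [lab_saddle_of_not_near s c m₁ m₂ he]

theorem compat_iff_of_near {l : D.E → Bool} {v : Fin D.n → Bool} {c : Fin D.n}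
    (hl : Compat l (Function.update v c true)) :
    Compat l v ↔ ∀ e e', D.SmoothRel v e e' → D.Near v c e → l e = l e' := by
  refine ⟨fun h e e' he _ => h e e' he, fun h e e' he => ?_⟩
  by_cases hn : D.Near v c e
  · exact h e e' he hn
  · exact hl.eq (circ_eq_of_not_near (update_agree v c true) hn (circ_eq_of_smoothRel he))

theorem Near.eq_of_compat {l : D.E → Bool} {v : Fin D.n → Bool} {c : Fin D.n} {e : D.E}
    (h : D.Near v c e) (hl : Compat l v) (hab : l (D.inc c true) = l (D.out c true)) :
    l e = l (D.inc c true) := by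
  rcases h with h | h
  · exact hl.eq h
  · rw [hl.eq h, hab]

theorem compat_of_update {l : D.E → Bool} {v : Fin D.n → Bool} {c : Fin D.n}
    (hl : Compat l (Function.update v c true)) (hab : l (D.inc c true) = l (D.out c true)) :
    Compat l v := by
  rw [compat_iff_of_near hl]
  intro e e' he hn
  have hn' := (near_congr (circ_eq_of_smoothRel he)).1 hn
  rw [near_iff (update_agree v c true)] at hn hn'
  rw [hn.eq_of_compat hl hab, hn'.eq_of_compat hl hab]

open Classical in
/-- The factor by which the saddle at `c` acts on the idempotent of the colouring `l`. -/
noncomputable def saddleSign (R : Type) [CommRing R] (v : Fin D.n → Bool) (c : Fin D.n)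
    (l : D.E → Bool) : R :=
  if D.circ v (D.inc c true) = D.circ v (D.out c true) ∧ l (D.inc c true) = false then -1 else 1

end PreDiagram

open PreDiagram

/-! ### The saddle maps in the idempotent basis -/

namespace LinkDiagram

variable (D : LinkDiagram) {R : Type} [CommRing R]

-- For `h = 1` the product commutes with evaluation at `x = 0` and at `x = 1`. The coproduct
-- evaluated at `(1,1)` is evaluation at 1, at `(0,0)` it is minus evaluation at 0, and at mixed
-- points it is zero. So a saddle is diagonal: it contributes only for colourings compatible with
-- both resolutions, and its only sign, apart from that of the cube, comes from splitting a circle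
-- of colour `false`.
open Classical in
theorem sum_edgeCoeff_of_update (s : D.State) (c : Fin D.n) (hc : s.1 c = false)
    (l : D.E → Bool) (hl : Compat l (Function.update s.1 c true)) :
    (∑ t, if t.1 = Function.update s.1 c true ∧ Dom l t then D.edgeCoeff (1 : R) s t c else 0) =
      if Compat l s.1 ∧ Dom l s then edgeSign R s.1 c * saddleSign R s.1 c l else 0 := by
  have hdich := D.circ_eq_iff_not s.1 c hc
  by_cases h1 : D.circ s.1 (D.inc c true) = D.circ s.1 (D.out c true)
  · have h2 := hdich.1 h1
    -- The neighbours of `s` across `c` are determined by the labels of the circles through `c`, so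
    -- the sum over all states reduces to a sum over these labels.
    have hzero : ∀ t ∉ Set.range (fun m : Bool × Bool => saddle s c m.1 m.2),
        (if t.1 = Function.update s.1 c true ∧ Dom l t then D.edgeCoeff (1 : R) s t c else 0)
          = 0 := by
      intro t ht
      have : ¬ Adj s t c := fun hA => ht ⟨(_, _), hA.eq_saddle.symm⟩
      simp [edgeCoeff_of_not_adj _ this]
    have hinj : Function.Injective (fun m : Bool × Bool => saddle s c m.1 m.2) := by
      intro m m' h
      have h3 := congrArg (fun t => lab t (D.inc c true)) h
      have h4 := congrArg (fun t => lab t (D.out c true)) h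
      simp only [lab_saddle_inc, lab_saddle_out _ _ _ _ h2] at h3 h4
      exact Prod.ext h3 h4
    rw [← Fintype.sum_of_injective _ hinj _ _ hzero fun _ => rfl, Fintype.sum_prod_type]
    have hterm : ∀ m₁ m₂, (if (saddle s c m₁ m₂).1 = Function.update s.1 c true ∧
          Dom l (saddle s c m₁ m₂) then D.edgeCoeff (1 : R) s (saddle s c m₁ m₂) c else 0) =
        if (∀ e, ¬ D.Near s.1 c e → lab s e = true ∨ l e = true) ∧
          (m₁ = true ∨ l (D.inc c true) = true) ∧ (m₂ = true ∨ l (D.out c true) = true) then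
          edgeSign R s.1 c * comulCoeff 1 (lab s (D.inc c true)) m₁ m₂ else 0 := by
      intro m₁ m₂
      have h0 : (saddle s c m₁ m₂).1 = Function.update s.1 c true := rfl
      have h2' : ¬ D.circ (saddle s c m₁ m₂).1 (D.inc c true) =
        D.circ (saddle s c m₁ m₂).1 (D.out c true) := h2
      rw [dom_saddle_iff hl, edgeCoeff_of_adj _ (adj_saddle hc m₁ m₂), lab_saddle_inc,
        lab_saddle_out _ _ _ _ h2]
      simp only [h0, h1, h2', true_and, ne_eq, not_true, not_false_eq_true, false_and, if_false,
        if_true, and_true]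
    simp only [hterm, Fintype.sum_bool]
    have hcomp : Compat l s.1 ↔ l (D.inc c true) = l (D.out c true) :=
      ⟨fun h => h.eq h1, compat_of_update hl⟩
    by_cases hfar : ∀ e, ¬ D.Near s.1 c e → lab s e = true ∨ l e = true
    · have hF := eq_true hfar
      simp only [hF, true_and]
      by_cases hab : l (D.inc c true) = l (D.out c true)
      · rw [dom_iff_of_near (c := c) (hcomp.2 hab)]
        simp only [hF, hcomp, ← hab, saddleSign, h1, true_and, ← lab_congr h1]
        generalize lab s (D.inc c true) = x
        generalize l (D.inc c true) = y
        cases x <;> cases y <;> simp [comulCoeff]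
      · rw [if_neg (c := Compat l s.1 ∧ _) (by rw [hcomp]; tauto)]
        generalize lab s (D.inc c true) = x
        revert hab
        generalize l (D.inc c true) = y
        generalize l (D.out c true) = z
        intro hab
        cases x <;> cases y <;> cases z <;> simp [comulCoeff] at hab ⊢
    · rw [if_neg (c := Compat l s.1 ∧ _) (fun h => hfar fun e _ => (h.2 : Dom l s) e)]
      simp [hfar]
  · have h2 : D.circ (Function.update s.1 c true) (D.inc c true) =
        D.circ (Function.update s.1 c true) (D.out c true) := by
      by_contra h2; exact h1 (hdich.2 h2)
    have hlab : ∀ m, lab (saddle s c m m) (D.out c true) = m := by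
      intro m
      rw [← lab_congr (s := saddle s c m m) h2, lab_saddle_inc]
    have hzero : ∀ t ∉ Set.range (fun m : Bool => saddle s c m m),
        (if t.1 = Function.update s.1 c true ∧ Dom l t then D.edgeCoeff (1 : R) s t c else 0)
          = 0 := by
      intro t ht
      have : ¬ Adj s t c := by
        intro hA
        refine ht ⟨lab t (D.inc c true), ?_⟩
        have h3 := hA.eq_saddle
        have h4 : lab t (D.inc c true) = lab t (D.out c true) :=
          lab_congr (by rw [hA.2.1]; exact h2)
        rw [← h4] at h3
        exact h3.symm
      simp [edgeCoeff_of_not_adj _ this]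
    have hinj : Function.Injective (fun m : Bool => saddle s c m m) := by
      intro m m' h
      have h3 := congrArg (fun t => lab t (D.inc c true)) h
      simpa only [lab_saddle_inc] using h3
    rw [← Fintype.sum_of_injective _ hinj _ _ hzero fun _ => rfl]
    have hab : l (D.inc c true) = l (D.out c true) := hl.eq h2
    have hterm : ∀ m, (if (saddle s c m m).1 = Function.update s.1 c true ∧
          Dom l (saddle s c m m) then D.edgeCoeff (1 : R) s (saddle s c m m) c else 0) =
        if (∀ e, ¬ D.Near s.1 c e → lab s e = true ∨ l e = true) ∧
          (m = true ∨ l (D.inc c true) = true) then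
          edgeSign R s.1 c * mulCoeff 1 (lab s (D.inc c true)) (lab s (D.out c true)) m
          else 0 := by
      intro m
      have h0 : (saddle s c m m).1 = Function.update s.1 c true := rfl
      have h2' : D.circ (saddle s c m m).1 (D.inc c true) =
        D.circ (saddle s c m m).1 (D.out c true) := h2
      rw [dom_saddle_iff hl, edgeCoeff_of_adj _ (adj_saddle hc m m), lab_saddle_inc, hlab, ← hab]
      simp only [h0, h1, h2', true_and, ne_eq, not_false_eq_true, if_true, and_self]
    have hcomp : Compat l s.1 := compat_of_update hl hab
    simp only [hterm, Fintype.sum_bool]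
    rw [dom_iff_of_near (c := c) hcomp]
    by_cases hfar : ∀ e, ¬ D.Near s.1 c e → lab s e = true ∨ l e = true
    · have hF := eq_true hfar
      simp only [hF, hcomp, ← hab, saddleSign, h1, true_and, false_and, if_false]
      generalize lab s (D.inc c true) = x
      generalize lab s (D.out c true) = z
      generalize l (D.inc c true) = y
      cases x <;> cases y <;> cases z <;> simp [mulCoeff]
    · simp [hfar]

open Classical in
theorem sum_edgeCoeff (s : D.State) (c : Fin D.n) (v : Fin D.n → Bool) (l : D.E → Bool)
    (hl : Compat l v) :
    (∑ t, if t.1 = v ∧ Dom l t then D.edgeCoeff (1 : R) s t c else 0) =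
      if (v c = true ∧ Compat l (Function.update v c false)) ∧
          s.1 = Function.update v c false ∧ Dom l s then
        edgeSign R (Function.update v c false) c * saddleSign R (Function.update v c false) c l
      else 0 := by
  by_cases h : v c = true ∧ s.1 = Function.update v c false
  · obtain ⟨h1, h2⟩ := h
    have hc : s.1 c = false := by rw [h2]; simp
    have hv : v = Function.update s.1 c true := by
      rw [h2, Function.update_idem, ← h1, Function.update_eq_self]
    rw [← h2]
    have h3 := D.sum_edgeCoeff_of_update (R := R) s c hc l (hv ▸ hl)
    rw [← hv] at h3
    rw [h3]
    simp [h1]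
  · rw [if_neg (by tauto)]
    refine Finset.sum_eq_zero fun t _ => ?_
    rw [ite_eq_right_iff]
    rintro ⟨rfl, -⟩
    refine edgeCoeff_of_not_adj _ fun hA => h ?_
    rw [hA.2.1]
    refine ⟨by simp, ?_⟩
    rw [Function.update_idem, ← hA.1, Function.update_eq_self]

open Classical in
/-- The differential in the idempotent basis. -/
theorem ev_diff (f : D.State → R) (v : Fin D.n → Bool) (l : D.E → Bool) (hl : Compat l v) :
    ev v l (D.diff 1 f) = ∑ c, if v c = true ∧ Compat l (Function.update v c false) then
      edgeSign R (Function.update v c false) c * saddleSign R (Function.update v c false) c l *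
        ev (Function.update v c false) l f else 0 := by
  have h1 : ev v l (D.diff 1 f) = ∑ s, ∑ c, f s *
      ∑ t, if t.1 = v ∧ Dom l t then D.edgeCoeff (1 : R) s t c else 0 := by
    simp only [ev, diff_apply, dcoeff, Finset.mul_sum]
    calc _ = ∑ t, ∑ s, ∑ c, f s *
          (if t.1 = v ∧ Dom l t then D.edgeCoeff (1 : R) s t c else 0) := by
            refine Finset.sum_congr rfl fun t _ => ?_
            split_ifs
            · refine Finset.sum_congr rfl fun s _ => ?_
              rw [Finset.sum_mul]
              exact Finset.sum_congr rfl fun c _ => mul_comm _ _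
            · simp
      _ = _ := by
        rw [Finset.sum_comm]
        refine Finset.sum_congr rfl fun s _ => ?_
        rw [Finset.sum_comm]
  rw [h1, Finset.sum_comm]
  refine Finset.sum_congr rfl fun c _ => ?_
  simp only [D.sum_edgeCoeff _ c v l hl, ev, Finset.mul_sum]
  by_cases h2 : v c = true ∧ Compat l (Function.update v c false)
  · rw [if_pos h2]
    refine Finset.sum_congr rfl fun s _ => ?_
    simp only [h2, true_and]
    split_ifs
    · ring
    · simp
  · rw [if_neg h2]
    simp [h2]

end LinkDiagram

namespace PreDiagram

variable {D : PreDiagram}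

theorem edgeSign_anticomm_of_lt (R : Type) [CommRing R] {v : Fin D.n → Bool} {c c' : Fin D.n}
    (hlt : c < c') (hc : v c = false) :
    edgeSign R v c * edgeSign R (Function.update v c true) c' =
      -(edgeSign R v c' * edgeSign R (Function.update v c' true) c) := by
  have h1 : (Finset.univ.filter fun x => x < c' ∧ Function.update v c true x = true) =
      insert c (Finset.univ.filter fun x => x < c' ∧ v x = true) := by
    ext x
    by_cases h : x = c
    · subst h; simp [hlt]
    · simp [h]
  have h2 : (Finset.univ.filter fun x => x < c ∧ Function.update v c' true x = true) =
      Finset.univ.filter fun x => x < c ∧ v x = true := by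
    ext x
    by_cases h : x = c'
    · subst h; simp [hlt.not_gt]
    · simp [h]
  simp only [edgeSign, h1, h2]
  rw [Finset.card_insert_of_notMem (by simp [hc]), pow_succ]
  ring

theorem edgeSign_anticomm (R : Type) [CommRing R] {v : Fin D.n → Bool} {c c' : Fin D.n}
    (hne : c ≠ c') (hc : v c = false) (hc' : v c' = false) :
    edgeSign R v c * edgeSign R (Function.update v c true) c' =
      -(edgeSign R v c' * edgeSign R (Function.update v c' true) c) := by
  rcases lt_or_gt_of_ne hne with h | h
  · exact edgeSign_anticomm_of_lt R h hc
  · rw [edgeSign_anticomm_of_lt R h hc', neg_neg]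

/-- The number of circles of colour `false`. -/
noncomputable def falseCount (v : Fin D.n → Bool) (l : D.E → Bool) : ℤ :=
  ∑ C : D.Circle v, if l C.out = false then 1 else 0

end PreDiagram

open PreDiagram

namespace LinkDiagram

variable (D : LinkDiagram)

theorem falseCount_update {v : Fin D.n → Bool} {c : Fin D.n} {l : D.E → Bool} (hc : v c = false)
    (hl : Compat l v) (hl' : Compat l (Function.update v c true)) :
    (l (D.inc c true) = true ∧ falseCount (Function.update v c true) l = falseCount v l) ∨
    (l (D.inc c true) = false ∧ D.circ v (D.inc c true) = D.circ v (D.out c true) ∧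
      falseCount (Function.update v c true) l = falseCount v l + 1) ∨
    (l (D.inc c true) = false ∧ D.circ v (D.inc c true) ≠ D.circ v (D.out c true) ∧
      falseCount (Function.update v c true) l = falseCount v l - 1) := by
  have hdich := D.circ_eq_iff_not v c hc
  have hout : ∀ (w : Fin D.n → Bool) (e : D.E), D.circ w (D.circ w e).out = D.circ w e :=
    fun w e => Quot.out_eq _
  have hF : ∀ (w : Fin D.n → Bool), Compat l w → ∀ e,
      (if l (D.circ w e).out = false then (1 : ℤ) else 0) = if l e = false then 1 else 0 := by
    intro w hw e
    rw [hw.eq (hout w e)]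
  have h0 := sum_circle_not_near (D := D.toPreDiagram) (update_agree v c true)
    (fun C => if l C.out = false then (1 : ℤ) else 0)
    (fun C => if l C.out = false then (1 : ℤ) else 0)
    (fun e _ => by rw [hF v hl, hF _ hl'])
  have hsum : ∀ w : Fin D.n → Bool, falseCount w l = _ := fun w =>
    (Finset.sum_sdiff (Finset.subset_univ
      {D.circ w (D.inc c true), D.circ w (D.out c true)})).symm
  rw [hsum, hsum, ← h0]
  by_cases h1 : D.circ v (D.inc c true) = D.circ v (D.out c true)
  · have h2 := hdich.1 h1
    rw [Finset.sum_pair h2, ← h1, Finset.pair_eq_singleton, Finset.sum_singleton, hF _ hl',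
      hF _ hl', hF _ hl, ← hl.eq h1]
    cases l (D.inc c true) <;> simp
    omega
  · have h2 : D.circ (Function.update v c true) (D.inc c true) =
        D.circ (Function.update v c true) (D.out c true) := by
      by_contra h2; exact h1 (hdich.2 h2)
    rw [Finset.sum_pair h1, ← h2, Finset.pair_eq_singleton, Finset.sum_singleton, hF _ hl',
      hF _ hl, hF _ hl, ← hl'.eq h2]
    cases l (D.inc c true) <;> simp [h1]
    omega

/-- The factor is `-1` exactly when a circle of colour `false` is split, that is, when `falseCount`
rises by one; merging two such circles lowers it by one. Both ways around a square have the same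
total change and meet the same colours at `c` and `c'`, hence contain equally many such splits. -/
theorem saddleSign_comm (R : Type) [CommRing R] {v : Fin D.n → Bool} {c c' : Fin D.n}
    {l : D.E → Bool} (hne : c ≠ c') (hc : v c = false) (hc' : v c' = false) (hl : Compat l v)
    (h1 : Compat l (Function.update v c true)) (h2 : Compat l (Function.update v c' true))
    (h12 : Compat l (Function.update (Function.update v c true) c' true)) :
    saddleSign R v c l * saddleSign R (Function.update v c true) c' l =
      saddleSign R v c' l * saddleSign R (Function.update v c' true) c l := by
  have hcomm : Function.update (Function.update v c' true) c true =
      Function.update (Function.update v c true) c' true := Function.update_comm hne.symm _ _ _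
  have e1 := D.falseCount_update hc hl h1
  have e2 := D.falseCount_update hc' hl h2
  have e3 := D.falseCount_update (v := Function.update v c true) (c := c')
    (by rw [Function.update_of_ne hne.symm, hc']) h1 h12
  have e4 := D.falseCount_update (v := Function.update v c' true) (c := c)
    (by rw [Function.update_of_ne hne, hc]) h2 (by rw [hcomm]; exact h12)
  rw [hcomm] at e4
  unfold saddleSign
  rcases e1 with ⟨a1, b1⟩ | ⟨a1, b1, d1⟩ | ⟨a1, b1, d1⟩ <;>
  rcases e2 with ⟨a2, b2⟩ | ⟨a2, b2, d2⟩ | ⟨a2, b2, d2⟩ <;>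
  rcases e3 with ⟨a3, b3⟩ | ⟨a3, b3, d3⟩ | ⟨a3, b3, d3⟩ <;>
  rcases e4 with ⟨a4, b4⟩ | ⟨a4, b4, d4⟩ | ⟨a4, b4, d4⟩ <;>
  first
  | (exfalso; rw [a1] at a4; exact absurd a4 (by decide))
  | (exfalso; rw [a2] at a3; exact absurd a3 (by decide))
  | (exfalso; omega)
  | simp [a1, a2, b1, b2, b3, b4]

/-- In the idempotent basis `d²` is a sum over ordered pairs of crossings. The two orders cancel
because `edgeSign` anticommutes and `saddleSign` commutes around each square. Arbitrary coefficients
are allowed since the Bockstein needs the integral complex. -/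
theorem diff_one_diff_one {R : Type} [CommRing R] (f : D.State → R) :
    D.diff 1 (D.diff 1 f) = 0 := by
  classical
  refine eq_zero_of_ev_eq_zero _ fun v l hl => ?_
  rw [D.ev_diff _ v l hl]
  let T : Fin D.n × Fin D.n → R := fun p =>
    if (v p.1 = true ∧ Compat l (Function.update v p.1 false)) ∧
      (Function.update v p.1 false p.2 = true ∧
        Compat l (Function.update (Function.update v p.1 false) p.2 false)) then
      edgeSign R (Function.update v p.1 false) p.1 *
        saddleSign R (Function.update v p.1 false) p.1 l *
        (edgeSign R (Function.update (Function.update v p.1 false) p.2 false) p.2 *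
        saddleSign R (Function.update (Function.update v p.1 false) p.2 false) p.2 l *
        ev (Function.update (Function.update v p.1 false) p.2 false) l f) else 0
  have hT : (∑ c, if v c = true ∧ Compat l (Function.update v c false) then
      edgeSign R (Function.update v c false) c * saddleSign R (Function.update v c false) c l *
        ev (Function.update v c false) l (D.diff 1 f) else 0) = ∑ p, T p := by
    rw [Fintype.sum_prod_type]
    refine Finset.sum_congr rfl fun c _ => ?_
    by_cases h : v c = true ∧ Compat l (Function.update v c false)
    · rw [if_pos h, D.ev_diff _ _ l h.2, Finset.mul_sum]
      refine Finset.sum_congr rfl fun c' _ => ?_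
      simp only [T, h, true_and]
      split_ifs <;> simp
    · simp [T, h]
  rw [hT]
  -- A colouring compatible with two opposite corners of a square is compatible with the other two,
  -- so the swapped pair contributes as well.
  have hcond : ∀ c c', ((v c = true ∧ Compat l (Function.update v c false)) ∧
      (Function.update v c false c' = true ∧
        Compat l (Function.update (Function.update v c false) c' false))) →
      c ≠ c' ∧ v c' = true ∧ Compat l (Function.update v c' false) := by
    rintro c c' ⟨⟨h1, h2⟩, h3, h4⟩
    have hne : c ≠ c' := by rintro rfl; simp at h3
    rw [Function.update_of_ne hne.symm] at h3
    refine ⟨hne, h3, hl.of_local h4 fun x => ?_⟩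
    by_cases hx : x = c'
    · subst hx; simp
    · simp [hx]
  refine Finset.sum_involution (fun p _ => p.swap) ?_ ?_ (fun _ _ => Finset.mem_univ _)
    (fun _ _ => Prod.swap_swap _)
  · rintro ⟨c, c'⟩ -
    simp only [T, Prod.swap_prod_mk]
    by_cases h : (v c = true ∧ Compat l (Function.update v c false)) ∧
      (Function.update v c false c' = true ∧
        Compat l (Function.update (Function.update v c false) c' false))
    · obtain ⟨hne, h1, h2⟩ := hcond c c' h
      have hcomm : Function.update (Function.update v c' false) c false =
        Function.update (Function.update v c false) c' false := Function.update_comm hne.symm _ _ _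
      rw [if_pos h, if_pos ⟨⟨h1, h2⟩, by rw [Function.update_of_ne hne, h.1.1], hcomm ▸ h.2.2⟩,
        hcomm]
      set w := Function.update (Function.update v c false) c' false with hw
      have hwc : w c = false := by simp [hw, hne]
      have hwc' : w c' = false := by simp [hw]
      have e1 : Function.update v c false = Function.update w c' true := by
        rw [hw, Function.update_idem, ← h.2.1, Function.update_eq_self]
      have e2 : Function.update v c' false = Function.update w c true := by
        rw [hw, Function.update_comm hne, Function.update_idem,
          show true = Function.update v c' false c by rw [Function.update_of_ne hne, h.1.1],
          Function.update_eq_self]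
      have e3 : v = Function.update (Function.update w c' true) c true := by
        rw [← e1, Function.update_idem, ← h.1.1, Function.update_eq_self]
      rw [e1] at h
      rw [e2] at h2
      rw [e1, e2]
      have s1 := edgeSign_anticomm R hne hwc hwc'
      have s2 := D.saddleSign_comm R hne.symm hwc' hwc h.2.2 h.1.2 h2 (e3 ▸ hl)
      linear_combination (saddleSign R w c' l * saddleSign R (Function.update w c' true) c l *
        ev w l f) * s1 - (edgeSign R w c * edgeSign R (Function.update w c true) c' *
        ev w l f) * s2
    · rw [if_neg h, if_neg (fun h' => h ?_), add_zero]
      obtain ⟨hne, h1, h2⟩ := hcond c' c h'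
      refine ⟨⟨h1, h2⟩, by rw [Function.update_of_ne hne, h'.1.1], ?_⟩
      rw [Function.update_comm hne.symm]
      exact h'.2.2
  · rintro ⟨c, c'⟩ - hT0 heq
    refine hT0 (if_neg fun h => (hcond c c' h).1 ?_)
    exact (congrArg Prod.snd heq)

theorem sum_dcoeff_one {R : Type} [CommRing R] (t s : D.State) :
    ∑ r, dcoeff (1 : R) t r * dcoeff 1 r s = 0 := by
  classical
  have h := congrFun (D.diff_one_diff_one (Pi.single s (1 : R))) t
  simpa [diff_apply, Pi.single_apply] using h

/-- The degree-preserving part of the relation for `h = 1`: no factor lowers the quantum degree, so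
a composite that preserves it consists of two factors that preserve it. -/
theorem diff_zero_diff_zero {R : Type} [CommRing R] (f : D.State → R) :
    D.diff 0 (D.diff 0 f) = 0 := by
  have key : ∀ t s : D.State, ∑ r, dcoeff (0 : R) t r * dcoeff 0 r s = 0 := by
    intro t s
    by_cases hts : D.qdeg t = D.qdeg s
    · refine Eq.trans ?_ (D.sum_dcoeff_one (R := R) t s)
      refine Finset.sum_congr rfl fun r _ => ?_
      rw [dcoeff_zero (1 : R), dcoeff_zero (1 : R)]
      by_cases h1 : dcoeff (1 : R) t r = 0
      · simp [h1]
      by_cases h2 : dcoeff (1 : R) r s = 0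
      · simp [h2]
      have h3 := qdeg_le_of_dcoeff_ne_zero h1
      have h4 := qdeg_le_of_dcoeff_ne_zero h2
      rw [if_pos (by omega), if_pos (by omega)]
    · refine Finset.sum_eq_zero fun r _ => ?_
      rw [dcoeff_zero (1 : R), dcoeff_zero (1 : R)]
      split_ifs with h1 h2
      · exact absurd (h1.trans h2) hts
      all_goals simp
  funext t
  simp only [diff_apply, Finset.mul_sum, Pi.zero_apply, ← mul_assoc]
  rw [Finset.sum_comm]
  refine Finset.sum_eq_zero fun s _ => ?_
  rw [← Finset.sum_mul, key, zero_mul]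

end LinkDiagram

/-! ### The canonical classes and the involution `x ↦ 1 + x` -/

namespace PreDiagram

variable {D : PreDiagram}

/-- Change the label of the circle through the edge `e`. -/
noncomputable def toggle (e : D.E) (s : D.State) : D.State :=
  ⟨s.1, Function.update s.2 (D.circ s.1 e) (!s.2 (D.circ s.1 e))⟩

theorem lab_toggle (e₀ : D.E) (s : D.State) (e : D.E) :
    lab (toggle e₀ s) e = if D.circ s.1 e = D.circ s.1 e₀ then !lab s e else lab s e := by
  change Function.update s.2 _ _ (D.circ s.1 e) = _
  by_cases h : D.circ s.1 e = D.circ s.1 e₀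
  · rw [if_pos h, lab, h, Function.update_self]
  · rw [if_neg h, lab, Function.update_of_ne h]

theorem toggle_toggle (e₀ : D.E) (s : D.State) : toggle e₀ (toggle e₀ s) = s := by
  refine state_ext rfl fun e => ?_
  rw [lab_toggle, lab_toggle]
  change (if D.circ s.1 e = D.circ s.1 e₀ then _ else _) = _
  split_ifs <;> simp

theorem sum_eq_zero_of_toggle (v : Fin D.n → Bool) (e₀ : D.E) (P : D.State → Prop)
    [DecidablePred fun s : D.State => s.1 = v ∧ P s]
    (hP : ∀ s, s.1 = v → P s → P (toggle e₀ s)) :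
    (∑ s, if s.1 = v ∧ P s then (1 : ZMod 2) else 0) = 0 := by
  refine Finset.sum_involution (fun s _ => toggle e₀ s) ?_ ?_ (fun _ _ => Finset.mem_univ _)
    (fun s _ => toggle_toggle e₀ s)
  · intro s _
    have h : (toggle e₀ s).1 = v ∧ P (toggle e₀ s) ↔ s.1 = v ∧ P s := by
      refine ⟨fun h => ⟨h.1, ?_⟩, fun h => ⟨h.1, hP s h.1 h.2⟩⟩
      simpa only [toggle_toggle] using hP _ h.1 h.2
    simp only [h]
    exact CharTwo.add_self_eq_zero _
  · intro s _ _ h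
    have h1 := congrArg (fun t => lab t e₀) h
    simp [lab_toggle] at h1

open Classical in
/-- The involution of the Bar-Natan complex induced by `x ↦ 1 + x`. -/
noncomputable def invol (f : D.State → ZMod 2) : D.State → ZMod 2 := fun s =>
  ∑ t, if t.1 = s.1 ∧ ∀ e, lab t e = true → lab s e = true then f t else 0

/-- The substitution `x ↦ 1 + x` exchanges the two evaluations of the algebra. On generators, the
coefficient of `f t` counts the states above `t` in the domain of `l`: only the state with all
labels `1` if `t` is in the domain of the opposite colouring, and otherwise an even number, as one
label can be changed freely. -/
theorem ev_invol (v : Fin D.n → Bool) (l : D.E → Bool) (hl : Compat l v) (f : D.State → ZMod 2) :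
    ev v l (invol f) = ev v (fun e => !l e) f := by
  classical
  have h1 : ev v l (invol f) = ∑ t, (if t.1 = v then f t else 0) *
      ∑ s, if s.1 = v ∧ (Dom l s ∧ ∀ e, lab t e = true → lab s e = true) then
        (1 : ZMod 2) else 0 := by
    simp only [ev, invol, Finset.mul_sum]
    rw [Finset.sum_comm]
    refine Finset.sum_congr rfl fun s _ => ?_
    by_cases hs : s.1 = v ∧ Dom l s
    · rw [if_pos hs]
      refine Finset.sum_congr rfl fun t _ => ?_
      simp only [hs, true_and]
      split_ifs <;> simp_all
    · rw [if_neg hs]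
      refine (Finset.sum_eq_zero fun t _ => ?_).symm
      rw [if_neg (c := s.1 = v ∧ _) (fun h => hs ⟨h.1, h.2.1⟩), mul_zero]
  rw [h1, ev]
  refine Finset.sum_congr rfl fun t _ => ?_
  by_cases ht : t.1 = v
  swap
  · simp [ht]
  by_cases hd : Dom (fun e => !l e) t
  · have hc : Compat (fun _ : D.E => true) v := fun _ _ _ => rfl
    rw [if_pos ht, if_pos ⟨ht, hd⟩, Finset.sum_eq_single (mkState v _ hc), if_pos, mul_one]
    · exact ⟨rfl, fun e => Or.inl rfl, fun e _ => rfl⟩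
    · rintro s - hs
      rw [ite_eq_right_iff]
      rintro ⟨h2, h3, h4⟩
      refine absurd (state_ext h2 fun e => ?_) hs
      rw [lab_mkState]
      rcases hd e with h5 | h5
      · exact h4 e h5
      · rcases h3 e with h6 | h6
        · exact h6
        · simp [h6] at h5
    · simp
  · rw [if_neg (c := t.1 = v ∧ _) (fun h => hd h.2)]
    have hd' : ∃ e₀, lab t e₀ = false ∧ l e₀ = true := by
      simp only [Dom, not_forall, not_or] at hd
      obtain ⟨e₀, h2, h3⟩ := hd
      exact ⟨e₀, by simpa using h2, by simpa using h3⟩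
    obtain ⟨e₀, h2, h3⟩ := hd'
    rw [sum_eq_zero_of_toggle v e₀, mul_zero]
    rintro s hs ⟨h4, h5⟩
    have h6 : ∀ e, D.circ s.1 e = D.circ s.1 e₀ → lab t e = false ∧ l e = true := by
      intro e he
      rw [hs] at he
      refine ⟨?_, ?_⟩
      · rw [← h2]; exact lab_congr (by rw [ht]; exact he)
      · rw [hl.eq he, h3]
    refine ⟨fun e => ?_, fun e he => ?_⟩ <;> rw [lab_toggle] <;> split_ifs with h7
    · exact Or.inr (h6 e h7).2
    · exact h4 e
    · rw [(h6 e h7).1] at he; simp at he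
    · exact h5 e he

theorem Compat.not {l : D.E → Bool} {v : Fin D.n → Bool} (h : Compat l v) :
    Compat (fun e => !l e) v := fun e e' he => congrArg Bool.not (h e e' he)

theorem compat_not_iff {l : D.E → Bool} {v : Fin D.n → Bool} :
    Compat (fun e => !l e) v ↔ Compat l v :=
  ⟨fun h => by simpa using h.not, Compat.not⟩

theorem invol_add (f g : D.State → ZMod 2) : invol (f + g) = invol f + invol g :=
  eq_of_ev_eq fun v l hl => by
    rw [ev_add, ev_invol _ _ hl, ev_invol _ _ hl, ev_invol _ _ hl, ev_add]

theorem qdeg_add_two_le {s t : D.State} (h : t.1 = s.1) (hl : ∀ e, lab t e = true → lab s e = true)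
    (hne : t ≠ s) : D.qdeg t + 2 ≤ D.qdeg s := by
  obtain ⟨v, f⟩ := s
  obtain ⟨w, g⟩ := t
  obtain rfl : w = v := h
  have hle : ∀ C, g C = true → f C = true := by
    intro C
    obtain ⟨e, rfl⟩ := D.circ_surjective w C
    exact hl e
  have hfg : ∃ C, g C ≠ f C := by
    by_contra hcon
    push Not at hcon
    exact hne (by rw [funext hcon])
  obtain ⟨C, hC⟩ := hfg
  have hpos : ∀ C, 0 ≤ labDeg (f C) - labDeg (g C) := by
    intro C
    have := hle C
    revert this
    cases f C <;> cases g C <;> simp [labDeg]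
  have h2 : 2 ≤ labDeg (f C) - labDeg (g C) := by
    have := hle C
    revert this hC
    cases f C <;> cases g C <;> simp [labDeg]
  have h3 := Finset.single_le_sum (fun C _ => hpos C) (Finset.mem_univ C)
  rw [Finset.sum_sub_distrib] at h3
  simp only [qdeg_eq]
  linarith

/-- Expanding `1 + x`, the generator itself is the leading term, and every other term replaces some
`x` by `1`, which raises the degree by at least 2. The leading terms cancel. -/
theorem add_invol_mem_filt {q : ℤ} {f : D.State → ZMod 2} (hf : f ∈ D.filt q) :
    f + invol f ∈ D.filt (q + 2) := by
  classical
  intro s hs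
  have h1 : invol f s = f s := by
    rw [invol, Finset.sum_eq_single s]
    · simp
    · intro t _ hts
      rw [ite_eq_right_iff]
      rintro ⟨h1, h2⟩
      have := qdeg_add_two_le h1 h2 hts
      exact hf t (by omega)
    · simp
  rw [Pi.add_apply, h1]
  exact CharTwo.add_self_eq_zero _

theorem filt_anti {q q' : ℤ} (h : q ≤ q') : D.filt q' ≤ D.filt q :=
  fun _ hf s hs => hf s fun hs' => hs (h.trans hs')

theorem invol_mem_filt {q : ℤ} {f : D.State → ZMod 2} (hf : f ∈ D.filt q) :
    invol f ∈ D.filt q := by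
  have h := sub_mem (filt_anti (by omega) (add_invol_mem_filt hf)) hf
  rwa [add_sub_cancel_left] at h

theorem invol_mem_supported_hdeg {i : ℤ} {f : D.State → ZMod 2}
    (hf : f ∈ D.supported (ZMod 2) fun s => D.hdeg s = i) :
    invol f ∈ D.supported (ZMod 2) fun s => D.hdeg s = i := by
  classical
  intro s hs
  refine Finset.sum_eq_zero fun t _ => ?_
  rw [ite_eq_right_iff]
  rintro ⟨h, -⟩
  have h1 : D.hdeg t = D.hdeg s := by unfold hdeg; rw [h]
  exact hf t fun ht => hs (h1.symm.trans ht)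

end PreDiagram

open PreDiagram

namespace LinkDiagram

variable (D : LinkDiagram)

theorem diff_invol (f : D.State → ZMod 2) : D.diff 1 (invol f) = invol (D.diff 1 f) := by
  classical
  have hone : ∀ (a : ZMod 2), -a = a := fun a => CharTwo.neg_eq a
  refine eq_of_ev_eq fun v l hl => ?_
  rw [ev_invol _ _ hl, D.ev_diff _ _ _ hl, D.ev_diff _ _ _ hl.not]
  refine Finset.sum_congr rfl fun c _ => ?_
  simp only [compat_not_iff]
  split_ifs with h
  · rw [ev_invol _ _ h.2]
    congr 2
    simp only [saddleSign, hone, ite_self]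
  · rfl

theorem compat_leftShade : Compat D.leftShade D.orientedRes := by
  rintro _ _ (⟨c, b, h⟩ | ⟨c, h⟩ | ⟨c, h⟩)
  · exact (D.leftShade_out c b).symm
  · simp [orientedRes] at h
  · simp [orientedRes] at h

/-- The colouring that belongs to the canonical generator `b`. -/
def canonicalColour (b : Bool) (e : D.E) : Bool := D.leftShade e == b

theorem compat_canonicalColour (b : Bool) : Compat (D.canonicalColour b) D.orientedRes :=
  fun e e' h => by rw [canonicalColour, canonicalColour, D.compat_leftShade e e' h]

/-- The two incoming edges at a crossing have opposite colours, but the smoothing that ignores the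
orientation joins them. So the canonical colourings meet no nonzero saddle, in either direction. -/
theorem not_compat_canonicalColour (b : Bool) (v : Fin D.n → Bool) (c : Fin D.n)
    (hv : v c = !D.orientedRes c) : ¬ Compat (D.canonicalColour b) v := by
  intro h
  have h1 := h _ _ (SmoothRel.unoriented_inc c (by rw [hv, orientedRes, Bool.not_not]))
  have h2 := D.leftShade_inc_not c true
  rw [Bool.not_true] at h2
  simp only [canonicalColour, h2] at h1
  revert h1
  cases D.leftShade (D.inc c true) <;> cases b <;> simp

-- On a circle of the oriented resolution the factor `x` evaluates to 1 exactly at colour `true` and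
-- `1 + x` exactly at colour `false`. So the canonical cochain is the idempotent of its colouring.
open Classical in
theorem ev_canonical (b : Bool) (v : Fin D.n → Bool) (l : D.E → Bool) (hl : Compat l v) :
    ev v l (D.canonical b) = if v = D.orientedRes ∧ l = D.canonicalColour b then 1 else 0 := by
  have h1 : ev v l (D.canonical b) = ∑ s, if s.1 = v ∧ (v = D.orientedRes ∧ Dom l s ∧
      ∀ e, D.leftShade e = b → lab s e = false) then 1 else 0 := by
    refine Finset.sum_congr rfl fun s _ => ?_
    by_cases hs : s.1 = v
    · subst hs
      by_cases hd : Dom l s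
      · simp only [hd, true_and, and_self, if_true, canonical]
        rfl
      · simp [hd]
    · simp [hs]
  rw [h1]
  by_cases hv : v = D.orientedRes
  swap
  · simp [hv]
  by_cases hlb : l = D.canonicalColour b
  · rw [if_pos ⟨hv, hlb⟩, Finset.sum_eq_single (mkState v (fun e => !l e) hl.not), if_pos]
    · refine ⟨rfl, hv, fun e => ?_, fun e he => ?_⟩
      · cases h : l e <;> simp [h]
      · simp [hlb, canonicalColour, he]
    · rintro s - hs
      rw [ite_eq_right_iff]
      rintro ⟨h2, -, h3, h4⟩
      refine absurd (state_ext h2 fun e => ?_) hs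
      rw [lab_mkState, hlb, canonicalColour]
      by_cases he : D.leftShade e = b
      · rw [h4 e he]; simp [he]
      · have : l e = false := by simp [hlb, canonicalColour, he]
        rcases h3 e with h5 | h5
        · rw [h5]; simp [he]
        · rw [this] at h5; simp at h5
    · simp
  · rw [if_neg (fun h => hlb h.2)]
    obtain ⟨e₀, he₀⟩ := Function.ne_iff.1 hlb
    by_cases hb : D.leftShade e₀ = b
    · have h2 : l e₀ = false := by simpa [canonicalColour, hb] using he₀
      refine Finset.sum_eq_zero fun s _ => ?_
      rw [ite_eq_right_iff]
      rintro ⟨-, -, h3, h4⟩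
      rcases h3 e₀ with h5 | h5
      · rw [h4 e₀ hb] at h5; simp at h5
      · rw [h2] at h5; simp at h5
    · have h0 : D.canonicalColour b e₀ = false := by simp [canonicalColour, hb]
      have h2 : l e₀ = true := by simpa [h0] using he₀
      refine sum_eq_zero_of_toggle v e₀ _ ?_
      rintro s hs ⟨-, h3, h4⟩
      have h6 : ∀ e, D.circ s.1 e = D.circ s.1 e₀ → D.leftShade e ≠ b ∧ l e = true := by
        intro e he
        rw [hs] at he
        exact ⟨by rwa [(hv ▸ D.compat_leftShade : Compat D.leftShade v).eq he],
          by rw [hl.eq he, h2]⟩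
      refine ⟨hv, fun e => ?_, fun e he => ?_⟩ <;> rw [lab_toggle] <;> split_ifs with h7
      · exact Or.inr (h6 e h7).2
      · exact h3 e
      · exact absurd he (h6 e h7).1
      · exact h4 e he

theorem invol_canonical (b : Bool) : invol (D.canonical b) = D.canonical (!b) := by
  classical
  refine eq_of_ev_eq fun v l hl => ?_
  rw [ev_invol _ _ hl, D.ev_canonical _ _ _ hl, D.ev_canonical _ _ _ hl.not]
  have : (fun e => !l e) = D.canonicalColour b ↔ l = D.canonicalColour (!b) := by
    simp only [funext_iff]
    refine forall_congr' fun e => ?_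
    rw [canonicalColour, canonicalColour]
    cases l e <;> cases D.leftShade e <;> cases b <;> simp
  simp only [this]

theorem diff_canonical (b : Bool) : D.diff 1 (D.canonical b) = 0 := by
  classical
  refine eq_zero_of_ev_eq_zero _ fun v l hl => ?_
  rw [D.ev_diff _ _ _ hl]
  refine Finset.sum_eq_zero fun c _ => ?_
  rw [ite_eq_right_iff]
  rintro ⟨h1, h2⟩
  rw [D.ev_canonical _ _ _ h2, if_neg, mul_zero]
  rintro ⟨h3, rfl⟩
  refine D.not_compat_canonicalColour b v c ?_ hl
  rw [← h3]; simp [h1]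

/-- No saddle reaches the canonical colouring, so evaluation there is defined on cohomology. This
separates the two canonical classes. -/
theorem ev_canonicalColour_diff (b : Bool) (f : D.State → ZMod 2) :
    ev D.orientedRes (D.canonicalColour b) (D.diff 1 f) = 0 := by
  classical
  rw [D.ev_diff _ _ _ (D.compat_canonicalColour b)]
  refine Finset.sum_eq_zero fun c _ => ?_
  rw [ite_eq_right_iff]
  rintro ⟨h1, h2⟩
  exact absurd h2 (D.not_compat_canonicalColour b _ c (by simp [h1]))

theorem ev_canonicalColour_canonical (b : Bool) :
    ev D.orientedRes (D.canonicalColour b) (D.canonical b) = 1 := by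
  rw [D.ev_canonical _ _ _ (D.compat_canonicalColour b), if_pos ⟨rfl, rfl⟩]

theorem ev_canonicalColour_canonical_not [hE : Nonempty D.E] (b : Bool) :
    ev D.orientedRes (D.canonicalColour b) (D.canonical (!b)) = 0 := by
  rw [D.ev_canonical _ _ _ (D.compat_canonicalColour b), if_neg]
  rintro ⟨-, h⟩
  obtain ⟨e⟩ := hE
  have := congrFun h e
  revert this
  rw [canonicalColour, canonicalColour]
  cases D.leftShade e <;> cases b <;> simp

theorem hdeg_of_orientedRes {s : D.State} (hs : s.1 = D.orientedRes) : D.hdeg s = 0 := by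
  rw [hdeg, hs, height, negCount]
  simp [orientedRes]

theorem canonical_mem_supported (b : Bool) :
    D.canonical b ∈ D.supported (ZMod 2) fun s => D.hdeg s = 0 := by
  intro s hs
  rw [canonical, if_neg]
  exact fun h => hs (D.hdeg_of_orientedRes h.1)

theorem canonical_mem_ZBN (b : Bool) : D.canonical b ∈ D.ZBN 0 :=
  ⟨D.diff_canonical b, D.canonical_mem_supported b⟩

end LinkDiagram

/-! ### Gradings, filtrations and the Bockstein on cochains -/

namespace PreDiagram

variable {D : PreDiagram} {R : Type} [CommRing R]

theorem exists_of_diff_ne_zero {h : R} {f : D.State → R} {t : D.State} (ht : D.diff h f t ≠ 0) :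
    ∃ s, dcoeff h t s ≠ 0 ∧ f s ≠ 0 := by
  rw [diff_apply] at ht
  obtain ⟨s, -, hs⟩ := Finset.exists_ne_zero_of_sum_ne_zero ht
  exact ⟨s, left_ne_zero_of_mul hs, right_ne_zero_of_mul hs⟩

theorem diff_mem_supported_hdeg (h : R) {i : ℤ} {f : D.State → R}
    (hf : f ∈ D.supported R fun s => D.hdeg s = i) :
    D.diff h f ∈ D.supported R fun s => D.hdeg s = i + 1 := by
  intro t ht
  by_contra hne
  obtain ⟨s, h1, h2⟩ := exists_of_diff_ne_zero hne
  refine ht ?_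
  change D.hdeg t = i + 1
  rw [hdeg_of_dcoeff_ne_zero h1]
  by_contra h3
  exact h2 (hf s fun h4 => h3 (by rw [h4]))

theorem diff_mem_CKh {i q : ℤ} {f : D.State → R} (hf : f ∈ D.CKh R i q) :
    D.diff 0 f ∈ D.CKh R (i + 1) q := by
  intro t ht
  by_contra hne
  obtain ⟨s, h1, h2⟩ := exists_of_diff_ne_zero hne
  refine ht ?_
  change D.hdeg t = i + 1 ∧ D.qdeg t = q
  rw [hdeg_of_dcoeff_ne_zero h1, qdeg_eq_of_dcoeff_zero_ne_zero h1]
  by_contra h3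
  exact h2 (hf s fun h4 => h3 (by rw [h4.1, h4.2]; exact ⟨rfl, rfl⟩))

theorem diff_mem_filt {q : ℤ} {f : D.State → ZMod 2} (hf : f ∈ D.filt q) :
    D.diff 1 f ∈ D.filt q := by
  intro t ht
  by_contra hne
  obtain ⟨s, h1, h2⟩ := exists_of_diff_ne_zero hne
  have h3 := qdeg_le_of_dcoeff_ne_zero h1
  exact h2 (hf s (by omega))

theorem component_apply (q : ℤ) (f : D.State → ZMod 2) (s : D.State) :
    D.component q f s = if D.qdeg s = q then f s else 0 := by
  unfold component
  dsimp only [LinearMap.coe_mk, AddHom.coe_mk]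

/-- The Bar-Natan differential never lowers the quantum degree and its degree-preserving part is
Khovanov's, so the lowest term of the image is the image of the lowest term. -/
theorem component_diff {q : ℤ} {f : D.State → ZMod 2} (hf : f ∈ D.filt q) :
    D.component q (D.diff 1 f) = D.diff 0 (D.component q f) := by
  funext t
  rw [component_apply, diff_apply, diff_apply]
  by_cases ht : D.qdeg t = q
  · rw [if_pos ht]
    refine Finset.sum_congr rfl fun s _ => ?_
    rw [component_apply, dcoeff_zero (1 : ZMod 2)]
    by_cases hs : D.qdeg s = q
    · rw [if_pos hs, if_pos (by rw [ht, hs])]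
    · rw [if_neg hs, mul_zero]
      by_contra hne
      have h1 := qdeg_le_of_dcoeff_ne_zero (left_ne_zero_of_mul hne)
      exact right_ne_zero_of_mul hne (hf s (by omega))
  · rw [if_neg ht]
    refine (Finset.sum_eq_zero fun s _ => ?_).symm
    rw [component_apply, dcoeff_zero (1 : ZMod 2)]
    split_ifs with h1 h2
    · exact absurd (h1.trans h2) ht
    all_goals simp

theorem component_of_mem_filt {q : ℤ} {f : D.State → ZMod 2} (hf : f ∈ D.filt (q + 1)) :
    D.component q f = 0 := by
  funext s
  rw [component_apply]
  split_ifs with h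
  · exact hf s (by omega)
  · rfl

theorem mem_filt_of_component {q : ℤ} {f : D.State → ZMod 2} (hf : f ∈ D.filt q)
    (h : D.component q f = 0) : f ∈ D.filt (q + 1) := by
  intro s hs
  by_cases h1 : D.qdeg s = q
  · have h2 := congrFun h s
    rwa [component_apply, if_pos h1] at h2
  · exact hf s (by omega)

theorem mod2_add (f g : D.State → ℤ) : D.mod2 (f + g) = D.mod2 f + D.mod2 g := by
  ext s; simp [mod2]

theorem mod2_sub (f g : D.State → ℤ) : D.mod2 (f - g) = D.mod2 f - D.mod2 g := by
  ext s; simp [mod2]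

theorem mod2_two_smul (f : D.State → ℤ) : D.mod2 (2 • f) = 0 := by
  ext s
  simp only [mod2, Pi.smul_apply, Pi.zero_apply, nsmul_eq_mul]
  push_cast
  rw [show (2 : ZMod 2) = 0 from rfl, zero_mul]

theorem mod2_mem_CKh {i q : ℤ} {f : D.State → ℤ} (hf : f ∈ D.CKh ℤ i q) :
    D.mod2 f ∈ D.CKh (ZMod 2) i q := fun s hs => by simp [mod2, hf s hs]

theorem edgeCoeff_intCast (s t : D.State) (c : Fin D.n) :
    ((D.edgeCoeff (0 : ℤ) s t c : ℤ) : R) = D.edgeCoeff 0 s t c := by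
  have h1 : ∀ x y z, ((mulCoeff (0 : ℤ) x y z : ℤ) : R) = mulCoeff 0 x y z := by
    intro x y z; cases x <;> cases y <;> cases z <;> simp [mulCoeff]
  have h2 : ∀ x y z, ((comulCoeff (0 : ℤ) x y z : ℤ) : R) = comulCoeff 0 x y z := by
    intro x y z; cases x <;> cases y <;> cases z <;> simp [comulCoeff]
  by_cases hA : Adj s t c
  · rw [edgeCoeff_of_adj _ hA, edgeCoeff_of_adj _ hA]
    simp only [edgeSign]
    push_cast
    rw [h1, h2]
  · rw [edgeCoeff_of_not_adj _ hA, edgeCoeff_of_not_adj _ hA, Int.cast_zero]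

theorem mod2_diff (f : D.State → ℤ) : D.mod2 (D.diff 0 f) = D.diff 0 (D.mod2 f) := by
  ext t
  rw [mod2, diff_apply, diff_apply]
  push_cast
  refine Finset.sum_congr rfl fun s _ => ?_
  rw [dcoeff, dcoeff]
  push_cast
  simp only [edgeCoeff_intCast]
  rfl

/-- The integral lift of a cochain with values `0` and `1`. -/
def intLift (f : D.State → ZMod 2) : D.State → ℤ := fun s => (f s).val

theorem mod2_intLift (f : D.State → ZMod 2) : D.mod2 (intLift f) = f := by
  ext s; simp [mod2, intLift]

theorem intLift_mem_CKh {i q : ℤ} {f : D.State → ZMod 2} (hf : f ∈ D.CKh (ZMod 2) i q) :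
    intLift f ∈ D.CKh ℤ i q := fun s hs => by simp [intLift, hf s hs]

theorem exists_two_smul_of_mod2_eq_zero {P : D.State → Prop} {f : D.State → ℤ}
    (hP : f ∈ D.supported ℤ P) (hf : D.mod2 f = 0) :
    ∃ g ∈ D.supported ℤ P, f = 2 • g := by
  refine ⟨fun s => f s / 2, fun s hs => by simp [hP s hs], ?_⟩
  ext s
  have h := (ZMod.intCast_zmod_eq_zero_iff_dvd (f s) 2).1 (congrFun hf s)
  simp only [Pi.smul_apply, nsmul_eq_mul]
  exact (Int.mul_ediv_cancel' h).symm

end PreDiagram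

open PreDiagram

namespace LinkDiagram

variable (D : LinkDiagram)

theorem two_smul_injective {f g : D.State → ℤ} (h : 2 • f = 2 • g) : f = g := by
  ext s
  have := congrFun h s
  simp only [Pi.smul_apply, nsmul_eq_mul] at this
  simpa using this

theorem mod2_mem_ZKh_of_diff_eq {i q : ℤ} {f g : D.State → ℤ} (hf : f ∈ D.CKh ℤ (i - 1) q)
    (hg : g ∈ D.CKh ℤ i q) (h : D.diff 0 f = 2 • g) :
    D.mod2 f ∈ D.ZKh (ZMod 2) (i - 1) q ∧ D.mod2 g ∈ D.ZKh (ZMod 2) i q := by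
  refine ⟨⟨?_, mod2_mem_CKh hf⟩, ⟨?_, mod2_mem_CKh hg⟩⟩
  · change D.diff 0 (D.mod2 f) = 0
    rw [← mod2_diff, h, mod2_two_smul]
  · have h1 : D.diff 0 g = 0 := by
      refine D.two_smul_injective ?_
      rw [← map_nsmul, ← h, D.diff_zero_diff_zero, smul_zero]
    change D.diff 0 (D.mod2 g) = 0
    rw [← mod2_diff, h1]
    ext s; simp [mod2]

/-- Equality of classes becomes equality of cochains: a coboundary `d k` added to `g` is absorbed by
adding `2 k` to `f`. -/
theorem mem_sq1Cocycles {i q : ℤ} {z : D.State → ZMod 2} :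
    z ∈ D.sq1Cocycles i q ↔ ∃ f ∈ D.CKh ℤ (i - 1) q, ∃ g ∈ D.CKh ℤ i q,
      D.diff 0 f = 2 • g ∧ z = D.mod2 g := by
  constructor
  · rintro ⟨⟨z, hz⟩, ⟨x, f, hf, g, hg, h, hf', hg', -, hy⟩, rfl⟩
    have h1 := (Submodule.Quotient.eq _).1 hy
    obtain ⟨k, hk, h2⟩ := h1
    change D.diff 0 k = z - D.mod2 g at h2
    have hk' := intLift_mem_CKh hk
    refine ⟨f + 2 • intLift k, add_mem hf (Submodule.smul_of_tower_mem _ 2 hk'),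
      g + D.diff 0 (intLift k), add_mem hg ?_, ?_, ?_⟩
    · simpa using diff_mem_CKh hk'
    · rw [map_add, h, map_nsmul, smul_add]
    · change z = _
      rw [mod2_add, mod2_diff, mod2_intLift, h2]; abel
  · rintro ⟨f, hf, g, hg, h, rfl⟩
    obtain ⟨hf', hg'⟩ := D.mod2_mem_ZKh_of_diff_eq hf hg h
    exact ⟨⟨_, hg'⟩, ⟨_, f, hf, g, hg, h, hf', hg', rfl, rfl⟩, rfl⟩

theorem exists_of_sq1_eq_zero {i q : ℤ}
    (hT : ∀ (x : D.Kh (ZMod 2) (i - 1) q) (y : D.Kh (ZMod 2) i q), D.IsSq1 i q x y → y = 0)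
    {f g : D.State → ℤ} (hf : f ∈ D.CKh ℤ (i - 1) q) (hg : g ∈ D.CKh ℤ i q)
    (h : D.diff 0 f = 2 • g) : ∃ k ∈ D.CKh (ZMod 2) (i - 1) q, D.mod2 g = D.diff 0 k := by
  obtain ⟨hf', hg'⟩ := D.mod2_mem_ZKh_of_diff_eq hf hg h
  have h1 := hT _ _ ⟨f, hf, g, hg, h, hf', hg', rfl, rfl⟩
  obtain ⟨k, hk, h2⟩ := (Submodule.Quotient.mk_eq_zero _).1 h1
  exact ⟨k, hk, h2.symm⟩

/-! ### The invariants in terms of cochains -/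

/-- Both canonical classes have representatives in `U`. -/
def CanonicalIn (U : Submodule (ZMod 2) (D.State → ZMod 2)) : Prop :=
  ∀ b, ∃ k ∈ D.supported (ZMod 2) fun s => D.hdeg s = -1, D.canonical b + D.diff 1 k ∈ U

theorem CanonicalIn.mono {U V : Submodule (ZMod 2) (D.State → ZMod 2)} (h : D.CanonicalIn U)
    (hUV : U ≤ V) : D.CanonicalIn V := fun b => by
  obtain ⟨k, hk, hu⟩ := h b
  exact ⟨k, hk, hUV hu⟩

/-- The canonical classes. -/
noncomputable def canonicalClass (b : Bool) : D.KhBN 0 :=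
  Submodule.Quotient.mk ⟨D.canonical b, D.canonical_mem_ZBN b⟩

theorem canonical_add_diff_mem_ZBN (b : Bool) {k : D.State → ZMod 2}
    (hk : k ∈ D.supported (ZMod 2) fun s => D.hdeg s = -1) :
    D.canonical b + D.diff 1 k ∈ D.ZBN 0 := by
  refine add_mem (D.canonical_mem_ZBN b) ⟨?_, ?_⟩
  · exact D.diff_one_diff_one k
  · simpa using diff_mem_supported_hdeg 1 hk

theorem canonicalClass_mem_classes {b : Bool} {U : Submodule (ZMod 2) (D.State → ZMod 2)} :
    D.canonicalClass b ∈ D.classes 0 U ↔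
      ∃ k ∈ D.supported (ZMod 2) fun s => D.hdeg s = -1, D.canonical b + D.diff 1 k ∈ U := by
  constructor
  · rintro ⟨⟨u, hu⟩, huU, h⟩
    obtain ⟨k, hk, h1⟩ := (Submodule.Quotient.eq _).1 h
    change D.diff 1 k = u - D.canonical b at h1
    refine ⟨k, by simpa using hk, ?_⟩
    rw [h1, add_sub_cancel]
    exact huU
  · rintro ⟨k, hk, hU⟩
    refine ⟨⟨_, D.canonical_add_diff_mem_ZBN b hk⟩, hU, ?_⟩
    refine (Submodule.Quotient.eq _).2 ⟨k, by simpa using hk, ?_⟩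
    change D.diff 1 k = D.canonical b + D.diff 1 k - D.canonical b
    abel

theorem W_eq_span : D.W = Submodule.span (ZMod 2) (Set.range D.canonicalClass) := by
  apply le_antisymm
  · rintro _ ⟨⟨w, hw⟩, hw', rfl⟩
    obtain ⟨a, ha⟩ := (Submodule.mem_span_range_iff_exists_fun _).1 hw'
    refine (Submodule.mem_span_range_iff_exists_fun _).2 ⟨a, ?_⟩
    have h1 : (⟨w, hw⟩ : D.ZBN 0) = ∑ b, a b • ⟨D.canonical b, D.canonical_mem_ZBN b⟩ := by
      apply Subtype.ext
      refine Eq.trans (show w = _ from ha.symm) ?_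
      simp
    rw [h1, map_sum]
    simp only [map_smul]
    rfl
  · rw [Submodule.span_le]
    rintro _ ⟨b, rfl⟩
    exact ⟨⟨D.canonical b, D.canonical_mem_ZBN b⟩, Submodule.subset_span ⟨b, rfl⟩, rfl⟩

theorem ev_sum_smul_canonical [Nonempty D.E] (a : Bool → ZMod 2) (b : Bool) :
    ev D.orientedRes (D.canonicalColour b) (∑ b, a b • D.canonical b) = a b := by
  have hsmul : ∀ (r : ZMod 2) (f : D.State → ZMod 2),
      ev D.orientedRes (D.canonicalColour b) (r • f) =
        r * ev D.orientedRes (D.canonicalColour b) f := by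
    intro r f
    simp only [ev, Finset.mul_sum]
    refine Finset.sum_congr rfl fun s _ => ?_
    split_ifs <;> simp
  have h1 := D.ev_canonicalColour_canonical b
  have h2 := D.ev_canonicalColour_canonical_not b
  rw [Fintype.sum_bool, ev_add, hsmul, hsmul]
  cases b
  · rw [Bool.not_false] at h2; rw [h1, h2]; ring
  · rw [Bool.not_true] at h2; rw [h1, h2]; ring

theorem linearIndependent_canonicalClass [Nonempty D.E] :
    LinearIndependent (ZMod 2) D.canonicalClass := by
  rw [Fintype.linearIndependent_iff]
  intro a ha b
  have h1 : ∑ b, a b • D.canonicalClass b = Submodule.Quotient.mk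
      (∑ b, a b • (⟨D.canonical b, D.canonical_mem_ZBN b⟩ : D.ZBN 0)) := by
    rw [← Submodule.mkQ_apply, map_sum]
    simp only [map_smul]
    rfl
  rw [h1] at ha
  obtain ⟨k, -, hk⟩ := (Submodule.Quotient.mk_eq_zero _).1 ha
  have h2 : D.diff 1 k = ∑ b, a b • D.canonical b := by
    refine hk.trans ?_
    simp
  rw [← D.ev_sum_smul_canonical a b, ← h2, D.ev_canonicalColour_diff]

/-- For a nonempty diagram the canonical classes are independent, so `W` has dimension exactly 2 and
an intersection of dimension at least 2 is all of `W`. -/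
theorem two_le_finrank_iff [Nonempty D.E] (U : Submodule (ZMod 2) (D.State → ZMod 2)) :
    2 ≤ Module.finrank (ZMod 2) ↥(D.classes 0 U ⊓ D.W) ↔ D.CanonicalIn U := by
  have hW : Module.finrank (ZMod 2) D.W = 2 := by
    rw [W_eq_span, finrank_span_eq_card D.linearIndependent_canonicalClass, Fintype.card_bool]
  constructor
  · intro h b
    rw [← canonicalClass_mem_classes]
    have h1 : D.classes 0 U ⊓ D.W = D.W :=
      Submodule.eq_of_le_of_finrank_le inf_le_right (by rw [hW]; exact h)
    have h2 : D.canonicalClass b ∈ D.W := by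
      rw [W_eq_span]; exact Submodule.subset_span ⟨b, rfl⟩
    rw [← h1] at h2
    exact h2.1
  · intro h
    rw [inf_eq_right.2, hW]
    rw [W_eq_span, Submodule.span_le]
    rintro _ ⟨b, rfl⟩
    exact D.canonicalClass_mem_classes.2 (h b)

theorem CanonicalIn.exists_ne_zero {U : Submodule (ZMod 2) (D.State → ZMod 2)}
    (h : D.CanonicalIn U) : ∃ u ∈ U, u ≠ 0 := by
  obtain ⟨k, -, hk⟩ := h true
  refine ⟨_, hk, fun h0 => ?_⟩
  have h1 := congrArg (ev D.orientedRes (D.canonicalColour true)) h0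
  rw [ev_add, D.ev_canonicalColour_diff, D.ev_canonicalColour_canonical] at h1
  simp [ev] at h1

/-- The cochains of filtration degree at least `q` whose component in degree `q` is a cocycle that
represents an element of the image of `Sq¹`. -/
noncomputable def sq1Filt (q : ℤ) : Submodule (ZMod 2) (D.State → ZMod 2) :=
  D.filt q ⊓ (D.sq1Cocycles 0 q).comap (D.component q)

theorem filt_le_sq1Filt (q : ℤ) : D.filt (q + 1) ≤ D.sq1Filt q := by
  intro f hf
  refine ⟨filt_anti (by omega) hf, ?_⟩
  change D.component q f ∈ D.sq1Cocycles 0 q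
  rw [component_of_mem_filt hf]
  exact zero_mem _

theorem filt_add_two {q : ℤ} (hq : q ≡ Nat.card D.Component [ZMOD 2]) :
    D.filt (q + 1) = D.filt (q + 2) := by
  refine le_antisymm (fun f hf s hs => hf s ?_) (filt_anti (by omega))
  have := D.qdeg_modEq s
  simp only [Int.ModEq] at *
  omega

theorem canonicalIn_filt_of_forall_le {q : ℤ} (h : ∀ s : D.State, q ≤ D.qdeg s) :
    D.CanonicalIn (D.filt q) := fun _ =>
  ⟨0, zero_mem _, fun s hs => absurd (h s) hs⟩

theorem CanonicalIn.exists_le_qdeg {q : ℤ} (h : D.CanonicalIn (D.filt q)) :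
    ∃ s : D.State, q ≤ D.qdeg s := by
  obtain ⟨u, hu, hne⟩ := h.exists_ne_zero
  by_contra hcon
  push Not at hcon
  exact hne (funext fun s => hu s (not_le.2 (hcon s)))

theorem qdeg_of_isEmpty [IsEmpty D.E] (s : D.State) : D.qdeg s = 0 ∧ D.hdeg s = 0 := by
  have hn : D.n = 0 := by
    by_contra h
    exact IsEmpty.false (D.inc ⟨0, Nat.pos_of_ne_zero h⟩ true)
  have : IsEmpty (Fin D.n) := by rw [hn]; infer_instance
  have : IsEmpty (D.Circle s.1) := ⟨fun C => IsEmpty.false C.out⟩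
  simp [qdeg, hdeg, height, negCount, posCount]

/-- This form also covers the empty diagram, where `W` is too small for the dimension condition: its
only generator has degree 0, in accordance with the convention `s = 1`. -/
theorem isGreatest_s : IsGreatest
    {q | q ≡ Nat.card D.Component [ZMOD 2] ∧ D.CanonicalIn (D.filt q)} (D.s - 1) := by
  by_cases hE : IsEmpty D.E
  · rw [s, if_pos hE]
    have h0 : Nat.card D.Component = 0 := by
      have : IsEmpty D.Component := ⟨fun C => IsEmpty.false C.out⟩
      simp
    refine ⟨⟨by rw [h0]; rfl, D.canonicalIn_filt_of_forall_le fun s => ?_⟩, ?_⟩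
    · rw [(D.qdeg_of_isEmpty s).1]; rfl
    · rintro q ⟨-, hq⟩
      obtain ⟨s, hs⟩ := hq.exists_le_qdeg
      rwa [(D.qdeg_of_isEmpty s).1] at hs
  · have := not_isEmpty_iff.1 hE
    rw [s, if_neg hE, add_sub_cancel_right]
    have h1 : {q | D.IsFull q} =
        {q | q ≡ Nat.card D.Component [ZMOD 2] ∧ D.CanonicalIn (D.filt q)} := by
      ext q
      exact and_congr_right fun _ => D.two_le_finrank_iff _
    rw [h1]
    obtain ⟨M, hM⟩ := (Set.finite_range D.qdeg).bddAbove
    obtain ⟨m, hm⟩ := (Set.finite_range D.qdeg).bddBelow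
    have hb : BddAbove {q | q ≡ Nat.card D.Component [ZMOD 2] ∧ D.CanonicalIn (D.filt q)} := by
      refine ⟨M, ?_⟩
      rintro q ⟨-, hq⟩
      obtain ⟨s, hs⟩ := hq.exists_le_qdeg
      exact hs.trans (hM ⟨s, rfl⟩)
    refine ⟨Int.csSup_mem ?_ hb, fun q hq => le_csSup hb hq⟩
    -- A number of the right parity that is at most `-|m|`, hence below all quantum degrees.
    refine ⟨Nat.card D.Component - 2 * (|m| + Nat.card D.Component), ?_,
      D.canonicalIn_filt_of_forall_le fun s => ?_⟩
    · simp only [Int.ModEq]; omega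
    · have h2 := hm ⟨s, rfl⟩
      have h3 := neg_abs_le m
      have h4 := abs_nonneg m
      omega

theorem s_sub_one_modEq : D.s - 1 ≡ Nat.card D.Component [ZMOD 2] := D.isGreatest_s.1.1

theorem canonicalIn_filt_iff {q : ℤ} (hq : q ≡ Nat.card D.Component [ZMOD 2]) :
    D.CanonicalIn (D.filt q) ↔ q ≤ D.s - 1 :=
  ⟨fun h => D.isGreatest_s.2 ⟨hq, h⟩, fun h => D.isGreatest_s.1.2.mono _ (filt_anti h)⟩

-- No `Sq¹`-full degree exceeds `s - 1`, as `Sq¹`-full implies full. The degree `s - 3` always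
-- qualifies: representatives in filtration degree `s - 1` have zero component there. Parity
-- excludes everything between.
open Classical in
theorem sPlusSq1_eq : D.sPlusSq1 = if D.CanonicalIn (D.sq1Filt (D.s - 1)) then D.s + 2 else D.s := by
  by_cases hE : IsEmpty D.E
  · rw [sPlusSq1, if_pos hE, if_neg, s, if_pos hE]
    -- The empty diagram has no generators of homological degree `-1`, so the image of `Sq¹` is zero
    -- and there is no refinement.
    intro h
    obtain ⟨u, ⟨-, hu⟩, hne⟩ := h.exists_ne_zero
    rw [s, if_pos hE] at hu
    have hu := D.mem_sq1Cocycles.1 (Submodule.mem_comap.1 hu)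
    obtain ⟨f, hf, g, -, h1, h2⟩ := hu
    have hf0 : f = 0 := funext fun s => hf s fun h => by
      have h3 := h.1
      rw [(D.qdeg_of_isEmpty s).2] at h3
      simp at h3
    have hg0 : g = 0 := D.two_smul_injective (by rw [← h1, hf0, map_zero, smul_zero])
    refine hne (funext fun s => ?_)
    have h3 := congrFun h2 s
    rwa [component_apply, if_pos (by rw [(D.qdeg_of_isEmpty s).1]; rfl), hg0,
      show D.mod2 0 s = 0 from Int.cast_zero] at h3
  · have := not_isEmpty_iff.1 hE
    rw [sPlusSq1, if_neg hE]
    have h1 : {q | D.IsSq1Full q} =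
        {q | q ≡ Nat.card D.Component [ZMOD 2] ∧ D.CanonicalIn (D.sq1Filt q)} := by
      ext q
      exact and_congr_right fun _ => D.two_le_finrank_iff _
    have hle : ∀ q, q ≡ Nat.card D.Component [ZMOD 2] → D.CanonicalIn (D.sq1Filt q) →
        q ≤ D.s - 1 := fun q hq h => (D.canonicalIn_filt_iff hq).1 (h.mono _ inf_le_left)
    have hs := D.s_sub_one_modEq
    rw [h1]
    split_ifs with h
    · have : IsGreatest {q | q ≡ Nat.card D.Component [ZMOD 2] ∧ D.CanonicalIn (D.sq1Filt q)}
          (D.s - 1) := ⟨⟨hs, h⟩, fun q hq => hle q hq.1 hq.2⟩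
      rw [this.csSup_eq]; ring
    · have hs3 : D.s - 3 ≡ Nat.card D.Component [ZMOD 2] := by
        simp only [Int.ModEq] at *; omega
      have : IsGreatest {q | q ≡ Nat.card D.Component [ZMOD 2] ∧ D.CanonicalIn (D.sq1Filt q)}
          (D.s - 3) := by
        refine ⟨⟨hs3, CanonicalIn.mono _ ?_ (D.filt_le_sq1Filt _)⟩, ?_⟩
        · rw [D.filt_add_two hs3, show D.s - 3 + 2 = D.s - 1 by ring]
          exact D.isGreatest_s.1.2
        · rintro q ⟨hq1, hq2⟩
          have h2 := hle q hq1 hq2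
          have h3 : q ≠ D.s - 1 := by rintro rfl; exact h hq2
          simp only [Int.ModEq] at *
          omega
      rw [this.csSup_eq]; ring

end LinkDiagram

/-! ### The cube of a disjoint union -/

namespace PreDiagram

variable {D₁ D₂ : PreDiagram}

/-- The resolution of a disjoint union given by resolutions of the two parts. -/
def joinRes (v : Fin D₁.n → Bool) (w : Fin D₂.n → Bool) : Fin (D₁.disjUnion D₂).n → Bool :=
  Fin.append v w

/-- A crossing of the first part as a crossing of the disjoint union. -/
def crossingL (D₂ : PreDiagram) (c : Fin D₁.n) : Fin (D₁.disjUnion D₂).n := Fin.castAdd D₂.n c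

/-- A crossing of the second part as a crossing of the disjoint union. -/
def crossingR (D₁ : PreDiagram) (c : Fin D₂.n) : Fin (D₁.disjUnion D₂).n := Fin.natAdd D₁.n c

/-- An edge of the first part as an edge of the disjoint union. -/
def edgeL (D₂ : PreDiagram) (e : D₁.E) : (D₁.disjUnion D₂).E := Sum.inl e

/-- An edge of the second part as an edge of the disjoint union. -/
def edgeR (D₁ : PreDiagram) (e : D₂.E) : (D₁.disjUnion D₂).E := Sum.inr e

theorem crossing_cases {P : Fin (D₁.disjUnion D₂).n → Prop} (hl : ∀ c, P (crossingL D₂ c))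
    (hr : ∀ c, P (crossingR D₁ c)) (c : Fin (D₁.disjUnion D₂).n) : P c :=
  Fin.addCases (motive := P) hl hr c

theorem edge_cases {P : (D₁.disjUnion D₂).E → Prop} (hl : ∀ e, P (edgeL D₂ e))
    (hr : ∀ e, P (edgeR D₁ e)) : ∀ e, P e
  | Sum.inl e => hl e
  | Sum.inr e => hr e

section simps

variable (v : Fin D₁.n → Bool) (w : Fin D₂.n → Bool)

@[simp] theorem joinRes_crossingL (c : Fin D₁.n) : joinRes v w (crossingL D₂ c) = v c :=
  Fin.append_left _ _ _

@[simp] theorem joinRes_crossingR (c : Fin D₂.n) : joinRes v w (crossingR D₁ c) = w c :=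
  Fin.append_right _ _ _

@[simp] theorem pos_crossingL (c : Fin D₁.n) : (D₁.disjUnion D₂).pos (crossingL D₂ c) = D₁.pos c :=
  Fin.append_left _ _ _

@[simp] theorem pos_crossingR (c : Fin D₂.n) : (D₁.disjUnion D₂).pos (crossingR D₁ c) = D₂.pos c :=
  Fin.append_right _ _ _

@[simp] theorem inc_crossingL (c : Fin D₁.n) (b : Bool) :
    (D₁.disjUnion D₂).inc (crossingL D₂ c) b = edgeL D₂ (D₁.inc c b) :=
  by simp [disjUnion, crossingL, edgeL]

@[simp] theorem inc_crossingR (c : Fin D₂.n) (b : Bool) :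
    (D₁.disjUnion D₂).inc (crossingR D₁ c) b = edgeR D₁ (D₂.inc c b) :=
  by simp [disjUnion, crossingR, edgeR]

@[simp] theorem out_crossingL (c : Fin D₁.n) (b : Bool) :
    (D₁.disjUnion D₂).out (crossingL D₂ c) b = edgeL D₂ (D₁.out c b) :=
  by simp [disjUnion, crossingL, edgeL]

@[simp] theorem out_crossingR (c : Fin D₂.n) (b : Bool) :
    (D₁.disjUnion D₂).out (crossingR D₁ c) b = edgeR D₁ (D₂.out c b) :=
  by simp [disjUnion, crossingR, edgeR]

theorem crossingL_injective : Function.Injective (crossingL (D₁ := D₁) D₂) :=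
  Fin.castAdd_injective _ _

theorem crossingR_injective : Function.Injective (crossingR (D₂ := D₂) D₁) :=
  Fin.natAdd_injective _ _

theorem crossingL_ne_crossingR (c : Fin D₁.n) (c' : Fin D₂.n) :
    crossingL D₂ c ≠ crossingR D₁ c' := by
  intro h
  have := congrArg Fin.val h
  simp only [crossingL, crossingR, Fin.val_castAdd, Fin.val_natAdd] at this
  omega

theorem joinRes_inj {v v' : Fin D₁.n → Bool} {w w' : Fin D₂.n → Bool} :
    joinRes v w = joinRes v' w' ↔ v = v' ∧ w = w' := by
  constructor
  · intro h
    refine ⟨funext fun c => ?_, funext fun c => ?_⟩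
    · simpa using congrFun h (crossingL D₂ c)
    · simpa using congrFun h (crossingR D₁ c)
  · rintro ⟨rfl, rfl⟩; rfl

theorem update_joinRes_crossingL (c : Fin D₁.n) (b : Bool) :
    Function.update (joinRes v w) (crossingL D₂ c) b = joinRes (Function.update v c b) w := by
  funext x
  induction x using crossing_cases with
  | hl x =>
    by_cases h : x = c
    · subst h; simp
    · rw [Function.update_of_ne (crossingL_injective.ne h)]
      simp [h]
  | hr x =>
    rw [Function.update_of_ne (crossingL_ne_crossingR _ _).symm]
    simp

theorem update_joinRes_crossingR (c : Fin D₂.n) (b : Bool) :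
    Function.update (joinRes v w) (crossingR D₁ c) b = joinRes v (Function.update w c b) := by
  funext x
  induction x using crossing_cases with
  | hl x =>
    rw [Function.update_of_ne (crossingL_ne_crossingR _ _)]
    simp
  | hr x =>
    by_cases h : x = c
    · subst h; simp
    · rw [Function.update_of_ne (crossingR_injective.ne h)]
      simp [h]

theorem smoothRel_edgeL {e e' : D₁.E} (h : D₁.SmoothRel v e e') :
    (D₁.disjUnion D₂).SmoothRel (joinRes v w) (edgeL D₂ e) (edgeL D₂ e') := by
  rcases h with ⟨c, b, h⟩ | ⟨c, h⟩ | ⟨c, h⟩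
  · simpa using SmoothRel.oriented (D := D₁.disjUnion D₂) (v := joinRes v w) (crossingL D₂ c) b
      (by simp [h])
  · simpa using SmoothRel.unoriented_inc (D := D₁.disjUnion D₂) (v := joinRes v w)
      (crossingL D₂ c) (by simp [h])
  · simpa using SmoothRel.unoriented_out (D := D₁.disjUnion D₂) (v := joinRes v w)
      (crossingL D₂ c) (by simp [h])

theorem smoothRel_edgeR {e e' : D₂.E} (h : D₂.SmoothRel w e e') :
    (D₁.disjUnion D₂).SmoothRel (joinRes v w) (edgeR D₁ e) (edgeR D₁ e') := by
  rcases h with ⟨c, b, h⟩ | ⟨c, h⟩ | ⟨c, h⟩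
  · simpa using SmoothRel.oriented (D := D₁.disjUnion D₂) (v := joinRes v w) (crossingR D₁ c) b
      (by simp [h])
  · simpa using SmoothRel.unoriented_inc (D := D₁.disjUnion D₂) (v := joinRes v w)
      (crossingR D₁ c) (by simp [h])
  · simpa using SmoothRel.unoriented_out (D := D₁.disjUnion D₂) (v := joinRes v w)
      (crossingR D₁ c) (by simp [h])

/-- The circles of a resolution of a disjoint union. -/
def circleSumEquiv : (D₁.disjUnion D₂).Circle (joinRes v w) ≃ D₁.Circle v ⊕ D₂.Circle w :=
  quotSumEquiv _ _ _ (Equiv.refl _) (fun _ _ h => smoothRel_edgeL v w h)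
    (fun _ _ h => smoothRel_edgeR v w h)
    (by
      rintro _ _ (⟨c, b, h⟩ | ⟨c, h⟩ | ⟨c, h⟩) <;> induction c using crossing_cases <;>
        simp only [joinRes_crossingL, joinRes_crossingR, pos_crossingL, pos_crossingR] at h <;>
        simp only [inc_crossingL, inc_crossingR, out_crossingL, out_crossingR]
      · exact Sum.LiftRel.inl (.oriented _ _ h)
      · exact Sum.LiftRel.inr (.oriented _ _ h)
      · exact Sum.LiftRel.inl (.unoriented_inc _ h)
      · exact Sum.LiftRel.inr (.unoriented_inc _ h)
      · exact Sum.LiftRel.inl (.unoriented_out _ h)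
      · exact Sum.LiftRel.inr (.unoriented_out _ h))

theorem circleSumEquiv_edgeL (e : D₁.E) :
    circleSumEquiv v w ((D₁.disjUnion D₂).circ (joinRes v w) (edgeL D₂ e)) =
      Sum.inl (D₁.circ v e) := rfl

theorem circleSumEquiv_edgeR (e : D₂.E) :
    circleSumEquiv v w ((D₁.disjUnion D₂).circ (joinRes v w) (edgeR D₁ e)) =
      Sum.inr (D₂.circ w e) := rfl

theorem circ_edgeL_eq_iff {e e' : D₁.E} :
    (D₁.disjUnion D₂).circ (joinRes v w) (edgeL D₂ e) =
      (D₁.disjUnion D₂).circ (joinRes v w) (edgeL D₂ e') ↔ D₁.circ v e = D₁.circ v e' := by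
  rw [← (circleSumEquiv v w).injective.eq_iff, circleSumEquiv_edgeL, circleSumEquiv_edgeL,
    Sum.inl.injEq]

theorem circ_edgeR_eq_iff {e e' : D₂.E} :
    (D₁.disjUnion D₂).circ (joinRes v w) (edgeR D₁ e) =
      (D₁.disjUnion D₂).circ (joinRes v w) (edgeR D₁ e') ↔ D₂.circ w e = D₂.circ w e' := by
  rw [← (circleSumEquiv v w).injective.eq_iff, circleSumEquiv_edgeR, circleSumEquiv_edgeR,
    Sum.inr.injEq]

theorem circ_edgeL_ne_edgeR (e : D₁.E) (e' : D₂.E) :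
    (D₁.disjUnion D₂).circ (joinRes v w) (edgeL D₂ e) ≠
      (D₁.disjUnion D₂).circ (joinRes v w) (edgeR D₁ e') := by
  rw [← (circleSumEquiv v w).injective.ne_iff, circleSumEquiv_edgeL, circleSumEquiv_edgeR]
  exact Sum.inl_ne_inr

end simps

/-- The state of a disjoint union given by states of the two parts. -/
def join (s : D₁.State) (t : D₂.State) : (D₁.disjUnion D₂).State :=
  mkState (joinRes s.1 t.1) (Sum.elim (lab s) (lab t)) (by
    rintro _ _ (⟨c, b, h⟩ | ⟨c, h⟩ | ⟨c, h⟩) <;> induction c using crossing_cases <;>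
      simp only [joinRes_crossingL, joinRes_crossingR, pos_crossingL, pos_crossingR] at h <;>
      simp only [inc_crossingL, inc_crossingR, out_crossingL, out_crossingR]
    · exact compat_lab s _ _ (.oriented _ _ h)
    · exact compat_lab t _ _ (.oriented _ _ h)
    · exact compat_lab s _ _ (.unoriented_inc _ h)
    · exact compat_lab t _ _ (.unoriented_inc _ h)
    · exact compat_lab s _ _ (.unoriented_out _ h)
    · exact compat_lab t _ _ (.unoriented_out _ h))

theorem join_fst (s : D₁.State) (t : D₂.State) : (join s t).1 = joinRes s.1 t.1 := rfl

theorem lab_join_edgeL (s : D₁.State) (t : D₂.State) (e : D₁.E) :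
    lab (join s t) (edgeL D₂ e) = lab s e := rfl

theorem lab_join_edgeR (s : D₁.State) (t : D₂.State) (e : D₂.E) :
    lab (join s t) (edgeR D₁ e) = lab t e := rfl

theorem join_injective : Function.Injective fun p : D₁.State × D₂.State => join p.1 p.2 := by
  rintro ⟨s, t⟩ ⟨s', t'⟩ h
  have h1 := joinRes_inj.1 (congrArg Sigma.fst h)
  have h2 := congrArg lab h
  refine Prod.ext (state_ext h1.1 fun e => ?_) (state_ext h1.2 fun e => ?_)
  · exact congrFun h2 (edgeL D₂ e)
  · exact congrFun h2 (edgeR D₁ e)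

theorem join_surjective : Function.Surjective fun p : D₁.State × D₂.State => join p.1 p.2 := by
  intro r
  let v : Fin D₁.n → Bool := fun c => r.1 (crossingL D₂ c)
  let w : Fin D₂.n → Bool := fun c => r.1 (crossingR D₁ c)
  have hvw : joinRes v w = r.1 := by
    funext c
    induction c using crossing_cases <;> simp [v, w]
  refine ⟨(mkState v (fun e => lab r (edgeL D₂ e)) ?_, mkState w (fun e => lab r (edgeR D₁ e)) ?_),
    state_ext hvw ?_⟩
  · exact fun e e' h => compat_lab r _ _ (hvw ▸ smoothRel_edgeL v w h)
  · exact fun e e' h => compat_lab r _ _ (hvw ▸ smoothRel_edgeR v w h)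
  · exact edge_cases (fun e => rfl) (fun e => rfl)

/-- States of a disjoint union are pairs of states. -/
noncomputable def joinEquiv : D₁.State × D₂.State ≃ (D₁.disjUnion D₂).State :=
  Equiv.ofBijective _ ⟨join_injective, join_surjective⟩

theorem sum_join {M : Type*} [AddCommMonoid M] (F : (D₁.disjUnion D₂).State → M) :
    ∑ r, F r = ∑ s, ∑ t, F (join s t) := by
  rw [← Fintype.sum_prod_type', ← joinEquiv.sum_comp]
  rfl

theorem ext_join {M : Type*} {f g : (D₁.disjUnion D₂).State → M} (h : ∀ s t, f (join s t) = g (join s t)) :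
    f = g := by
  funext r
  obtain ⟨⟨s, t⟩, rfl⟩ := join_surjective r
  exact h s t

/-! ### Gradings of a disjoint union -/

theorem card_filter_crossing (P : Fin (D₁.disjUnion D₂).n → Prop) [DecidablePred P] :
    (Finset.univ.filter P).card = (Finset.univ.filter fun c => P (crossingL D₂ c)).card +
      (Finset.univ.filter fun c => P (crossingR D₁ c)).card := by
  simp only [Finset.card_filter]
  exact Fin.sum_univ_add (a := D₁.n) (b := D₂.n) _

theorem height_joinRes (v : Fin D₁.n → Bool) (w : Fin D₂.n → Bool) :
    (D₁.disjUnion D₂).height (joinRes v w) = D₁.height v + D₂.height w := by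
  rw [height, card_filter_crossing]; simp [height]

theorem posCount_disjUnion : (D₁.disjUnion D₂).posCount = D₁.posCount + D₂.posCount := by
  rw [posCount, card_filter_crossing]; simp [posCount]

theorem negCount_disjUnion : (D₁.disjUnion D₂).negCount = D₁.negCount + D₂.negCount := by
  rw [negCount, card_filter_crossing]; simp [negCount]

theorem hdeg_join (s : D₁.State) (t : D₂.State) :
    (D₁.disjUnion D₂).hdeg (join s t) = D₁.hdeg s + D₂.hdeg t := by
  rw [hdeg, join_fst, height_joinRes, negCount_disjUnion, hdeg, hdeg]
  push_cast; ring

theorem qdeg_join (s : D₁.State) (t : D₂.State) :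
    (D₁.disjUnion D₂).qdeg (join s t) = D₁.qdeg s + D₂.qdeg t := by
  have h : ∑ C, labDeg ((join s t).2 C) = ∑ C, labDeg (s.2 C) + ∑ C, labDeg (t.2 C) := by
    rw [← Fintype.sum_sumElim, ← (circleSumEquiv s.1 t.1).sum_comp]
    refine Finset.sum_congr rfl fun C _ => ?_
    obtain ⟨e, rfl⟩ := (D₁.disjUnion D₂).circ_surjective _ C
    induction e using edge_cases
    · rfl
    · rfl
  rw [qdeg_eq, qdeg_eq, qdeg_eq, h, join_fst, height_joinRes, posCount_disjUnion,
    negCount_disjUnion]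
  push_cast; ring

/-! ### The differential of a disjoint union -/

variable {R : Type} [CommRing R]

theorem edgeSign_crossingL (v : Fin D₁.n → Bool) (w : Fin D₂.n → Bool) (c : Fin D₁.n) :
    edgeSign R (joinRes v w) (crossingL D₂ c) = edgeSign R v c := by
  have h1 : ∀ c', crossingL D₂ c' < crossingL D₂ c ↔ c' < c := fun c' => Iff.rfl
  have h2 : ∀ c', ¬ crossingR (D₂ := D₂) D₁ c' < crossingL D₂ c := fun c' h => by
    have : D₁.n + c'.val < c.val := h
    omega
  rw [edgeSign, card_filter_crossing]
  simp [h1, h2, edgeSign]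

/-- The crossings of the first part precede those of the second, so each of its `1`-smoothings
contributes a sign. This is the Koszul sign of the tensor product. -/
theorem edgeSign_crossingR (v : Fin D₁.n → Bool) (w : Fin D₂.n → Bool) (c : Fin D₂.n) :
    edgeSign R (joinRes v w) (crossingR D₁ c) = (-1) ^ D₁.height v * edgeSign R w c := by
  have h1 : ∀ c', crossingR (D₂ := D₂) D₁ c' < crossingR D₁ c ↔ c' < c := fun c' => by
    change D₁.n + c'.val < D₁.n + c.val ↔ c'.val < c.val
    omega
  have h2 : ∀ c', crossingL D₂ c' < crossingR (D₂ := D₂) D₁ c := fun c' => by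
    change c'.val < D₁.n + c.val
    omega
  rw [edgeSign, card_filter_crossing, pow_add]
  simp [h1, h2, edgeSign, height]

theorem near_edgeL_iff (v : Fin D₁.n → Bool) (w : Fin D₂.n → Bool) (c : Fin D₁.n) (e : D₁.E) :
    (D₁.disjUnion D₂).Near (joinRes v w) (crossingL D₂ c) (edgeL D₂ e) ↔ D₁.Near v c e := by
  simp [Near, circ_edgeL_eq_iff]

theorem not_near_edgeR (v : Fin D₁.n → Bool) (w : Fin D₂.n → Bool) (c : Fin D₁.n) (e : D₂.E) :
    ¬ (D₁.disjUnion D₂).Near (joinRes v w) (crossingL D₂ c) (edgeR D₁ e) := by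
  simp [Near, (circ_edgeL_ne_edgeR v w _ e).symm]

theorem near_edgeR_iff (v : Fin D₁.n → Bool) (w : Fin D₂.n → Bool) (c : Fin D₂.n) (e : D₂.E) :
    (D₁.disjUnion D₂).Near (joinRes v w) (crossingR D₁ c) (edgeR D₁ e) ↔ D₂.Near w c e := by
  simp [Near, circ_edgeR_eq_iff]

theorem not_near_edgeL (v : Fin D₁.n → Bool) (w : Fin D₂.n → Bool) (c : Fin D₂.n) (e : D₁.E) :
    ¬ (D₁.disjUnion D₂).Near (joinRes v w) (crossingR D₁ c) (edgeL D₂ e) := by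
  simp [Near, circ_edgeL_ne_edgeR v w e]

theorem adj_join_crossingL {s s' : D₁.State} {t t' : D₂.State} {c : Fin D₁.n} :
    Adj (join s t) (join s' t') (crossingL D₂ c) ↔ Adj s s' c ∧ t' = t := by
  rw [Adj, join_fst, join_fst, joinRes_crossingL, update_joinRes_crossingL, joinRes_inj]
  constructor
  · rintro ⟨h1, ⟨h2, h3⟩, h4⟩
    refine ⟨⟨h1, h2, fun e he => h4 (edgeL D₂ e) (by rwa [near_edgeL_iff])⟩,
      state_ext h3 fun e => ?_⟩
    exact (h4 (edgeR D₁ e) (not_near_edgeR _ _ _ _)).symm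
  · rintro ⟨⟨h1, h2, h3⟩, rfl⟩
    refine ⟨h1, ⟨h2, rfl⟩, edge_cases (fun e he => h3 e ?_) fun e _ => rfl⟩
    rwa [near_edgeL_iff] at he

theorem adj_join_crossingR {s s' : D₁.State} {t t' : D₂.State} {c : Fin D₂.n} :
    Adj (join s t) (join s' t') (crossingR D₁ c) ↔ Adj t t' c ∧ s' = s := by
  rw [Adj, join_fst, join_fst, joinRes_crossingR, update_joinRes_crossingR, joinRes_inj]
  constructor
  · rintro ⟨h1, ⟨h2, h3⟩, h4⟩
    refine ⟨⟨h1, h3, fun e he => h4 (edgeR D₁ e) (by rwa [near_edgeR_iff])⟩,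
      state_ext h2 fun e => ?_⟩
    exact (h4 (edgeL D₂ e) (not_near_edgeL _ _ _ _)).symm
  · rintro ⟨⟨h1, h2, h3⟩, rfl⟩
    refine ⟨h1, ⟨rfl, h2⟩, edge_cases (fun e _ => rfl) fun e he => h3 e ?_⟩
    rwa [near_edgeR_iff] at he

open Classical in
theorem edgeCoeff_join_crossingL (h : R) (s s' : D₁.State) (t t' : D₂.State) (c : Fin D₁.n) :
    (D₁.disjUnion D₂).edgeCoeff h (join s t) (join s' t') (crossingL D₂ c) =
      if t' = t then D₁.edgeCoeff h s s' c else 0 := by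
  by_cases hA : Adj (join s t) (join s' t') (crossingL D₂ c)
  · obtain ⟨hA', ht⟩ := adj_join_crossingL.1 hA
    rw [if_pos ht, edgeCoeff_of_adj h hA, edgeCoeff_of_adj h hA']
    simp only [join_fst, edgeSign_crossingL, inc_crossingL, out_crossingL, circ_edgeL_eq_iff,
      lab_join_edgeL, ne_eq]
  · rw [edgeCoeff_of_not_adj h hA]
    split_ifs with ht
    · rw [edgeCoeff_of_not_adj h fun hA' => hA (adj_join_crossingL.2 ⟨hA', ht⟩)]
    · rfl

open Classical in
theorem edgeCoeff_join_crossingR (h : R) (s s' : D₁.State) (t t' : D₂.State) (c : Fin D₂.n) :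
    (D₁.disjUnion D₂).edgeCoeff h (join s t) (join s' t') (crossingR D₁ c) =
      if s' = s then (-1) ^ D₁.height s.1 * D₂.edgeCoeff h t t' c else 0 := by
  by_cases hA : Adj (join s t) (join s' t') (crossingR D₁ c)
  · obtain ⟨hA', ht⟩ := adj_join_crossingR.1 hA
    rw [if_pos ht, edgeCoeff_of_adj h hA, edgeCoeff_of_adj h hA']
    simp only [join_fst, edgeSign_crossingR, inc_crossingR, out_crossingR, circ_edgeR_eq_iff,
      lab_join_edgeR, ne_eq, mul_assoc]
  · rw [edgeCoeff_of_not_adj h hA]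
    split_ifs with ht
    · rw [edgeCoeff_of_not_adj h fun hA' => hA (adj_join_crossingR.2 ⟨hA', ht⟩), mul_zero]
    · rfl

open Classical in
theorem dcoeff_join (h : R) (s s' : D₁.State) (t t' : D₂.State) :
    dcoeff h (join s' t') (join s t) = (if t' = t then dcoeff h s' s else 0) +
      if s' = s then (-1) ^ D₁.height s.1 * dcoeff h t' t else 0 := by
  have h1 : dcoeff h (join s' t') (join s t) = _ :=
    Fin.sum_univ_add (a := D₁.n) (b := D₂.n) _
  rw [h1]
  have h2 : ∀ c : Fin D₁.n, (D₁.disjUnion D₂).edgeCoeff h (join s t) (join s' t')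
    (Fin.castAdd D₂.n c) = _ := edgeCoeff_join_crossingL h s s' t t'
  have h3 : ∀ c : Fin D₂.n, (D₁.disjUnion D₂).edgeCoeff h (join s t) (join s' t')
    (Fin.natAdd D₁.n c) = _ := edgeCoeff_join_crossingR h s s' t t'
  congr 1
  · refine (Finset.sum_congr rfl fun c _ => h2 c).trans ?_
    split_ifs
    · rfl
    · simp
  · refine (Finset.sum_congr rfl fun c _ => h3 c).trans ?_
    split_ifs
    · rw [dcoeff, Finset.mul_sum]
    · simp

/-- The tensor product of two cochains. -/
noncomputable def tensor (f : D₁.State → R) (g : D₂.State → R) : (D₁.disjUnion D₂).State → R :=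
  fun r => f (joinEquiv.symm r).1 * g (joinEquiv.symm r).2

theorem tensor_join (f : D₁.State → R) (g : D₂.State → R) (s : D₁.State) (t : D₂.State) :
    tensor f g (join s t) = f s * g t := by
  have h : joinEquiv.symm (join s t) = (s, t) := joinEquiv.symm_apply_apply (s, t)
  rw [tensor, h]

/-- The sign by which the differential of the second factor of a tensor product is twisted. -/
def heightSign (f : D₁.State → R) : D₁.State → R := fun s => (-1) ^ D₁.height s.1 * f s

theorem diff_join (h : R) (F : (D₁.disjUnion D₂).State → R) (s : D₁.State) (t : D₂.State) :
    (D₁.disjUnion D₂).diff h F (join s t) = D₁.diff h (fun s' => F (join s' t)) s +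
      (-1) ^ D₁.height s.1 * D₂.diff h (fun t' => F (join s t')) t := by
  classical
  rw [diff_apply, sum_join]
  simp only [dcoeff_join, add_mul, Finset.sum_add_distrib, ite_mul, zero_mul, Finset.sum_ite_eq,
    Finset.mem_univ, if_true]
  congr 1
  rw [Finset.sum_comm]
  simp only [Finset.sum_ite_eq, Finset.mem_univ, if_true, diff_apply, Finset.mul_sum, mul_assoc]

theorem diff_tensor (h : R) (f : D₁.State → R) (g : D₂.State → R) :
    (D₁.disjUnion D₂).diff h (tensor f g) =
      tensor (D₁.diff h f) g + tensor (heightSign f) (D₂.diff h g) := by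
  refine ext_join fun s t => ?_
  rw [diff_join, Pi.add_apply, tensor_join, tensor_join]
  simp only [tensor_join, diff_apply, heightSign, Finset.sum_mul, Finset.mul_sum]
  congr 1 <;> refine Finset.sum_congr rfl fun _ _ => by ring

/-- Contraction of the second factor of a tensor product with a functional. -/
noncomputable def contract (φ : D₂.State → R) (F : (D₁.disjUnion D₂).State → R) : D₁.State → R :=
  fun s => ∑ t, F (join s t) * φ t

/-- The transpose of the differential. -/
noncomputable def codiff {D : PreDiagram} (h : R) (φ : D.State → R) : D.State → R :=
  fun s => ∑ t, φ t * dcoeff h t s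

theorem sum_diff_mul {D : PreDiagram} (h : R) (f φ : D.State → R) :
    ∑ t, D.diff h f t * φ t = ∑ s, f s * codiff h φ s := by
  simp only [diff_apply, codiff, Finset.sum_mul, Finset.mul_sum]
  rw [Finset.sum_comm]
  exact Finset.sum_congr rfl fun _ _ => Finset.sum_congr rfl fun _ _ => by ring

/-- The Leibniz rule with the second differential moved onto `φ`. In particular, contraction with a
cocycle is a chain map. -/
theorem contract_diff (h : R) (φ : D₂.State → R) (F : (D₁.disjUnion D₂).State → R) :
    contract φ ((D₁.disjUnion D₂).diff h F) =
      D₁.diff h (contract φ F) + heightSign (contract (codiff h φ) F) := by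
  funext s
  rw [Pi.add_apply, contract, heightSign, contract, ← sum_diff_mul, diff_apply]
  simp only [diff_join, add_mul, Finset.sum_add_distrib, Finset.mul_sum, contract, mul_assoc]
  congr 1
  simp only [diff_apply, Finset.sum_mul, mul_assoc]
  rw [Finset.sum_comm]

theorem contract_add (φ : D₂.State → R) (F G : (D₁.disjUnion D₂).State → R) :
    contract φ (F + G) = contract φ F + contract φ G := by
  funext s
  simp [contract, add_mul, Finset.sum_add_distrib]

theorem contract_tensor (φ g : D₂.State → R) (f : D₁.State → R) :
    contract φ (tensor f g) = fun s => (∑ t, g t * φ t) * f s := by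
  funext s
  simp only [contract, tensor_join, Finset.sum_mul]
  exact Finset.sum_congr rfl fun _ _ => by ring

end PreDiagram

open PreDiagram

/-! ### Components and canonical cochains of a split union -/

namespace LinkDiagram

variable (D₁ D₂ : LinkDiagram)

theorem card_component_disjUnion : Nat.card (D₁.disjUnion D₂).Component =
    Nat.card D₁.Component + Nat.card D₂.Component := by
  rw [← Nat.card_sum]
  refine Nat.card_congr (quotSumEquiv _ _ _ (Equiv.refl _) ?_ ?_ ?_)
  · rintro _ _ ⟨c, b⟩
    have := StrandRel.through (D := D₁.toPreDiagram.disjUnion D₂.toPreDiagram) (crossingL _ c) b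
    rwa [inc_crossingL, out_crossingL] at this
  · rintro _ _ ⟨c, b⟩
    have := StrandRel.through (D := D₁.toPreDiagram.disjUnion D₂.toPreDiagram) (crossingR _ c) b
    rwa [inc_crossingR, out_crossingR] at this
  · rintro _ _ ⟨c, b⟩
    revert c
    refine crossing_cases (fun c => ?_) fun c => ?_
    · have h1 := inc_crossingL (D₂ := D₂.toPreDiagram) c b
      have h2 := out_crossingL (D₂ := D₂.toPreDiagram) c b
      exact h1 ▸ h2 ▸ Sum.LiftRel.inl (.through _ _)
    · have h1 := inc_crossingR (D₁ := D₁.toPreDiagram) c b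
      have h2 := out_crossingR (D₁ := D₁.toPreDiagram) c b
      exact h1 ▸ h2 ▸ Sum.LiftRel.inr (.through _ _)

theorem canonical_eq_one {D : LinkDiagram} {b : Bool} {s : D.State} (h : s.1 = D.orientedRes ∧
    ∀ e, D.shade (Quot.mk _ (e, true)) = b → s.2 (D.circ s.1 e) = false) :
    D.canonical b s = 1 := if_pos h

theorem canonical_eq_zero {D : LinkDiagram} {b : Bool} {s : D.State} (h : ¬ (s.1 = D.orientedRes ∧
    ∀ e, D.shade (Quot.mk _ (e, true)) = b → s.2 (D.circ s.1 e) = false)) :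
    D.canonical b s = 0 := if_neg h

/-- Drawing diagrams side by side keeps both shadings, so the oriented resolution and the colours of
its circles split into those of the parts. -/
theorem canonical_disjUnion (b : Bool) :
    (D₁.disjUnion D₂).canonical b = tensor (D₁.canonical b) (D₂.canonical b) := by
  classical
  refine ext_join (D₁ := D₁.toPreDiagram) (D₂ := D₂.toPreDiagram) fun s t => ?_
  rw [tensor_join]
  have h1 : (D₁.disjUnion D₂).orientedRes = joinRes D₁.orientedRes D₂.orientedRes := by
    funext c
    revert c
    refine crossing_cases (D₁ := D₁.toPreDiagram) (D₂ := D₂.toPreDiagram) (fun c => ?_) fun c => ?_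
    · rw [joinRes_crossingL]
      exact congrArg Bool.not (pos_crossingL _)
    · rw [joinRes_crossingR]
      exact congrArg Bool.not (pos_crossingR _)
  have h2 : ((join s t).1 = (D₁.disjUnion D₂).orientedRes ∧
      ∀ e, (D₁.disjUnion D₂).shade (Quot.mk _ (e, true)) = b →
        (join s t).2 ((D₁.disjUnion D₂).circ (join s t).1 e) = false) ↔
      (s.1 = D₁.orientedRes ∧ ∀ e, D₁.shade (Quot.mk _ (e, true)) = b →
        s.2 (D₁.circ s.1 e) = false) ∧
      (t.1 = D₂.orientedRes ∧ ∀ e, D₂.shade (Quot.mk _ (e, true)) = b →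
        t.2 (D₂.circ t.1 e) = false) := by
    have h3 : (join s t).1 = (D₁.disjUnion D₂).orientedRes ↔
        s.1 = D₁.orientedRes ∧ t.1 = D₂.orientedRes := by
      rw [h1]; exact joinRes_inj
    rw [h3]
    constructor
    · rintro ⟨⟨h3, h4⟩, h5⟩
      exact ⟨⟨h3, fun e => h5 (edgeL _ e)⟩, h4, fun e => h5 (edgeR _ e)⟩
    · rintro ⟨⟨h3, h4⟩, h5, h6⟩
      exact ⟨⟨h3, h5⟩, edge_cases h4 h6⟩
  by_cases h : (s.1 = D₁.orientedRes ∧ ∀ e, D₁.shade (Quot.mk _ (e, true)) = b →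
      s.2 (D₁.circ s.1 e) = false) ∧ (t.1 = D₂.orientedRes ∧
      ∀ e, D₂.shade (Quot.mk _ (e, true)) = b → t.2 (D₂.circ t.1 e) = false)
  · rw [canonical_eq_one h.1, canonical_eq_one h.2, mul_one]
    exact canonical_eq_one (h2.2 h)
  · refine (canonical_eq_zero (mt h2.1 h)).trans ?_
    rcases not_and_or.1 h with h | h
    · rw [canonical_eq_zero h, zero_mul]
    · rw [canonical_eq_zero h, mul_zero]

end LinkDiagram

/-! ### Functionals on the Bar-Natan complex -/

namespace PreDiagram

variable {D : PreDiagram} {R : Type} [CommRing R]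

open Classical in
/-- Restriction to the generators of homological degree `i`. -/
noncomputable def homRes (i : ℤ) (f : D.State → R) : D.State → R := fun s =>
  if D.hdeg s = i then f s else 0

open Classical in
/-- Restriction to the generators of bidegree `(i, q)`. -/
noncomputable def biRes (i q : ℤ) (f : D.State → R) : D.State → R := fun s =>
  if D.hdeg s = i ∧ D.qdeg s = q then f s else 0

theorem homRes_mem (i : ℤ) (f : D.State → R) :
    homRes i f ∈ D.supported R fun s => D.hdeg s = i := fun _ hs => if_neg hs

theorem biRes_mem (i q : ℤ) (f : D.State → R) : biRes i q f ∈ D.CKh R i q := fun _ hs => if_neg hs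

theorem homRes_of_mem {i : ℤ} {f : D.State → R} (hf : f ∈ D.supported R fun s => D.hdeg s = i) :
    homRes i f = f := by
  funext s
  rw [homRes]
  split_ifs with h
  · rfl
  · exact (hf s h).symm

theorem homRes_add (i : ℤ) (f g : D.State → R) : homRes i (f + g) = homRes i f + homRes i g := by
  funext s
  simp only [homRes, Pi.add_apply]
  split_ifs <;> simp

theorem homRes_diff (h : R) (i : ℤ) (f : D.State → R) :
    homRes (i + 1) (D.diff h f) = D.diff h (homRes i f) := by
  funext t
  rw [homRes, diff_apply, diff_apply]
  by_cases ht : D.hdeg t = i + 1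
  · rw [if_pos ht]
    refine Finset.sum_congr rfl fun s _ => ?_
    by_cases h0 : dcoeff h t s = 0
    · rw [h0, zero_mul, zero_mul]
    · rw [homRes, if_pos]
      have := hdeg_of_dcoeff_ne_zero h0
      omega
  · rw [if_neg ht]
    refine (Finset.sum_eq_zero fun s _ => ?_).symm
    by_cases h0 : dcoeff h t s = 0
    · rw [h0, zero_mul]
    · rw [homRes, if_neg, mul_zero]
      have := hdeg_of_dcoeff_ne_zero h0
      omega

theorem biRes_diff (i q : ℤ) (f : D.State → R) :
    biRes (i + 1) q (D.diff 0 f) = D.diff 0 (biRes i q f) := by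
  funext t
  rw [biRes, diff_apply, diff_apply]
  by_cases ht : D.hdeg t = i + 1 ∧ D.qdeg t = q
  · rw [if_pos ht]
    refine Finset.sum_congr rfl fun s _ => ?_
    by_cases h0 : dcoeff (0 : R) t s = 0
    · rw [h0, zero_mul, zero_mul]
    · rw [biRes, if_pos]
      have h1 := hdeg_of_dcoeff_ne_zero h0
      have h2 := qdeg_eq_of_dcoeff_zero_ne_zero h0
      omega
  · rw [if_neg ht]
    refine (Finset.sum_eq_zero fun s _ => ?_).symm
    by_cases h0 : dcoeff (0 : R) t s = 0
    · rw [h0, zero_mul]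
    · rw [biRes, if_neg, mul_zero]
      have h1 := hdeg_of_dcoeff_ne_zero h0
      have h2 := qdeg_eq_of_dcoeff_zero_ne_zero h0
      omega

theorem codiff_biRes (i q : ℤ) (φ : D.State → R) :
    codiff 0 (biRes (i + 1) q φ) = biRes i q (codiff 0 φ) := by
  funext s
  rw [biRes, codiff, codiff]
  by_cases hs : D.hdeg s = i ∧ D.qdeg s = q
  · rw [if_pos hs]
    refine Finset.sum_congr rfl fun t _ => ?_
    by_cases h0 : dcoeff (0 : R) t s = 0
    · rw [h0, mul_zero, mul_zero]
    · rw [biRes, if_pos]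
      have h1 := hdeg_of_dcoeff_ne_zero h0
      have h2 := qdeg_eq_of_dcoeff_zero_ne_zero h0
      omega
  · rw [if_neg hs]
    refine Finset.sum_eq_zero fun t _ => ?_
    by_cases h0 : dcoeff (0 : R) t s = 0
    · rw [h0, mul_zero]
    · rw [biRes, if_neg, zero_mul]
      have h1 := hdeg_of_dcoeff_ne_zero h0
      have h2 := qdeg_eq_of_dcoeff_zero_ne_zero h0
      omega

theorem homRes_mem_filt {q : ℤ} (i : ℤ) {f : D.State → ZMod 2} (hf : f ∈ D.filt q) :
    homRes i f ∈ D.filt q := by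
  intro s hs
  rw [homRes, hf s hs, ite_self]

/-- The values of a linear functional on the generators. -/
theorem linearMap_apply_eq_sum [DecidableEq D.State] (φ : (D.State → R) →ₗ[R] R)
    (f : D.State → R) : φ f = ∑ t, f t * φ (Pi.single t 1) := by
  conv_lhs => rw [pi_eq_sum_univ' f, map_sum]
  refine Finset.sum_congr rfl fun t _ => ?_
  rw [map_smul, smul_eq_mul]

end PreDiagram

open PreDiagram

namespace LinkDiagram

variable (D : LinkDiagram)

theorem not_canonicalIn_filt : ¬ D.CanonicalIn (D.filt (D.s + 1)) := by
  intro h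
  have h1 := D.s_sub_one_modEq
  have h2 := (D.canonicalIn_filt_iff (q := D.s + 1) (by simp only [Int.ModEq] at *; omega)).1 h
  omega

/-- There is a functional on the Bar-Natan complex that is invariant under coboundaries, vanishes
in quantum degrees at least `s` and takes the value `1` on both canonical cochains. -/
theorem exists_functional : ∃ φ : D.State → ZMod 2, codiff 1 φ = 0 ∧
    (∀ t, D.hdeg t ≠ 0 → φ t = 0) ∧ (∀ t, D.s ≤ D.qdeg t → φ t = 0) ∧
    ∀ b, ∑ t, D.canonical b t * φ t = 1 := by
  classical
  have hs : D.filt D.s = D.filt (D.s + 1) := by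
    have := D.filt_add_two D.s_sub_one_modEq
    rwa [sub_add_cancel, show D.s - 1 + 2 = D.s + 1 by ring] at this
  -- `N` is what the functional has to kill. If it contained a canonical cochain, projection to
  -- homological degree 0 would give a representative of filtration degree `s + 1`. Its image under
  -- `invol` would do so for the other class, against the maximality of `s`.
  let N := D.filt (D.s + 1) ⊔ (LinearMap.range (D.diff (1 : ZMod 2)) ⊔
    D.supported (ZMod 2) fun s => D.hdeg s ≠ 0)
  have hN : D.canonical true ∉ N := by
    intro h
    obtain ⟨u, hu, x, hx, h⟩ := Submodule.mem_sup.1 h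
    obtain ⟨_, ⟨k, rfl⟩, w, hw, rfl⟩ := Submodule.mem_sup.1 hx
    have hw0 : homRes 0 w = 0 := by
      funext s
      rw [homRes]
      split_ifs with h1
      · exact hw s (not_not.2 h1)
      · rfl
    have h1 := congrArg (homRes 0) h
    have h2 := homRes_diff (D := D.toPreDiagram) 1 (-1) k
    rw [neg_add_cancel] at h2
    rw [homRes_add, homRes_add, hw0, add_zero, h2, homRes_of_mem (D.canonical_mem_supported true)]
      at h1
    have h3 : D.canonical true + D.diff 1 (homRes (-1) k) ∈ D.filt (D.s + 1) := by
      rw [← h1, add_assoc, CharTwo.add_self_eq_zero, add_zero]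
      exact homRes_mem_filt 0 hu
    refine D.not_canonicalIn_filt fun b => ?_
    cases b
    · refine ⟨_, invol_mem_supported_hdeg (homRes_mem (-1) k), ?_⟩
      have h4 := invol_mem_filt h3
      rwa [invol_add, D.invol_canonical, ← D.diff_invol] at h4
    · exact ⟨_, homRes_mem (-1) k, h3⟩
  obtain ⟨f, hf, hker⟩ := Submodule.exists_le_ker_of_notMem hN
  have hfd : ∀ k, f (D.diff 1 k) = 0 := fun k =>
    hker (Submodule.mem_sup_right (Submodule.mem_sup_left ⟨k, rfl⟩))
  have hf1 : f (D.canonical true) = 1 := by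
    generalize f (D.canonical true) = x at hf
    revert hf; revert x; decide
  have hsum := linearMap_apply_eq_sum f
  refine ⟨fun t => f (Pi.single t 1), ?_, ?_, ?_, ?_⟩
  · funext s
    have h1 := sum_diff_mul (1 : ZMod 2) (Pi.single s 1) fun t => f (Pi.single t 1)
    rw [← hsum, hfd] at h1
    simpa [Pi.single_apply] using h1.symm
  · intro t ht
    refine hker (Submodule.mem_sup_right (Submodule.mem_sup_right fun s hst => ?_))
    rw [Pi.single_apply, if_neg]
    rintro rfl
    exact hst ht
  · intro t ht
    refine hker (Submodule.mem_sup_left (hs ▸ fun s hst => ?_))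
    rw [Pi.single_apply, if_neg]
    rintro rfl
    exact hst ht
  · intro b
    rw [← hsum]
    cases b
    -- A representative of filtration degree `s - 1` plus its image under `invol` represents the sum
    -- of the canonical classes and lies in filtration degree `s + 1`. The functional kills it, so
    -- its two values agree.
    · obtain ⟨k, -, hk⟩ := D.isGreatest_s.1.2 true
      have h1 := add_invol_mem_filt hk
      rw [show D.s - 1 + 2 = D.s + 1 by ring, invol_add, D.invol_canonical, ← D.diff_invol] at h1
      have h2 : f _ = 0 := hker (Submodule.mem_sup_left h1)
      rw [map_add, map_add, map_add, hfd, hfd, add_zero, add_zero, hf1] at h2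
      rw [← CharTwo.neg_eq (1 : ZMod 2)]
      exact (neg_eq_of_add_eq_zero_right h2).symm
    · exact hf1

theorem codiff_mod2 {D : PreDiagram} (φ : D.State → ℤ) :
    D.mod2 (codiff 0 φ) = codiff 0 (D.mod2 φ) := by
  ext s
  rw [mod2, codiff, codiff]
  push_cast
  refine Finset.sum_congr rfl fun t _ => ?_
  rw [dcoeff, dcoeff]
  push_cast
  simp only [edgeCoeff_intCast]
  rfl

theorem codiff_sub_two_smul {D : PreDiagram} (φ ψ : D.State → ℤ) :
    codiff 0 (φ - 2 • ψ) = codiff 0 φ - 2 • codiff 0 ψ := by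
  funext s
  simp only [codiff, Pi.sub_apply, two_nsmul, Pi.add_apply, sub_mul, add_mul,
    Finset.sum_sub_distrib, Finset.sum_add_distrib]

/-- A functional that vanishes on the cocycles is a coboundary. -/
theorem exists_codiff_eq {D : PreDiagram} (ψ : D.State → ZMod 2)
    (h : ∀ f, D.diff 0 f = 0 → ∑ s, f s * ψ s = 0) : ∃ κ, codiff 0 κ = ψ := by
  classical
  let Ψ : Module.Dual (ZMod 2) (D.State → ZMod 2) :=
    ∑ s, ψ s • LinearMap.proj s
  have hΨ : ∀ f, Ψ f = ∑ s, f s * ψ s := by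
    intro f
    simp [Ψ, mul_comm]
  have h1 : Ψ ∈ LinearMap.range (D.diff (0 : ZMod 2)).dualMap := by
    rw [LinearMap.range_dualMap_eq_dualAnnihilator_ker, Submodule.mem_dualAnnihilator]
    intro f hf
    rw [hΨ]
    exact h f hf
  obtain ⟨κ, hκ⟩ := h1
  refine ⟨fun t => κ (Pi.single t 1), ?_⟩
  funext s
  have h2 := sum_diff_mul (0 : ZMod 2) (Pi.single s 1) fun t => κ (Pi.single t 1)
  rw [← linearMap_apply_eq_sum κ] at h2
  have h3 : κ (D.diff 0 (Pi.single s 1)) = Ψ (Pi.single s 1) := by rw [← hκ]; rfl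
  rw [h3, hΨ] at h2
  simpa [Pi.single_apply] using h2.symm

theorem sum_mul_two_smul {D : PreDiagram} (f g : D.State → ℤ) :
    ∑ s, f s * (2 • g) s = 2 * ∑ s, f s * g s := by
  rw [Finset.mul_sum]
  refine Finset.sum_congr rfl fun s _ => ?_
  simp only [Pi.smul_apply, nsmul_eq_mul]
  push_cast; ring

/-- The transposed differential does not raise the quantum degree, so the top part of a Bar-Natan
functional cocycle is a cocycle for the transposed Khovanov differential. -/
theorem codiff_biRes_eq_zero {D : PreDiagram} {φ : D.State → ZMod 2} {q : ℤ}
    (h1 : codiff 1 φ = 0) (h2 : ∀ t, D.hdeg t ≠ 0 → φ t = 0)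
    (h3 : ∀ t, q < D.qdeg t → φ t = 0) : codiff 0 (biRes 0 q φ) = 0 := by
  funext s
  by_cases hs : D.qdeg s = q
  · rw [← h1, codiff, codiff]
    refine Finset.sum_congr rfl fun t _ => ?_
    rw [dcoeff_zero (1 : ZMod 2), hs, biRes]
    by_cases h4 : dcoeff (1 : ZMod 2) t s = 0
    · simp [h4]
    · have h5 := qdeg_le_of_dcoeff_ne_zero h4
      by_cases h6 : D.hdeg t = 0
      · by_cases h7 : D.qdeg t = q
        · simp [h6, h7]
        · rw [h3 t (by omega)]; simp
      · rw [h2 t h6]; simp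
  · refine Finset.sum_eq_zero fun t _ => ?_
    by_contra hne
    have h4 := qdeg_eq_of_dcoeff_zero_ne_zero (right_ne_zero_of_mul hne)
    refine left_ne_zero_of_mul hne ?_
    rw [biRes, if_neg]
    omega

/-- The functional of `exists_functional` in quantum degree `s - 1` lifts to an integral one which
is a cocycle modulo `4`, provided that `Sq¹` vanishes. -/
theorem exists_integral_functional
    (hT : ∀ (x : D.Kh (ZMod 2) (0 - 1) (D.s - 1)) (y : D.Kh (ZMod 2) 0 (D.s - 1)),
      D.IsSq1 0 (D.s - 1) x y → y = 0)
    {φ : D.State → ZMod 2} (h1 : codiff 1 φ = 0) (h2 : ∀ t, D.hdeg t ≠ 0 → φ t = 0)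
    (h3 : ∀ t, D.s ≤ D.qdeg t → φ t = 0) :
    ∃ Φ ∈ D.CKh ℤ 0 (D.s - 1), D.mod2 Φ = biRes 0 (D.s - 1) φ ∧
      ∃ Ψ, codiff 0 Φ = 2 • 2 • Ψ := by
  set q := D.s - 1 with hq
  have hφ : codiff 0 (biRes 0 q φ) = 0 := codiff_biRes_eq_zero h1 h2 fun t ht => h3 t (by omega)
  have htop : ∀ f : D.State → ℤ, f ∈ D.supported ℤ fun _ => True := fun f s hs =>
    absurd trivial hs
  -- `ψ` is the dual Bockstein of the top part of `φ`.
  obtain ⟨ψ, -, hψ⟩ := exists_two_smul_of_mod2_eq_zero (htop (codiff 0 (intLift (biRes 0 q φ))))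
    (by rw [codiff_mod2, mod2_intLift, hφ])
  -- The dual Bockstein is adjoint to `Sq¹`: halving `⟨d F, φ⟩ = ⟨F, 2 ψ⟩` shows that `ψ` pairs with
  -- `f` as `φ` pairs with the Bockstein of `f`. The latter is a coboundary by hypothesis, and `φ`
  -- kills coboundaries.
  have hψker : ∀ f, D.diff 0 f = 0 → ∑ s, f s * biRes (-1) q (D.mod2 ψ) s = 0 := by
    intro f hf
    have hf' : D.diff 0 (biRes (-1) q f) = 0 := by
      rw [← biRes_diff, hf]
      funext s
      simp [biRes]
    have hF := intLift_mem_CKh (biRes_mem (-1) q f)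
    have hdF := diff_mem_CKh hF
    rw [neg_add_cancel] at hdF
    obtain ⟨g, hg, hFg⟩ := exists_two_smul_of_mod2_eq_zero hdF
      (by rw [mod2_diff, mod2_intLift, hf'])
    obtain ⟨k, -, hk⟩ := D.exists_of_sq1_eq_zero hT (by simpa using hF) hg hFg
    have h4 := sum_diff_mul 0 (intLift (biRes (-1) q f)) (intLift (biRes 0 q φ))
    rw [hψ, hFg, sum_mul_two_smul] at h4
    have h5 : ∑ t, (2 • g) t * intLift (biRes 0 q φ) t =
        2 * ∑ t, g t * intLift (biRes 0 q φ) t := by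
      rw [← sum_mul_two_smul]
      refine Finset.sum_congr rfl fun t _ => ?_
      simp only [Pi.smul_apply, nsmul_eq_mul]; ring
    rw [h5] at h4
    have h6 : ∑ t, g t * intLift (biRes 0 q φ) t = ∑ s, intLift (biRes (-1) q f) s * ψ s := by
      omega
    have h7 := congrArg (Int.cast : ℤ → ZMod 2) h6
    push_cast at h7
    have h8 : ∀ (k : D.State → ZMod 2) s, ((intLift k s : ℤ) : ZMod 2) = k s := fun k s =>
      congrFun (mod2_intLift k) s
    simp only [h8] at h7
    have h9 : ∑ t, (g t : ZMod 2) * biRes 0 q φ t = 0 := by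
      change ∑ t, D.mod2 g t * biRes 0 q φ t = 0
      rw [hk, sum_diff_mul, hφ]
      simp
    rw [h9] at h7
    rw [h7]
    refine Finset.sum_congr rfl fun s _ => ?_
    rw [biRes, biRes]
    split_ifs
    · rfl
    · simp
  -- So `ψ` is mod 2 the coboundary of some `κ`, and subtracting `2 κ` from the lift makes its
  -- coboundary divisible by 4.
  obtain ⟨κ, hκ⟩ := exists_codiff_eq _ hψker
  have h4 := codiff_sub_two_smul (intLift (biRes 0 q φ)) (intLift κ)
  obtain ⟨Ψ, -, hΨ⟩ := exists_two_smul_of_mod2_eq_zero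
    (htop (biRes (-1) q (ψ - codiff 0 (intLift κ)))) (by
      have h5 := hκ
      funext s
      have h6 := congrFun h5 s
      rw [mod2, biRes]
      rw [biRes] at h6
      split_ifs with hs
      · rw [if_pos hs] at h6
        have h7 := congrFun (codiff_mod2 (intLift κ)) s
        rw [mod2_intLift, h6] at h7
        change ((ψ s - codiff 0 (intLift κ) s : ℤ) : ZMod 2) = 0
        rw [Int.cast_sub]
        change (ψ s : ZMod 2) - D.mod2 (codiff 0 (intLift κ)) s = 0
        rw [h7]
        exact sub_self _
      · exact Int.cast_zero)
  refine ⟨biRes 0 q (intLift (biRes 0 q φ) - 2 • intLift κ), biRes_mem _ _ _, ?_, Ψ, ?_⟩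
  · funext s
    rw [mod2, biRes]
    split_ifs with hs
    · have := congrFun (mod2_sub (intLift (biRes 0 q φ)) (2 • intLift κ)) s
      rw [mod2_two_smul, mod2_intLift, sub_zero] at this
      exact this
    · rw [biRes, if_neg hs, Int.cast_zero]
  · have h5 := codiff_biRes (D := D.toPreDiagram) (-1) q (intLift (biRes 0 q φ) - 2 • intLift κ)
    rw [neg_add_cancel] at h5
    rw [h5, h4, hψ, ← smul_sub, ← hΨ]
    funext s
    simp only [biRes, Pi.smul_apply]
    split_ifs <;> simp

end LinkDiagram

/-! ### Tensor products and contractions of graded and filtered cochains -/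

namespace PreDiagram

variable {D₁ D₂ : PreDiagram} {R : Type} [CommRing R]

theorem heightSign_eq_self (f : D₁.State → ZMod 2) : heightSign f = f := by
  funext s
  rw [heightSign, CharTwo.neg_eq, one_pow, one_mul]

theorem tensor_add (f : D₁.State → R) (g g' : D₂.State → R) :
    tensor f (g + g') = tensor f g + tensor f g' := by
  refine ext_join fun s t => ?_
  simp only [tensor_join, Pi.add_apply, mul_add]

theorem add_tensor (f f' : D₁.State → R) (g : D₂.State → R) :
    tensor (f + f') g = tensor f g + tensor f' g := by
  refine ext_join fun s t => ?_
  simp only [tensor_join, Pi.add_apply, add_mul]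

theorem tensor_zero (f : D₁.State → R) : tensor f (0 : D₂.State → R) = 0 := by
  refine ext_join fun s t => ?_
  simp only [tensor_join, Pi.zero_apply, mul_zero]

theorem zero_tensor (g : D₂.State → R) : tensor (0 : D₁.State → R) g = 0 := by
  refine ext_join fun s t => ?_
  simp only [tensor_join, Pi.zero_apply, zero_mul]

theorem tensor_two_smul (f : D₁.State → R) (g : D₂.State → R) :
    tensor f (2 • g) = 2 • tensor f g := by
  rw [two_nsmul, two_nsmul, tensor_add]

theorem two_smul_tensor (f : D₁.State → R) (g : D₂.State → R) :
    tensor (2 • f) g = 2 • tensor f g := by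
  rw [two_nsmul, two_nsmul, add_tensor]

theorem contract_two_smul (φ : D₂.State → R) (F : (D₁.disjUnion D₂).State → R) :
    contract φ (2 • F) = 2 • contract φ F := by
  rw [two_nsmul, two_nsmul, contract_add]

theorem two_smul_contract (φ : D₂.State → R) (F : (D₁.disjUnion D₂).State → R) :
    contract (2 • φ) F = 2 • contract φ F := by
  funext s
  simp only [contract, two_nsmul, Pi.add_apply, mul_add, Finset.sum_add_distrib]

theorem heightSign_two_smul (f : D₁.State → R) : heightSign (2 • f) = 2 • heightSign f := by
  funext s
  simp only [heightSign, two_nsmul, Pi.add_apply, mul_add]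

theorem mod2_tensor (f : D₁.State → ℤ) (g : D₂.State → ℤ) :
    (D₁.disjUnion D₂).mod2 (tensor f g) = tensor (D₁.mod2 f) (D₂.mod2 g) := by
  refine ext_join fun s t => ?_
  rw [tensor_join, mod2, tensor_join, Int.cast_mul]
  rfl

theorem mod2_contract (φ : D₂.State → ℤ) (F : (D₁.disjUnion D₂).State → ℤ) :
    D₁.mod2 (contract φ F) = contract (D₂.mod2 φ) ((D₁.disjUnion D₂).mod2 F) := by
  funext s
  rw [mod2, contract]
  push_cast
  rfl

theorem mem_supported_of_join {P : (D₁.disjUnion D₂).State → Prop}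
    {F : (D₁.disjUnion D₂).State → R} (h : ∀ s t, F (join s t) ≠ 0 → P (join s t)) :
    F ∈ (D₁.disjUnion D₂).supported R P := by
  intro r hr
  obtain ⟨⟨s, t⟩, rfl⟩ := join_surjective r
  by_contra hne
  exact hr (h s t hne)

theorem of_mem_supported {D : PreDiagram} {P : D.State → Prop} {f : D.State → R}
    (hf : f ∈ D.supported R P) {s : D.State} (hs : f s ≠ 0) : P s := by
  by_contra h
  exact hs (hf s h)

theorem exists_of_contract_ne_zero {φ : D₂.State → R} {F : (D₁.disjUnion D₂).State → R}
    {s : D₁.State} (h : contract φ F s ≠ 0) : ∃ t, F (join s t) ≠ 0 ∧ φ t ≠ 0 := by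
  obtain ⟨t, -, ht⟩ := Finset.exists_ne_zero_of_sum_ne_zero h
  exact ⟨t, left_ne_zero_of_mul ht, right_ne_zero_of_mul ht⟩

theorem tensor_mem_filt {p q : ℤ} {f : D₁.State → ZMod 2} {g : D₂.State → ZMod 2}
    (hf : f ∈ D₁.filt p) (hg : g ∈ D₂.filt q) : tensor f g ∈ (D₁.disjUnion D₂).filt (p + q) := by
  refine mem_supported_of_join fun s t h => ?_
  rw [tensor_join] at h
  rw [qdeg_join]
  exact add_le_add (of_mem_supported hf (left_ne_zero_of_mul h))
    (of_mem_supported hg (right_ne_zero_of_mul h))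

theorem tensor_mem_supported_hdeg {i j : ℤ} {f : D₁.State → R} {g : D₂.State → R}
    (hf : f ∈ D₁.supported R fun s => D₁.hdeg s = i)
    (hg : g ∈ D₂.supported R fun s => D₂.hdeg s = j) :
    tensor f g ∈ (D₁.disjUnion D₂).supported R fun r => (D₁.disjUnion D₂).hdeg r = i + j := by
  refine mem_supported_of_join fun s t h => ?_
  rw [tensor_join] at h
  rw [hdeg_join, of_mem_supported hf (left_ne_zero_of_mul h),
    of_mem_supported hg (right_ne_zero_of_mul h)]

theorem tensor_mem_CKh {i j p q : ℤ} {f : D₁.State → R} {g : D₂.State → R}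
    (hf : f ∈ D₁.CKh R i p) (hg : g ∈ D₂.CKh R j q) :
    tensor f g ∈ (D₁.disjUnion D₂).CKh R (i + j) (p + q) := by
  refine mem_supported_of_join fun s t h => ?_
  rw [tensor_join] at h
  have h1 := of_mem_supported hf (left_ne_zero_of_mul h)
  have h2 := of_mem_supported hg (right_ne_zero_of_mul h)
  rw [hdeg_join, qdeg_join, h1.1, h1.2, h2.1, h2.2]
  exact ⟨rfl, rfl⟩

theorem component_tensor {p q : ℤ} {f : D₁.State → ZMod 2} {g : D₂.State → ZMod 2}
    (hf : f ∈ D₁.filt p) (hg : g ∈ D₂.filt q) :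
    (D₁.disjUnion D₂).component (p + q) (tensor f g) =
      tensor (D₁.component p f) (D₂.component q g) := by
  refine ext_join fun s t => ?_
  rw [component_apply, tensor_join, tensor_join, component_apply, component_apply, qdeg_join]
  by_cases h : f s * g t = 0
  · rw [h, ite_self]
    split_ifs <;> simp [h]
  · have h1 := of_mem_supported hf (left_ne_zero_of_mul h)
    have h2 := of_mem_supported hg (right_ne_zero_of_mul h)
    by_cases h3 : D₁.qdeg s = p
    · by_cases h4 : D₂.qdeg t = q
      · rw [if_pos h3, if_pos h4, if_pos (by rw [h3, h4])]
      · rw [if_neg h4, mul_zero, if_neg (by omega)]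
    · rw [if_neg h3, zero_mul, if_neg (by omega)]

theorem contract_mem_filt {p q : ℤ} {φ : D₂.State → ZMod 2} (hφ : ∀ t, q < D₂.qdeg t → φ t = 0)
    {F : (D₁.disjUnion D₂).State → ZMod 2} (hF : F ∈ (D₁.disjUnion D₂).filt (p + q)) :
    contract φ F ∈ D₁.filt p := by
  intro s hs
  by_contra h
  obtain ⟨t, h1, h2⟩ := exists_of_contract_ne_zero h
  have h3 : p + q ≤ _ := of_mem_supported hF h1
  rw [qdeg_join] at h3
  exact h2 (hφ t (by omega))

theorem contract_mem_supported_hdeg {i : ℤ} {φ : D₂.State → R}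
    (hφ : ∀ t, D₂.hdeg t ≠ 0 → φ t = 0) {F : (D₁.disjUnion D₂).State → R}
    (hF : F ∈ (D₁.disjUnion D₂).supported R fun r => (D₁.disjUnion D₂).hdeg r = i) :
    contract φ F ∈ D₁.supported R fun s => D₁.hdeg s = i := by
  intro s hs
  by_contra h
  obtain ⟨t, h1, h2⟩ := exists_of_contract_ne_zero h
  have h3 : _ = i := of_mem_supported hF h1
  rw [hdeg_join] at h3
  exact h2 (hφ t (by omega))

theorem contract_mem_CKh {i p q : ℤ} {φ : D₂.State → R} (hφ : φ ∈ D₂.CKh R 0 q)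
    {F : (D₁.disjUnion D₂).State → R} (hF : F ∈ (D₁.disjUnion D₂).CKh R i (p + q)) :
    contract φ F ∈ D₁.CKh R i p := by
  intro s hs
  by_contra h
  obtain ⟨t, h1, h2⟩ := exists_of_contract_ne_zero h
  have h3 := of_mem_supported hF h1
  have h4 := of_mem_supported hφ h2
  rw [hdeg_join, qdeg_join] at h3
  exact hs ⟨by omega, by omega⟩

theorem component_contract {p q : ℤ} {φ : D₂.State → ZMod 2} (h0 : ∀ t, D₂.hdeg t ≠ 0 → φ t = 0)
    (hφ : ∀ t, q < D₂.qdeg t → φ t = 0) {F : (D₁.disjUnion D₂).State → ZMod 2}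
    (hF : F ∈ (D₁.disjUnion D₂).filt (p + q)) :
    D₁.component p (contract φ F) =
      contract (biRes 0 q φ) ((D₁.disjUnion D₂).component (p + q) F) := by
  funext s
  have h1 : D₁.component p (contract φ F) s =
      ∑ t, if D₁.qdeg s = p then F (join s t) * φ t else 0 := by
    rw [component_apply, contract]
    split_ifs <;> simp
  rw [h1, contract]
  refine Finset.sum_congr rfl fun t _ => ?_
  rw [component_apply, biRes, qdeg_join]
  by_cases h : F (join s t) * φ t = 0
  · rw [h, ite_self]
    split_ifs <;> simp [h]
  · have h2 : p + q ≤ _ := of_mem_supported hF (left_ne_zero_of_mul h)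
    have h3 : D₂.qdeg t ≤ q := not_lt.1 fun h4 => right_ne_zero_of_mul h (hφ t h4)
    have h4 : D₂.hdeg t = 0 := by
      by_contra h5
      exact right_ne_zero_of_mul h (h0 t h5)
    rw [qdeg_join] at h2
    by_cases h5 : D₁.qdeg s = p
    · have h6 : D₂.qdeg t = q := by omega
      rw [if_pos h5, if_pos (by rw [h5, h6]), if_pos ⟨h4, h6⟩]
    · rw [if_neg h5]
      by_cases h6 : D₂.qdeg t = q
      · rw [if_neg (by omega), zero_mul]
      · rw [if_neg (c := _ ∧ _) fun h7 => h6 h7.2, mul_zero]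

/-- Replacing first `c` and then `d` by a cohomologous cocycle changes `c ⊗ d` by the coboundaries
of `k ⊗ (d + d l)` and `c ⊗ l`. -/
theorem tensor_add_diff {c k : D₁.State → ZMod 2} {d l : D₂.State → ZMod 2} (hc : D₁.diff 1 c = 0)
    (hd : D₂.diff 1 (d + D₂.diff 1 l) = 0) :
    tensor c d + (D₁.disjUnion D₂).diff 1 (tensor k (d + D₂.diff 1 l) + tensor c l) =
      tensor (c + D₁.diff 1 k) (d + D₂.diff 1 l) := by
  rw [map_add, diff_tensor, hd, tensor_zero, add_zero, diff_tensor, hc, zero_tensor, zero_add,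
    heightSign_eq_self, add_tensor, tensor_add, tensor_add]
  abel

/-- Divisibility by 4 in the second factor leaves its Leibniz term even after halving, so the
Bockstein of the product is `g ⊗ k` mod 2. -/
theorem diff_tensor_of_eq_two_smul {f g : D₁.State → ℤ} {k l : D₂.State → ℤ}
    (hf : D₁.diff 0 f = 2 • g) (hk : D₂.diff 0 k = 2 • 2 • l) :
    (D₁.disjUnion D₂).diff 0 (tensor f k) = 2 • (tensor g k + 2 • tensor (heightSign f) l) := by
  rw [diff_tensor, hf, hk, two_smul_tensor, tensor_two_smul, tensor_two_smul, smul_add]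

/-- Dually, contraction with a functional that is a cocycle mod 4 respects Bockstein relations,
since the error term remains even after halving. -/
theorem diff_contract_of_eq_two_smul {φ ψ : D₂.State → ℤ} {F G : (D₁.disjUnion D₂).State → ℤ}
    (hφ : codiff 0 φ = 2 • 2 • ψ) (hF : (D₁.disjUnion D₂).diff 0 F = 2 • G) :
    D₁.diff 0 (contract φ F) = 2 • (contract φ G - 2 • heightSign (contract ψ F)) := by
  have h := contract_diff 0 φ F
  rw [hφ, two_smul_contract, two_smul_contract, heightSign_two_smul, heightSign_two_smul, hF,
    contract_two_smul] at h
  rw [smul_sub, h, add_sub_cancel_right]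

theorem mem_supported_of_two_smul {D : PreDiagram} {P : D.State → Prop} {f : D.State → ℤ}
    (h : 2 • f ∈ D.supported ℤ P) : f ∈ D.supported ℤ P := by
  intro s hs
  have := h s hs
  simpa using this

end PreDiagram

open PreDiagram

namespace LinkDiagram

variable (L T : LinkDiagram)

/-! ### The invariants of a split union -/

/-- A product of representatives of canonical classes represents a canonical class. -/
theorem exists_tensor_eq {b : Bool} {k : L.State → ZMod 2} {l : T.State → ZMod 2}
    (hk : k ∈ L.supported (ZMod 2) fun s => L.hdeg s = -1)
    (hl : l ∈ T.supported (ZMod 2) fun s => T.hdeg s = -1) :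
    ∃ m ∈ (L.disjUnion T).supported (ZMod 2) fun s => (L.disjUnion T).hdeg s = -1,
      (L.disjUnion T).canonical b + (L.disjUnion T).diff 1 m =
        tensor (L.canonical b + L.diff 1 k) (T.canonical b + T.diff 1 l) := by
  refine ⟨tensor k (T.canonical b + T.diff 1 l) + tensor (L.canonical b) l, add_mem ?_ ?_, ?_⟩
  · exact tensor_mem_supported_hdeg (j := 0) hk (T.canonical_add_diff_mem_ZBN b hl).2
  · exact tensor_mem_supported_hdeg (i := 0) (j := -1) (L.canonical_mem_supported b) hl
  · rw [canonical_disjUnion]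
    exact tensor_add_diff (L.diff_canonical b) (T.canonical_add_diff_mem_ZBN b hl).1

theorem canonicalIn_filt_disjUnion {p q : ℤ} (hL : L.CanonicalIn (L.filt p))
    (hT : T.CanonicalIn (T.filt q)) :
    (L.disjUnion T).CanonicalIn ((L.disjUnion T).filt (p + q)) := by
  intro b
  obtain ⟨k, hk, hu⟩ := hL b
  obtain ⟨l, hl, hw⟩ := hT b
  obtain ⟨m, hm, h⟩ := exists_tensor_eq L T (b := b) hk hl
  exact ⟨m, hm, h ▸ tensor_mem_filt hu hw⟩

/-- Contraction with the cocycle `φ` is a chain map, and it takes `c_L ⊗ c_T` to `φ(c_T) c_L = c_L`.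
-/
theorem contract_canonical_add_diff {φ : T.State → ZMod 2} (h1 : codiff 1 φ = 0) {b : Bool}
    (h4 : ∑ t, T.canonical b t * φ t = 1) (k : (L.disjUnion T).State → ZMod 2) :
    contract (D₁ := L.toPreDiagram) φ
        ((L.disjUnion T).canonical b + (L.disjUnion T).diff 1 k) =
      L.canonical b + L.diff 1 (contract φ k) := by
  rw [canonical_disjUnion]
  refine (contract_add _ _ _).trans (congrArg₂ (· + ·) ?_ ?_)
  · rw [contract_tensor, h4]
    funext s
    rw [one_mul]
  · refine (contract_diff 1 φ k).trans ?_
    rw [h1, heightSign_eq_self]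
    funext s
    simp [contract]

/-- The functional lives in degrees at most `s(T) - 1`, so contraction lowers the filtration degree
by no more than that. -/
theorem canonicalIn_filt_of_disjUnion {p : ℤ}
    (h : (L.disjUnion T).CanonicalIn ((L.disjUnion T).filt (p + (T.s - 1)))) :
    L.CanonicalIn (L.filt p) := by
  obtain ⟨φ, h1, h2, h3, h4⟩ := T.exists_functional
  intro b
  obtain ⟨k, hk, hz⟩ := h b
  refine ⟨contract φ k, contract_mem_supported_hdeg h2 hk, ?_⟩
  rw [← contract_canonical_add_diff L T h1 (h4 b)]
  exact contract_mem_filt (fun t ht => h3 t (by omega)) hz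

theorem s_disjUnion : (L.disjUnion T).s = L.s + T.s - 1 := by
  have hc := card_component_disjUnion L T
  have hL := L.s_sub_one_modEq
  have hT := T.s_sub_one_modEq
  have hU := (L.disjUnion T).s_sub_one_modEq
  rw [hc] at hU
  push_cast at hU
  have h1 : (L.s - 1) + (T.s - 1) ≤ (L.disjUnion T).s - 1 := by
    refine ((L.disjUnion T).canonicalIn_filt_iff ?_).1 (canonicalIn_filt_disjUnion L T
      ((L.canonicalIn_filt_iff hL).2 le_rfl) ((T.canonicalIn_filt_iff hT).2 le_rfl))
    rw [hc]
    push_cast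
    exact hL.add hT
  have h2 : (L.disjUnion T).s - 1 - (T.s - 1) ≤ L.s - 1 := by
    refine (L.canonicalIn_filt_iff ?_).1 (canonicalIn_filt_of_disjUnion L T ?_)
    · simp only [Int.ModEq] at *
      omega
    · rw [sub_add_cancel]
      exact ((L.disjUnion T).canonicalIn_filt_iff (by rw [hc]; push_cast; exact hU)).2 le_rfl
  omega

variable {T}

/-- If `Sq¹` vanishes, then it does not refine `s`. -/
theorem not_canonicalIn_sq1Filt
    (hT : ∀ (x : T.Kh (ZMod 2) (0 - 1) (T.s - 1)) (y : T.Kh (ZMod 2) 0 (T.s - 1)),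
      T.IsSq1 0 (T.s - 1) x y → y = 0) :
    ¬ T.CanonicalIn (T.sq1Filt (T.s - 1)) := by
  intro h
  refine T.not_canonicalIn_filt fun b => ?_
  obtain ⟨k, hk, hu, hc⟩ := h b
  obtain ⟨f, hf, g, hg, hfg, hz⟩ := T.mem_sq1Cocycles.1 hc
  obtain ⟨l, hl, h1⟩ := T.exists_of_sq1_eq_zero hT hf hg hfg
  have hlf : l ∈ T.filt (T.s - 1) := fun s hs => hl s fun h2 => hs h2.2.ge
  have hlc : T.component (T.s - 1) l = l := by
    funext s
    rw [component_apply]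
    split_ifs with h2
    · rfl
    · exact (hl s fun h3 => h2 h3.2).symm
  -- The leading term is the Khovanov coboundary of `l`. Subtracting the Bar-Natan coboundary of `l`
  -- removes it, and by parity the filtration degree jumps to `s + 1`.
  refine ⟨k - l, sub_mem hk fun s hs => hl s fun h2 => hs h2.1, ?_⟩
  rw [map_sub, ← add_sub_assoc, show T.s + 1 = T.s - 1 + 2 by ring,
    ← T.filt_add_two T.s_sub_one_modEq]
  refine mem_filt_of_component (sub_mem hu (diff_mem_filt hlf)) ?_
  rw [map_sub, component_diff hlf, hlc, ← h1, hz, sub_self]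

/-- The leading term of a product is the product of the leading terms. The one from `T` is a
Khovanov cocycle of degree 0, and as `Sq¹` vanishes on it, it lifts to a cocycle mod 4. Multiplying
the Bockstein relation of `L` by this lift gives the one required. -/
theorem canonicalIn_sq1Filt_disjUnion
    (hT : ∀ (x : T.Kh (ZMod 2) (1 - 1) (T.s - 1)) (y : T.Kh (ZMod 2) 1 (T.s - 1)),
      T.IsSq1 1 (T.s - 1) x y → y = 0) {p : ℤ} (h : L.CanonicalIn (L.sq1Filt p)) :
    (L.disjUnion T).CanonicalIn ((L.disjUnion T).sq1Filt (p + (T.s - 1))) := by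
  intro b
  obtain ⟨k, hk, hu, hc⟩ := h b
  obtain ⟨l, hl, hw⟩ := (T.canonicalIn_filt_iff T.s_sub_one_modEq).2 le_rfl b
  obtain ⟨m, hm, hmk⟩ := exists_tensor_eq L T (b := b) hk hl
  obtain ⟨f, hf, g, hg, hfg, hz⟩ := L.mem_sq1Cocycles.1 hc
  refine ⟨m, hm, hmk ▸ tensor_mem_filt hu hw, ?_⟩
  change (L.disjUnion T).component _ _ ∈ (L.disjUnion T).sq1Cocycles 0 _
  rw [hmk, LinkDiagram.mem_sq1Cocycles]
  have hZ := T.canonical_add_diff_mem_ZBN b hl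
  set w := T.canonical b + T.diff 1 l
  set q := T.s - 1
  have hwq : T.component q w ∈ T.CKh (ZMod 2) 0 q := by
    intro s hs
    rw [component_apply]
    split_ifs with h1
    · exact hZ.2 s fun h2 => hs ⟨h2, h1⟩
    · rfl
  have hdw : T.diff 0 (T.component q w) = 0 := by
    rw [← component_diff hw, show T.diff 1 w = 0 from hZ.1, map_zero]
  have hV := intLift_mem_CKh hwq
  obtain ⟨x, hx, hVx⟩ := exists_two_smul_of_mod2_eq_zero (diff_mem_CKh hV)
    (by rw [mod2_diff, mod2_intLift, hdw])
  obtain ⟨y, hy, hxy⟩ := T.exists_of_sq1_eq_zero hT (by simpa using hV)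
    hx hVx
  rw [sub_self] at hy
  have hY := intLift_mem_CKh hy
  obtain ⟨z, -, hxz⟩ := exists_two_smul_of_mod2_eq_zero (P := fun _ => True)
    (f := x - T.diff 0 (intLift y)) (fun s hs => absurd trivial hs)
    (by rw [mod2_sub, mod2_diff, mod2_intLift, hxy, sub_self])
  -- The Bockstein `x` of the first lift is mod 2 the coboundary of `y`, so this correction of the
  -- lift has coboundary `2 (x - d y) = 4 z`.
  let V := intLift (T.component q w) - 2 • intLift y
  have hVC : V ∈ T.CKh ℤ 0 q := sub_mem hV (Submodule.smul_of_tower_mem _ 2 hY)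
  have hVd : T.diff 0 V = 2 • 2 • z := by
    rw [map_sub, map_nsmul, hVx, ← smul_sub, hxz]
  have hVm : T.mod2 V = T.component q w := by
    rw [mod2_sub, mod2_two_smul, mod2_intLift, sub_zero]
  have hF : tensor f V ∈ (L.disjUnion T).CKh ℤ (0 - 1) (p + q) :=
    tensor_mem_CKh (i := 0 - 1) (j := 0) hf hVC
  have hd := diff_tensor_of_eq_two_smul hfg hVd
  have hG := diff_mem_CKh hF
  rw [sub_add_cancel] at hG
  refine ⟨tensor f V, hF, _, mem_supported_of_two_smul (hd ▸ hG), hd, ?_⟩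
  refine (component_tensor hu hw).trans (Eq.trans ?_ (mod2_add _ _).symm)
  rw [mod2_two_smul, add_zero, mod2_tensor, hVm]
  exact congrArg (fun v => tensor v _) hz

theorem canonicalIn_sq1Filt_of_disjUnion
    (hT : ∀ (x : T.Kh (ZMod 2) (0 - 1) (T.s - 1)) (y : T.Kh (ZMod 2) 0 (T.s - 1)),
      T.IsSq1 0 (T.s - 1) x y → y = 0) {p : ℤ}
    (h : (L.disjUnion T).CanonicalIn ((L.disjUnion T).sq1Filt (p + (T.s - 1)))) :
    L.CanonicalIn (L.sq1Filt p) := by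
  obtain ⟨φ, h1, h2, h3, h4⟩ := T.exists_functional
  obtain ⟨Φ, hΦ, hΦφ, Ψ, hΨ⟩ := T.exists_integral_functional hT h1 h2 h3
  have h5 : ∀ t, T.s - 1 < T.qdeg t → φ t = 0 := fun t ht => h3 t (by omega)
  intro b
  obtain ⟨k, hk, hz, hc⟩ := h b
  obtain ⟨f, hf, g, hg, hfg, hz'⟩ := (L.disjUnion T).mem_sq1Cocycles.1 hc
  refine ⟨contract φ k, contract_mem_supported_hdeg h2 hk, ?_⟩
  rw [← contract_canonical_add_diff L T h1 (h4 b)]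
  refine ⟨contract_mem_filt h5 hz, ?_⟩
  change L.component p _ ∈ L.sq1Cocycles 0 p
  -- The leading term of the contraction involves only the part of `φ` in degree `s(T) - 1`, which
  -- `Φ` lifts integrally.
  rw [component_contract h2 h5 hz, L.mem_sq1Cocycles]
  have hF : contract Φ f ∈ L.CKh ℤ (0 - 1) p := contract_mem_CKh hΦ hf
  have hd := diff_contract_of_eq_two_smul hΨ hfg
  have hG := diff_mem_CKh hF
  rw [sub_add_cancel] at hG
  refine ⟨_, hF, _, mem_supported_of_two_smul (hd ▸ hG), hd, ?_⟩
  rw [mod2_sub, mod2_two_smul, sub_zero]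
  refine Eq.trans ?_ (mod2_contract Φ g).symm
  rw [hΦφ]
  exact congrArg _ hz'

end LinkDiagram

end Khovanov

/-! ### The additivity formula -/

theorem mainTheorem3 (T : Khovanov.LinkDiagram)
    (hT : ∀ i : ℤ, i = 0 ∨ i = 1 →
      ∀ (x : T.Kh (ZMod 2) (i - 1) (T.s - 1)) (y : T.Kh (ZMod 2) i (T.s - 1)),
        T.IsSq1 i (T.s - 1) x y → y = 0)
    (L : Khovanov.LinkDiagram) :
    (L.disjUnion T).sPlusSq1 = L.sPlusSq1 + T.sPlusSq1 - 1 := by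
  have hs := Khovanov.LinkDiagram.s_disjUnion L T
  have h0 := hT 0 (Or.inl rfl)
  have h1 : (L.disjUnion T).CanonicalIn ((L.disjUnion T).sq1Filt ((L.disjUnion T).s - 1)) ↔
      L.CanonicalIn (L.sq1Filt (L.s - 1)) := by
    rw [hs, show L.s + T.s - 1 - 1 = L.s - 1 + (T.s - 1) by ring]
    exact ⟨L.canonicalIn_sq1Filt_of_disjUnion h0,
      L.canonicalIn_sq1Filt_disjUnion (hT 1 (Or.inr rfl))⟩
  -- As `T` is not refined, the formula is additivity of `s - 1`, with the same increment 0 or 2 for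
  -- `L` and for `L ⊔ T`.
  rw [Khovanov.LinkDiagram.sPlusSq1_eq, L.sPlusSq1_eq, T.sPlusSq1_eq,
    if_neg (Khovanov.LinkDiagram.not_canonicalIn_sq1Filt h0)]
  by_cases h : L.CanonicalIn (L.sq1Filt (L.s - 1))
  · rw [if_pos h, if_pos (h1.2 h)]
    omega
  · rw [if_neg h, if_neg (mt h1.1 h)]
    omega
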